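/- An instance $\mathcal I=(G,[r],f,t,k)$ of Partition Color Constrained Dominating Set (PCCDS) consists of a bipartite graph $G=(A\uplus B,E)$, a surjective colouring $f:B\to[r]$, a coverage requirement $t_j\in\mathbb Z_{\ge 0}$ for each colour $j\in[r]$, and an integer $k\ge 0$. For $S\subseteq A$, let $N_j(S)$ be the set of vertices of colour $j$ in $B$ that are adjacent to at least one vertex of $S$. The instance is a yes-instance if some $S\subseteq A$ with $|S|\le k$ satisfies $|N_j(S)|\ge t_j$ for every $j\in[r]$. The graph $G$ is $K_{d,d}$-free if there are no $d$ vertices of $A$ and $d$ vertices of $B$ such that each of the former is adjacent to each of the latter. Let $n+m=|A|+|B|$ be the number of vertices of $G$. Theorem. There is a single deterministic algorithm which takes as input an instance $\mathcal I$ of PCCDS and a rational $\varepsilon>0$ (with $G$ given by its adjacency matrix, and $\varepsilon$ by its numerator and denominator) and has the following properties whenever $d$ is such that $G$ is $K_{d,d}$-free. 1. It halts within $2^{O(k^4r^2d\log(r+1)/\varepsilon)}\cdot(n+m+1)^{O(1)}$ steps, that is, within $C\cdot 2^{C k^4r^2d\log(r+1)/\varepsilon}\,(n+m+1)^{C}$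 steps, where $C$ is an absolute constant. 2. If $\mathcal I$ is a yes-instance, then it outputs a set $S\subseteq A$ with $|S|\le k$ and $|N_j(S)|\ge(1-\varepsilon)t_j$ for every $j\in[r]$. Steps are counted on a random access machine with natural-number registers and arrays, in which constants, reads, writes, addition, truncated subtraction and comparison cost one step each, and multiplication and division are not available as elementary operations. -/

import Mathlib

/-! ## A deterministic random access machine

Programs are structured (sequence, conditional, while loop) and work on scalar registers and on
arrays, all holding natural numbers; array cells are addressed indirectly.  The arithmetic is
addition and truncated subtraction only.  Every elementary operation (constant, register read,
array read, addition, subtraction, comparison, assignment) costs one step.  There is no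
unit-cost multiplication, so numbers grow by at most one bit per step and the model is
polynomially equivalent to Turing machines. -/

/-- Memory: scalar registers `reg x`, and arrays `arr a` with cells `arr a i`. A program mentions
only finitely many registers and arrays. -/
structure RamState where
  reg : ℕ → ℕ
  arr : ℕ → ℕ → ℕ

/-- Arithmetic expressions. In `get a e` the array name `a` is fixed in the program, and the index
`e` is computed at run time. -/
inductive RamExpr where
  | lit (c : ℕ)
  | var (x : ℕ)
  | get (a : ℕ) (e : RamExpr)
  | add (e₁ e₂ : RamExpr)
  | sub (e₁ e₂ : RamExpr)

/-- The value of an expression. -/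
def RamExpr.eval (s : RamState) : RamExpr → ℕ
  | .lit c => c
  | .var x => s.reg x
  | .get a e => s.arr a (e.eval s)
  | .add e₁ e₂ => e₁.eval s + e₂.eval s
  | .sub e₁ e₂ => e₁.eval s - e₂.eval s

/-- The number of steps for evaluating an expression: one per operation. -/
def RamExpr.cost : RamExpr → ℕ
  | .lit _ => 1
  | .var _ => 1
  | .get _ e => e.cost + 1
  | .add e₁ e₂ => e₁.cost + e₂.cost + 1
  | .sub e₁ e₂ => e₁.cost + e₂.cost + 1

/-- Programs. -/
inductive RamProg where
  /-- do nothing -/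
  | skip
  /-- `reg x := e` -/
  | assign (x : ℕ) (e : RamExpr)
  /-- `arr a i := e` -/
  | store (a : ℕ) (i e : RamExpr)
  /-- `p; q` -/
  | seq (p q : RamProg)
  /-- `if e₁ < e₂ then p else q` -/
  | ifLt (e₁ e₂ : RamExpr) (p q : RamProg)
  /-- `while e₁ < e₂ do p` -/
  | whileLt (e₁ e₂ : RamExpr) (p : RamProg)

/-- `RamExec p s T s'`: the program `p`, started in state `s`, halts after exactly `T` steps in
state `s'`. -/
inductive RamExec : RamProg → RamState → ℕ → RamState → Prop where
  | skip (s : RamState) : RamExec .skip s 1 s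
  | assign (x : ℕ) (e : RamExpr) (s : RamState) :
      RamExec (.assign x e) s (e.cost + 1)
        ⟨Function.update s.reg x (e.eval s), s.arr⟩
  | store (a : ℕ) (i e : RamExpr) (s : RamState) :
      RamExec (.store a i e) s (i.cost + e.cost + 1)
        ⟨s.reg, Function.update s.arr a
          (Function.update (s.arr a) (i.eval s) (e.eval s))⟩
  | seq {p q : RamProg} {s s' s'' : RamState} {T T' : ℕ} :
      RamExec p s T s' → RamExec q s' T' s'' → RamExec (.seq p q) s (T + T') s''
  | ifTrue {e₁ e₂ : RamExpr} {p q : RamProg} {s s' : RamState} {T : ℕ} :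
      e₁.eval s < e₂.eval s → RamExec p s T s' →
      RamExec (.ifLt e₁ e₂ p q) s (e₁.cost + e₂.cost + 1 + T) s'
  | ifFalse {e₁ e₂ : RamExpr} {p q : RamProg} {s s' : RamState} {T : ℕ} :
      ¬ e₁.eval s < e₂.eval s → RamExec q s T s' →
      RamExec (.ifLt e₁ e₂ p q) s (e₁.cost + e₂.cost + 1 + T) s'
  | whileTrue {e₁ e₂ : RamExpr} {p : RamProg} {s s' s'' : RamState} {T T' : ℕ} :
      e₁.eval s < e₂.eval s → RamExec p s T s' → RamExec (.whileLt e₁ e₂ p) s' T' s'' →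
      RamExec (.whileLt e₁ e₂ p) s (e₁.cost + e₂.cost + 1 + T + T') s''
  | whileFalse {e₁ e₂ : RamExpr} {p : RamProg} {s : RamState} :
      ¬ e₁.eval s < e₂.eval s →
      RamExec (.whileLt e₁ e₂ p) s (e₁.cost + e₂.cost + 1) s

/-- The machine is deterministic: running time and final state are determined by the program and
the initial state. -/
theorem RamExec.deterministic {p : RamProg} {s s₁ s₂ : RamState} {T₁ T₂ : ℕ}
    (h₁ : RamExec p s T₁ s₁) (h₂ : RamExec p s T₂ s₂) : T₁ = T₂ ∧ s₁ = s₂ := by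
  induction h₁ generalizing T₂ s₂ with
  | skip s => cases h₂; exact ⟨rfl, rfl⟩
  | assign x e s => cases h₂; exact ⟨rfl, rfl⟩
  | store a i e s => cases h₂; exact ⟨rfl, rfl⟩
  | seq _ _ ih ih' =>
    cases h₂ with
    | seq g g' =>
      obtain ⟨rfl, rfl⟩ := ih g
      obtain ⟨rfl, rfl⟩ := ih' g'
      exact ⟨rfl, rfl⟩
  | ifTrue hc _ ih =>
    cases h₂ with
    | ifTrue _ g => obtain ⟨rfl, rfl⟩ := ih g; exact ⟨rfl, rfl⟩
    | ifFalse hn _ => exact absurd hc hn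
  | ifFalse hc _ ih =>
    cases h₂ with
    | ifTrue hn _ => exact absurd hn hc
    | ifFalse _ g => obtain ⟨rfl, rfl⟩ := ih g; exact ⟨rfl, rfl⟩
  | whileTrue hc _ _ ih ih' =>
    cases h₂ with
    | whileTrue _ g g' =>
      obtain ⟨rfl, rfl⟩ := ih g
      obtain ⟨rfl, rfl⟩ := ih' g'
      exact ⟨rfl, rfl⟩
    | whileFalse hn => exact absurd hc hn
  | whileFalse hc =>
    cases h₂ with
    | whileTrue hn _ _ => exact absurd hn hc
    | whileFalse _ => exact ⟨rfl, rfl⟩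

/-! ## Partition Color Constrained Dominating Set -/

/-- An instance of PCCDS: a bipartite graph with sides `A = Fin n` and `B = Fin m`, a surjective
colouring `f` of `B` with `r` colours, coverage requirements `t` and a budget `k`. -/
structure PCCDS where
  n : ℕ
  m : ℕ
  r : ℕ
  k : ℕ
  adj : Fin n → Fin m → Bool
  f : Fin m → Fin r
  f_surj : Function.Surjective f
  t : Fin r → ℕ

namespace PCCDS

/-- `N_j(S)`: the vertices of colour `j` adjacent to at least one vertex of `S`. -/
def nbr (I : PCCDS) (j : Fin I.r) (S : Finset (Fin I.n)) : Finset (Fin I.m) :=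
  Finset.univ.filter fun b => I.f b = j ∧ ∃ a ∈ S, I.adj a b = true

/-- A yes-instance: at most `k` vertices of `A` meet all coverage requirements. -/
def IsYes (I : PCCDS) : Prop :=
  ∃ S : Finset (Fin I.n), S.card ≤ I.k ∧ ∀ j, I.t j ≤ (I.nbr j S).card

/-- The graph is `K_{d,d}`-free: no `d` vertices of `A` are all adjacent to `d` common vertices
of `B`. -/
def KFree (I : PCCDS) (d : ℕ) : Prop :=
  ¬ ∃ (X : Finset (Fin I.n)) (Y : Finset (Fin I.m)), X.card = d ∧ Y.card = d ∧
    ∀ x ∈ X, ∀ y ∈ Y, I.adj x y = true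

/-- The input of the algorithm, for a positive rational `ε`.  Registers `0,…,5` hold `n`, `m`,
`r`, `k`, and the numerator and the denominator of `ε`; array `0` holds the adjacency matrix row
by row, array `1` the colouring, array `2` the coverage requirements.  Everything else is `0`. -/
def input (I : PCCDS) (ε : ℚ) : RamState where
  reg
    | 0 => I.n
    | 1 => I.m
    | 2 => I.r
    | 3 => I.k
    | 4 => ε.num.toNat
    | 5 => ε.den
    | _ => 0
  arr
    | 0 => fun p => if ∃ (a : Fin I.n) (b : Fin I.m), p = (a : ℕ) * I.m + (b : ℕ) ∧ I.adj a b = true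
        then 1 else 0
    | 1 => fun i => if h : i < I.m then (I.f ⟨i, h⟩ : ℕ) else 0
    | 2 => fun j => if h : j < I.r then I.t ⟨j, h⟩ else 0
    | _ => fun _ => 0

/-- The output of the algorithm: the set of vertices of `A` marked in array `3`. -/
def output (I : PCCDS) (s : RamState) : Finset (Fin I.n) :=
  Finset.univ.filter fun a => s.arr 3 a ≠ 0

end PCCDS

/-!
Let `o 0, …, o (k - 1)` be a solution. The algorithm keeps, for each slot `i`, a set `X i` of
candidates for `o i`, and a set `K i` of vertices of `B` to which all candidates are adjacent in the
same way. It first guesses the degree of `o i` in every colour `j`, up to `t j / D` and capped at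
`t j`, where `D` is about `2 k / ε`. Then a greedy pass selects from every `X i` some vertex that has,
in each colour `j` not yet satisfied, an overlap of at most `t j / D` with what is already covered,
apart from the overlap in `K i`, which is the same for `o i`. If the pass succeeds, each slot loses at
most `2 t j / D` against the solution, and so the selection is good (`accepts_of_ok`). If it fails in
slot `i`, then all of `X i`, and in particular `o i`, has a larger overlap in some colour `j` with the
set `W` covered so far. The algorithm guesses this colour and the neighbours of `o i` among the
vertices of colour `j` in `W`, adds these vertices to `K i`, and repeats the pass. As `K i` grows,
some sequence of guesses leads to a successful pass (`ex_guesses`).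

The guesses form a binary tree, and the running time is governed by the number of its leaves
(`size_guesses`). If the common overlap of `X i` consists of `q` vertices, then the refinement of slot
`i` costs fewer than `r + D q` binary guesses, as fewer than `t j < D q` vertices of `W` have colour
`j`, and it yields `q` new known common neighbours. Once `d` of them are known, `X i` has fewer than
`d` members by `K_{d,d}`-freeness, and further guesses merely partition `X i`. The step in which the
number of known common neighbours jumps far beyond `d` needs an extra argument: it leaves only
vertices with at least `2 d` neighbours in `W` of colour `j` that make up the fraction `1 / D` of
these, and the counting argument of Kővári, Sós and Turán bounds the number of such vertices
(`card_le_of_kfree`). All this is expressed by a weight of the slots whose sum over the branches does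
not increase (`sum_weight_refine`). The result is a bound `2 ^ O(k r d D)` for the number of leaves.

On the machine, the leaves are visited one after the other by replaying the algorithm from its start
with the guesses read from an array of advice bits, which is incremented as a binary number after each
run; only the bits that were used take part, so that no leaf is visited twice (`rest_incr`,
`searchLoop_exec`). A single run is a program all of whose loops are counting loops. Such programs
have a denotation as functions on states, and polynomial running time (`LoopProg.exec`); thus it
remains to compare the denotation with the guessing algorithm.
-/

/-! ### Decision trees and their enumeration by binary advice -/

/-- A computation that makes binary guesses, given by the tree of its runs. -/
inductive DTree (β : Type) where
  | leaf (b : β)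
  | node (l r : DTree β)

namespace DTree

variable {β γ : Type}

/-- Continue every run of a guessing computation by another guessing computation. -/
def bind : DTree β → (β → DTree γ) → DTree γ
  | leaf b, f => f b
  | node l r, f => node (l.bind f) (r.bind f)

/-- The sum of a weight over the outcomes of all runs. -/
def sum (g : β → ℕ) : DTree β → ℕ
  | leaf b => g b
  | node l r => l.sum g + r.sum g

/-- The number of runs. -/
def size (t : DTree β) : ℕ := t.sum fun _ => 1

/-- Every run ends in an outcome with the property `P`. -/
def All (P : β → Prop) : DTree β → Prop
  | leaf b => P b
  | node l r => l.All P ∧ r.All P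

/-- Some run ends in an outcome with the property `P`. -/
def Ex (P : β → Prop) : DTree β → Prop
  | leaf b => P b
  | node l r => l.Ex P ∨ r.Ex P

/-- The list of outcomes, from left to right. -/
def toList : DTree β → List β
  | leaf b => [b]
  | node l r => l.toList ++ r.toList

/-- The largest number of guesses in a run. -/
def depth : DTree β → ℕ
  | leaf _ => 0
  | node l r => max l.depth r.depth + 1

/-- Follow the guesses prescribed by the advice `α` from position `p` on (`0` means left). The
result is the outcome and the position behind the last advice value used. -/
def walk (α : ℕ → ℕ) : DTree β → ℕ → β × ℕ
  | leaf b, p => (b, p)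
  | node l r, p => if α p = 0 then l.walk α (p + 1) else r.walk α (p + 1)

/-- Repeat a guessing computation with loop index `0, …, n - 1`. -/
def iter : ℕ → (ℕ → β → DTree β) → β → DTree β
  | 0, _, b => leaf b
  | n + 1, f, b => (iter n f b).bind (f n)

theorem sum_bind (t : DTree β) (f : β → DTree γ) (g : γ → ℕ) :
    (t.bind f).sum g = t.sum fun b => (f b).sum g := by
  induction t with
  | leaf b => rfl
  | node l r hl hr => simp [bind, sum, hl, hr]

theorem walk_bind (α : ℕ → ℕ) (t : DTree β) (f : β → DTree γ) (p : ℕ) :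
    (t.bind f).walk α p = (f (t.walk α p).1).walk α (t.walk α p).2 := by
  induction t generalizing p with
  | leaf b => rfl
  | node l r hl hr => simp only [bind, walk]; split <;> simp [hl, hr]

theorem All.mono {P Q : β → Prop} {t : DTree β} (h : t.All P) (hPQ : ∀ b, P b → Q b) :
    t.All Q := by
  induction t with
  | leaf b => exact hPQ b h
  | node l r hl hr => exact ⟨hl h.1, hr h.2⟩

theorem All.bind {P : β → Prop} {Q : γ → Prop} {t : DTree β} {f : β → DTree γ} (h : t.All P)
    (hf : ∀ b, P b → (f b).All Q) : (t.bind f).All Q := by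
  induction t with
  | leaf b => exact hf b h
  | node l r hl hr => exact ⟨hl h.1, hr h.2⟩

theorem Ex.mono_of_all {P Q R : β → Prop} {t : DTree β} (h : t.Ex P) (h' : t.All R)
    (hPQ : ∀ b, P b → R b → Q b) : t.Ex Q := by
  induction t with
  | leaf b => exact hPQ b h h'
  | node l r hl hr => exact h.imp (fun h => hl h h'.1) (fun h => hr h h'.2)

theorem Ex.bind {P : β → Prop} {Q : γ → Prop} {t : DTree β} {f : β → DTree γ} (h : t.Ex P)
    (hf : ∀ b, P b → (f b).Ex Q) : (t.bind f).Ex Q := by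
  induction t with
  | leaf b => exact hf b h
  | node l r hl hr => exact h.imp hl hr

theorem all_iter {P : ℕ → β → Prop} {f : ℕ → β → DTree β} {b : β} (n : ℕ) (h0 : P 0 b)
    (h : ∀ i < n, ∀ b, P i b → (f i b).All (P (i + 1))) : (iter n f b).All (P n) := by
  induction n with
  | zero => exact h0
  | succ n ih => exact (ih fun i hi => h i (by omega)).bind (h n (by omega))

theorem ex_iter {P : ℕ → β → Prop} {f : ℕ → β → DTree β} {b : β} (n : ℕ) (h0 : P 0 b)
    (h : ∀ i < n, ∀ b, P i b → (f i b).Ex (P (i + 1))) : (iter n f b).Ex (P n) := by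
  induction n with
  | zero => exact h0
  | succ n ih => exact (ih fun i hi => h i (by omega)).bind (h n (by omega))

theorem sum_le_of_all {P : β → Prop} {g g' : β → ℕ} {t : DTree β} (ht : t.All P)
    (h : ∀ b, P b → g b ≤ g' b) : t.sum g ≤ t.sum g' := by
  induction t with
  | leaf b => exact h b ht
  | node l r hl hr => exact add_le_add (hl ht.1) (hr ht.2)

theorem sum_add (g g' : β → ℕ) (t : DTree β) :
    (t.sum fun b => g b + g' b) = t.sum g + t.sum g' := by
  induction t with
  | leaf b => rfl
  | node l r hl hr => simp only [sum, hl, hr]; ring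

theorem sum_const (c : ℕ) (t : DTree β) : (t.sum fun _ => c) = t.size * c := by
  induction t with
  | leaf b => simp [sum, size]
  | node l r hl hr => simp only [sum, hl, hr, size]; ring

theorem one_le_size (t : DTree β) : 1 ≤ t.size := by
  induction t with
  | leaf b => exact le_rfl
  | node l r hl hr => exact hl.trans (Nat.le_add_right _ _)

theorem sum_le_size_mul {P : β → Prop} {g : β → ℕ} {t : DTree β} {c : ℕ} (ht : t.All P)
    (h : ∀ b, P b → g b ≤ c) : t.sum g ≤ t.size * c :=
  (sum_le_of_all (g' := fun _ => c) ht h).trans (sum_const c t).le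

theorem all_true (t : DTree β) : t.All fun _ => True := by
  induction t with
  | leaf b => trivial
  | node l r hl hr => exact ⟨hl, hr⟩

theorem sum_mul (a : ℕ) (g : β → ℕ) (t : DTree β) : (t.sum fun b => a * g b) = a * t.sum g := by
  induction t with
  | leaf b => rfl
  | node l r hl hr => simp only [sum, hl, hr]; ring

theorem size_iter_le {f : ℕ → β → DTree β} {c : ℕ → ℕ} (n : ℕ) (b : β)
    (h : ∀ i < n, ∀ b, (f i b).size ≤ c i) : (iter n f b).size ≤ ∏ i ∈ Finset.range n, c i := by
  induction n with
  | zero => exact le_rfl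
  | succ n ih =>
    have h1 : (iter (n + 1) f b).size = (iter n f b).sum fun b => (f n b).size :=
      sum_bind _ _ _
    rw [h1, Finset.prod_range_succ]
    exact (sum_le_size_mul (all_true _) fun b _ => h n (by omega) b).trans
      (Nat.mul_le_mul_right _ (ih fun i hi => h i (by omega)))

theorem size_iter_le_pow {f : ℕ → β → DTree β} {c : ℕ} (n : ℕ) (b : β)
    (h : ∀ i < n, ∀ b, (f i b).size ≤ c) : (iter n f b).size ≤ c ^ n := by
  simpa using size_iter_le (c := fun _ => c) n b h

theorem depth_bind_le {t : DTree β} {f : β → DTree γ} {c : ℕ} (h : ∀ b, (f b).depth ≤ c) :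
    (t.bind f).depth ≤ t.depth + c := by
  induction t with
  | leaf b => simpa [bind, depth] using h b
  | node l r hl hr => simp only [bind, depth]; omega

theorem depth_iter_le {f : ℕ → β → DTree β} {c : ℕ} (n : ℕ) (b : β)
    (h : ∀ i b, (f i b).depth ≤ c) : (iter n f b).depth ≤ n * c := by
  induction n with
  | zero => simp [iter, depth]
  | succ n ih =>
    rw [iter, Nat.succ_mul]
    exact (depth_bind_le (h n)).trans (Nat.add_le_add_right ih c)

theorem walk_le (α : ℕ → ℕ) (t : DTree β) (p : ℕ) : (t.walk α p).2 ≤ p + t.depth := by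
  induction t generalizing p with
  | leaf b => simp [walk]
  | node l r hl hr =>
    have h1 := hl (p + 1)
    have h2 := hr (p + 1)
    simp only [walk, depth]
    split <;> omega

theorem le_walk (α : ℕ → ℕ) (t : DTree β) (p : ℕ) : p ≤ (t.walk α p).2 := by
  induction t generalizing p with
  | leaf b => simp [walk]
  | node l r hl hr =>
    have h1 := hl (p + 1)
    have h2 := hr (p + 1)
    simp only [walk]
    split <;> omega

theorem All.of_mem {P : β → Prop} {t : DTree β} (h : t.All P) : ∀ b ∈ t.toList, P b := by
  induction t with
  | leaf b =>
    intro b' hb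
    rw [List.mem_singleton.1 hb]
    exact h
  | node l r hl hr =>
    simp only [toList, List.mem_append]
    rintro b (hb | hb)
    · exact hl h.1 b hb
    · exact hr h.2 b hb

theorem Ex.exists_mem {P : β → Prop} {t : DTree β} (h : t.Ex P) : ∃ b ∈ t.toList, P b := by
  induction t with
  | leaf b => exact ⟨b, by simp [toList], h⟩
  | node l r hl hr =>
    rcases h with h | h
    · obtain ⟨b, hb, hP⟩ := hl h
      exact ⟨b, by simp [toList, hb], hP⟩
    · obtain ⟨b, hb, hP⟩ := hr h
      exact ⟨b, by simp [toList, hb], hP⟩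

theorem length_toList (t : DTree β) : t.toList.length = t.size := by
  induction t with
  | leaf b => rfl
  | node l r hl hr => simp [toList, hl, hr, size, sum]

/-- Binary increment of the advice values at the positions `p, …, p + d - 1`, the last position
being the least significant one. The Boolean is the carry out of position `p`. -/
def incr (p : ℕ) : ℕ → (ℕ → ℕ) → Bool × (ℕ → ℕ)
  | 0, α => (true, α)
  | d + 1, α =>
    if α (p + d) = 0 then (false, Function.update α (p + d) 1)
    else incr p d (Function.update α (p + d) 0)

/-- The increment in terms of the most significant position. -/
theorem incr_succ (p d : ℕ) (α : ℕ → ℕ) :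
    incr p (d + 1) α =
      if (incr (p + 1) d α).1 = true then
        if (incr (p + 1) d α).2 p = 0 then (false, Function.update (incr (p + 1) d α).2 p 1)
        else (true, Function.update (incr (p + 1) d α).2 p 0)
      else incr (p + 1) d α := by
  induction d generalizing α with
  | zero => simp [incr]; rfl
  | succ d ih =>
    have e : p + (d + 1) = p + 1 + d := by omega
    rw [incr, e]
    conv_rhs => simp only [incr]
    by_cases h : α (p + 1 + d) = 0
    · simp [h]
    · simp only [h, if_false]
      exact ih _

theorem incr_of_lt (p d : ℕ) (α : ℕ → ℕ) {q : ℕ} (hq : q < p) : (incr p d α).2 q = α q := by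
  induction d generalizing α with
  | zero => rfl
  | succ d ih =>
    simp only [incr]
    split
    · exact Function.update_of_ne (by omega) _ _
    · rw [ih]
      exact Function.update_of_ne (by omega) _ _

/-- The advice from position `p` on vanishes behind the run of `t` that it describes. -/
def Valid (α : ℕ → ℕ) : DTree β → ℕ → Prop
  | leaf _, p => ∀ q, p ≤ q → α q = 0
  | node l r, p => if α p = 0 then l.Valid α (p + 1) else r.Valid α (p + 1)

/-- The outcomes of the run described by the advice and of all runs to its right. -/
def rest (α : ℕ → ℕ) : DTree β → ℕ → List β
  | leaf b, _ => [b]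
  | node l r, p => if α p = 0 then l.rest α (p + 1) ++ r.toList else r.rest α (p + 1)

theorem valid_of_zero {α : ℕ → ℕ} (t : DTree β) {p : ℕ} (h : ∀ q, p ≤ q → α q = 0) :
    t.Valid α p := by
  induction t generalizing p with
  | leaf b => exact h
  | node l r hl hr =>
    simp only [Valid, h p le_rfl, if_true]
    exact hl fun q hq => h q (by omega)

theorem rest_of_zero {α : ℕ → ℕ} (t : DTree β) {p : ℕ} (h : ∀ q, p ≤ q → α q = 0) :
    t.rest α p = t.toList := by
  induction t generalizing p with
  | leaf b => rfl
  | node l r hl hr =>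
    simp only [rest, h p le_rfl, if_true, toList]
    rw [hl fun q hq => h q (by omega)]

/-- Incrementing the advice moves on to the next run, and produces a carry after the last one. -/
theorem rest_incr {α : ℕ → ℕ} (t : DTree β) {p : ℕ} (h : t.Valid α p) :
    ((incr p ((t.walk α p).2 - p) α).1 = false →
      t.Valid (incr p ((t.walk α p).2 - p) α).2 p ∧
      t.rest α p = (t.walk α p).1 :: t.rest (incr p ((t.walk α p).2 - p) α).2 p) ∧
    ((incr p ((t.walk α p).2 - p) α).1 = true →
      (∀ q, p ≤ q → (incr p ((t.walk α p).2 - p) α).2 q = 0) ∧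
      t.rest α p = [(t.walk α p).1]) := by
  induction t generalizing p with
  | leaf b => simp [walk, incr, rest]; exact h
  | node l r hl hr =>
    by_cases h0 : α p = 0
    · simp only [Valid, h0, if_true] at h
      have hw := le_walk α l (p + 1)
      have e : (l.walk α (p + 1)).2 - p = ((l.walk α (p + 1)).2 - (p + 1)) + 1 := by omega
      obtain ⟨h1, h2⟩ := hl h
      simp only [walk, rest, h0, if_true]
      rw [e, incr_succ]
      set c := incr (p + 1) ((l.walk α (p + 1)).2 - (p + 1)) α with hc
      have hp : c.2 p = 0 := by rw [hc, incr_of_lt _ _ _ (Nat.lt_succ_self p), h0]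
      cases hc1 : c.1 with
      | false =>
        obtain ⟨h3, h4⟩ := h1 hc1
        simp [hc1, Valid, hp, h3, h4]
      | true =>
        obtain ⟨h3, h4⟩ := h2 hc1
        have hz : ∀ q, p + 1 ≤ q → Function.update c.2 p 1 q = 0 := fun q hq => by
          rw [Function.update_of_ne (by omega)]; exact h3 q hq
        simp [hp, Valid, valid_of_zero r hz, rest_of_zero r hz, h4]
    · simp only [Valid, h0, if_false] at h
      have hw := le_walk α r (p + 1)
      have e : (r.walk α (p + 1)).2 - p = ((r.walk α (p + 1)).2 - (p + 1)) + 1 := by omega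
      obtain ⟨h1, h2⟩ := hr h
      simp only [walk, rest, h0, if_false]
      rw [e, incr_succ]
      set c := incr (p + 1) ((r.walk α (p + 1)).2 - (p + 1)) α with hc
      have hp : c.2 p ≠ 0 := by rw [hc, incr_of_lt _ _ _ (Nat.lt_succ_self p)]; exact h0
      cases hc1 : c.1 with
      | false =>
        obtain ⟨h3, h4⟩ := h1 hc1
        simp [hc1, Valid, hp, h3, h4]
      | true =>
        obtain ⟨h3, h4⟩ := h2 hc1
        have hz : ∀ q, p ≤ q → Function.update c.2 p 0 q = 0 := fun q hq => by
          rcases eq_or_lt_of_le hq with rfl | hq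
          · simp
          · rw [Function.update_of_ne (by omega)]; exact h3 q hq
        simp only [if_true, hp, if_false]
        simp [h4]
        exact hz

end DTree

/-! ### The guessing algorithm -/

/-- A PCCDS instance with vertices and colours numbered from `0`, and an accuracy `D`. The sides
of the graph are `range n` and `range m`. -/
structure CoverData where
  n : ℕ
  m : ℕ
  r : ℕ
  k : ℕ
  D : ℕ
  adj : ℕ → ℕ → Bool
  f : ℕ → ℕ
  t : ℕ → ℕ

/-- What is known about a hypothetical solution `o 0, …, o (k - 1)`: the vertex `o i` lies in `X i`,
and all vertices of `X i` have the same neighbours in `K i`. -/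
structure Slots where
  X : ℕ → Finset ℕ
  K : ℕ → Finset ℕ

/-- The state of a greedy pass: `W` is the set covered or known to be covered, `sel` the selected
vertices, and `slot` the slot for which no vertex was acceptable, if `ok` is false. -/
structure PassState where
  ok : Bool
  W : Finset ℕ
  sel : ℕ → ℕ
  slot : ℕ

/-- The representative of a nonempty set of vertices: its largest member. -/
def rep (S : Finset ℕ) : ℕ := S.sup id

/-- Guess the value of `P` on the sought member of `S`, if `P` takes both values on `S`. -/
def splitSet (S : Finset ℕ) (P : ℕ → Bool) : DTree (Finset ℕ) :=
  if (S.filter fun v => P v = true).Nonempty ∧ (S.filter fun v => P v = false).Nonempty then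
    .node (.leaf (S.filter fun v => P v = false)) (.leaf (S.filter fun v => P v = true))
  else .leaf S

/-- Guess the value of `P` on the sought member of slot `i`. -/
def Slots.split (c : Slots) (i : ℕ) (P : ℕ → Bool) : DTree Slots :=
  (splitSet (c.X i) P).bind fun S => .leaf ⟨Function.update c.X i S, c.K⟩

/-- Guess whether the sought member of slot `i` is adjacent to `b`, and record `b` as known. -/
def Slots.learn (G : CoverData) (c : Slots) (i b : ℕ) : DTree Slots :=
  (c.split i fun v => G.adj v b).bind fun c' =>
    .leaf ⟨c'.X, Function.update c'.K i (insert b (c'.K i))⟩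

namespace CoverData

variable (G : CoverData)

/-- The neighbourhood of `v`. -/
def nb (v : ℕ) : Finset ℕ := (Finset.range G.m).filter fun b => G.adj v b = true

/-- The vertices of colour `j` in `W`. -/
def col (W : Finset ℕ) (j : ℕ) : Finset ℕ := W.filter fun b => G.f b = j

/-- Absence of `K_{d,d}`. -/
def KFree (d : ℕ) : Prop :=
  ∀ S ⊆ Finset.range G.n, ∀ T ⊆ Finset.range G.m, S.card = d → T.card = d →
    ¬ ∀ x ∈ S, ∀ y ∈ T, G.adj x y = true

/-- In slot `i`, the vertex `v` wastes more than `t j / D` of its neighbours of colour `j` on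
vertices of `W` for which this was not foreseen, while `W` does not yet satisfy colour `j`. -/
def bad (c : Slots) (W : Finset ℕ) (i j v : ℕ) : Prop :=
  (G.col W j).card < G.t j ∧ G.t j < G.D * (G.col (G.nb v ∩ (W \ c.K i)) j).card

instance (c : Slots) (W : Finset ℕ) (i j v : ℕ) : Decidable (G.bad c W i j v) :=
  inferInstanceAs (Decidable (_ ∧ _))

/-- One more than the last colour in which `v` is bad, or `0` if there is none. -/
def badColor (c : Slots) (W : Finset ℕ) (i v : ℕ) : ℕ :=
  ((Finset.range G.r).filter fun j => G.bad c W i j v).sup (· + 1)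

/-- The vertices known to be covered. -/
def known (c : Slots) : Finset ℕ :=
  (Finset.range G.k).biUnion fun l => G.nb (rep (c.X l)) ∩ c.K l

/-- The acceptable vertices of slot `i`. -/
def cands (c : Slots) (W : Finset ℕ) (i : ℕ) : Finset ℕ :=
  (c.X i).filter fun v => G.badColor c W i v = 0

/-- Select a vertex for slot `i`. -/
def passStep (c : Slots) (i : ℕ) (s : PassState) : PassState :=
  if s.ok = true then
    if (G.cands c s.W i).Nonempty then
      ⟨true, s.W ∪ G.nb (rep (G.cands c s.W i)), Function.update s.sel i (rep (G.cands c s.W i)),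
        s.slot⟩
    else ⟨false, s.W, s.sel, i⟩
  else s

/-- The greedy pass over the first slots. -/
def pass (c : Slots) : ℕ → PassState
  | 0 => ⟨true, G.known c, fun _ => 0, 0⟩
  | i + 1 => G.passStep c i (pass c i)

/-- Guess the colour that rules out the sought member of slot `i`. -/
def guessColor (c : Slots) (W : Finset ℕ) (i : ℕ) : DTree Slots :=
  .iter G.r (fun j s => s.split i fun v => decide (G.badColor c W i v ≤ j)) c

/-- Guess the neighbours of the sought member of slot `i` among the vertices `b` of `W` that have
the colour `f b = J - 1`. -/
def guessTrace (W : Finset ℕ) (i J : ℕ) (c : Slots) : DTree Slots :=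
  .iter G.m (fun b s => if G.f b + 1 = J ∧ b ∈ W ∧ b ∉ s.K i then s.learn G i b else .leaf s) c

/-- Refine slot `i`, for which no vertex is acceptable. -/
def refine (c : Slots) (W : Finset ℕ) (i : ℕ) : DTree Slots :=
  (G.guessColor c W i).bind fun c' => G.guessTrace W i (G.badColor c W i (rep (c'.X i))) c'

/-- A greedy pass, and a refinement if it fails. -/
def round (c : Slots) : DTree Slots :=
  if (G.pass c G.k).ok = true then .leaf c
  else G.refine c (G.pass c G.k).W (G.pass c G.k).slot

/-- Nothing is known. -/
def start : Slots := ⟨fun _ => Finset.range G.n, fun _ => ∅⟩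

/-- The number of neighbours of colour `j`. -/
def deg (j v : ℕ) : ℕ := (G.col (G.nb v) j).card

/-- Guess the degrees of the sought vertices, up to `t j / D` and capped at `t j`. -/
def guessDegrees : DTree Slots :=
  .iter G.k (fun i => .iter G.r fun j => .iter G.D fun q s =>
    s.split i fun v => decide ((q + 1) * G.t j ≤ G.D * G.deg j v)) G.start

/-- All guesses; enough rounds are made for the greedy pass to succeed. -/
def guesses : DTree Slots :=
  G.guessDegrees.bind (.iter (G.k * G.m + 1) fun _ => G.round)

/-- The last greedy pass succeeds and its selection is good enough. -/
def accepts (c : Slots) : Prop :=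
  (G.pass c G.k).ok = true ∧
    ∀ j < G.r, (G.D - (G.k + G.k)) * G.t j ≤ G.D * (G.col (G.pass c G.k).W j).card

end CoverData

/-! ### Splitting -/

theorem rep_mem {S : Finset ℕ} (h : S.Nonempty) : rep S ∈ S := by
  obtain ⟨v, hv, e⟩ := Finset.exists_mem_eq_sup S h id
  rw [rep, e]
  exact hv

theorem all_splitSet (S : Finset ℕ) (P : ℕ → Bool) :
    (splitSet S P).All fun S' => S' ⊆ S ∧ (S.Nonempty → S'.Nonempty) ∧
      ∀ u ∈ S', ∀ v ∈ S', P u = P v := by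
  unfold splitSet
  split_ifs with h
  · refine ⟨⟨Finset.filter_subset _ _, fun _ => h.2, ?_⟩, Finset.filter_subset _ _, fun _ => h.1, ?_⟩
    all_goals
      intro u hu v hv
      rw [(Finset.mem_filter.1 hu).2, (Finset.mem_filter.1 hv).2]
  · refine ⟨subset_rfl, id, fun u hu v hv => ?_⟩
    by_contra hne
    cases hPu : P u <;> cases hPv : P v <;> simp [hPu, hPv] at hne
    · exact h ⟨⟨v, by simp [hv, hPv]⟩, ⟨u, by simp [hu, hPu]⟩⟩
    · exact h ⟨⟨u, by simp [hu, hPu]⟩, ⟨v, by simp [hv, hPv]⟩⟩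

theorem ex_splitSet {S : Finset ℕ} (P : ℕ → Bool) {o : ℕ} (ho : o ∈ S) :
    (splitSet S P).Ex fun S' => o ∈ S' := by
  unfold splitSet
  split_ifs with h
  · cases hP : P o
    · exact Or.inl (by simp [DTree.Ex, ho, hP])
    · exact Or.inr (by simp [DTree.Ex, ho, hP])
  · exact ho

theorem sum_splitSet (S Y : Finset ℕ) (P : ℕ → Bool) :
    ((splitSet S P).sum fun S' => (S' ∩ Y).card) = (S ∩ Y).card := by
  unfold splitSet
  split_ifs with h
  · simp only [DTree.sum]
    rw [← Finset.card_union_of_disjoint]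
    · congr 1
      ext v
      cases hP : P v <;> simp [hP]
    · rw [Finset.disjoint_left]
      intro v hv hv'
      simp at hv hv'
      simp [hv.1.2] at hv'
  · rfl

theorem size_splitSet (S : Finset ℕ) (P : ℕ → Bool) : (splitSet S P).size ≤ 2 := by
  unfold splitSet
  split_ifs <;> simp [DTree.size, DTree.sum]

theorem depth_splitSet (S : Finset ℕ) (P : ℕ → Bool) : (splitSet S P).depth ≤ 1 := by
  unfold splitSet
  split_ifs <;> simp [DTree.depth]

namespace Slots

/-- `c'` arises from `c` by narrowing down the slots. -/
structure Narrow (c c' : Slots) : Prop where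
  sub : ∀ l, c'.X l ⊆ c.X l
  ne : ∀ l, (c.X l).Nonempty → (c'.X l).Nonempty

theorem Narrow.refl (c : Slots) : Narrow c c := ⟨fun _ => subset_rfl, fun _ => id⟩

theorem Narrow.trans {c₁ c₂ c₃ : Slots} (h : Narrow c₁ c₂) (h' : Narrow c₂ c₃) : Narrow c₁ c₃ :=
  ⟨fun l => (h'.sub l).trans (h.sub l), fun l hl => h'.ne l (h.ne l hl)⟩

theorem all_split (c : Slots) (i : ℕ) (P : ℕ → Bool) :
    (c.split i P).All fun c' => Narrow c c' ∧ c'.K = c.K ∧ (∀ l, l ≠ i → c'.X l = c.X l) ∧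
      ∀ u ∈ c'.X i, ∀ v ∈ c'.X i, P u = P v := by
  refine (all_splitSet (c.X i) P).bind fun S hS => ?_
  refine ⟨⟨fun l => ?_, fun l hl => ?_⟩, rfl, fun l hl => Function.update_of_ne hl _ _, ?_⟩
  · by_cases h : l = i
    · subst h; simpa using hS.1
    · simp [h]
  · by_cases h : l = i
    · subst h; simpa using hS.2.1 hl
    · simpa [h] using hl
  · simpa using hS.2.2

theorem ex_split (c : Slots) (i : ℕ) (P : ℕ → Bool) (k : ℕ) (o : ℕ → ℕ)
    (ho : ∀ l < k, o l ∈ c.X l) : (c.split i P).Ex fun c' => ∀ l < k, o l ∈ c'.X l := by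
  by_cases hi : i < k
  · refine (ex_splitSet P (ho i hi)).bind fun S hS l hl => ?_
    by_cases h : l = i
    · subst h; simpa using hS
    · simpa [h] using ho l hl
  · unfold split splitSet
    split_ifs
    · refine Or.inl fun l hl => ?_
      have h : l ≠ i := by omega
      simpa [h] using ho l hl
    · intro l hl
      have h : l ≠ i := by omega
      simpa [h] using ho l hl

theorem sum_split (c : Slots) (i : ℕ) (P : ℕ → Bool) (Y : Finset ℕ) :
    ((c.split i P).sum fun c' => (c'.X i ∩ Y).card) = (c.X i ∩ Y).card := by
  rw [split, DTree.sum_bind, ← sum_splitSet _ _ P]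
  simp [DTree.sum]

theorem size_split (c : Slots) (i : ℕ) (P : ℕ → Bool) : (c.split i P).size ≤ 2 := by
  rw [split, DTree.size, DTree.sum_bind]
  exact size_splitSet _ _

theorem depth_split (c : Slots) (i : ℕ) (P : ℕ → Bool) : (c.split i P).depth ≤ 1 :=
  (DTree.depth_bind_le (c := 0) fun _ => le_rfl).trans (depth_splitSet _ _)

theorem all_learn (G : CoverData) (c : Slots) (i b : ℕ) :
    (c.learn G i b).All fun c' => Narrow c c' ∧ c'.K i = insert b (c.K i) ∧
      (∀ l, l ≠ i → c'.K l = c.K l) ∧ (∀ l, l ≠ i → c'.X l = c.X l) ∧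
      ∀ u ∈ c'.X i, ∀ v ∈ c'.X i, G.adj u b = G.adj v b := by
  refine (c.all_split i _).bind fun c' h => ?_
  refine ⟨⟨h.1.1, h.1.2⟩, ?_, fun l hl => ?_, h.2.2.1, h.2.2.2⟩
  · simp [h.2.1]
  · simp [h.2.1, hl]

theorem ex_learn (G : CoverData) (c : Slots) (i b : ℕ) (k : ℕ) (o : ℕ → ℕ)
    (ho : ∀ l < k, o l ∈ c.X l) : (c.learn G i b).Ex fun c' => ∀ l < k, o l ∈ c'.X l :=
  (c.ex_split i _ k o ho).bind fun _ h => h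

theorem sum_learn (G : CoverData) (c : Slots) (i b : ℕ) (Y : Finset ℕ) :
    ((c.learn G i b).sum fun c' => (c'.X i ∩ Y).card) = (c.X i ∩ Y).card := by
  rw [learn, DTree.sum_bind, ← c.sum_split i (fun v => G.adj v b)]
  rfl

theorem size_learn (G : CoverData) (c : Slots) (i b : ℕ) : (c.learn G i b).size ≤ 2 := by
  rw [learn, DTree.size, DTree.sum_bind]
  exact size_split _ _ _

theorem depth_learn (G : CoverData) (c : Slots) (i b : ℕ) : (c.learn G i b).depth ≤ 1 :=
  (DTree.depth_bind_le (c := 0) fun _ => le_rfl).trans (depth_split _ _ _)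

end Slots

theorem DTree.sum_iter_eq {β : Type} {f : ℕ → β → DTree β} {g : β → ℕ} (n : ℕ) (b : β)
    (h : ∀ i b, (f i b).sum g = g b) : (iter n f b).sum g = g b := by
  induction n with
  | zero => rfl
  | succ n ih => rw [iter, sum_bind, ← ih]; congr 1; funext b; exact h n b

open DTree

namespace CoverData

variable (G : CoverData)

/-! ### Consistency of the guesses -/

/-- What is recorded in the slots is meaningful: they are nonempty sets of vertices, and all members
of a slot have the same neighbours among the recorded vertices. -/
structure Consistent (c : Slots) : Prop where
  sub : ∀ i < G.k, c.X i ⊆ Finset.range G.n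
  ne : ∀ i < G.k, (c.X i).Nonempty
  ksub : ∀ i < G.k, c.K i ⊆ Finset.range G.m
  const : ∀ i < G.k, ∀ b ∈ c.K i, ∀ u ∈ c.X i, ∀ v ∈ c.X i, G.adj u b = G.adj v b

/-- All members of a slot have the same degrees, up to rounding and capping. -/
def SameDegrees (c : Slots) : Prop :=
  ∀ i < G.k, ∀ j < G.r, ∀ q < G.D, ∀ u ∈ c.X i, ∀ v ∈ c.X i,
    (q + 1) * G.t j ≤ G.D * G.deg j u → (q + 1) * G.t j ≤ G.D * G.deg j v

variable {G}

theorem SameDegrees.narrow {c c' : Slots} (h : G.SameDegrees c) (h' : c.Narrow c') :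
    G.SameDegrees c' :=
  fun i hi j hj q hq u hu v hv => h i hi j hj q hq u (h'.sub i hu) v (h'.sub i hv)

theorem Consistent.narrow {c c' : Slots} (h : G.Consistent c) (h' : c.Narrow c') (hK : c'.K = c.K) :
    G.Consistent c' :=
  ⟨fun i hi => (h'.sub i).trans (h.sub i hi), fun i hi => h'.ne i (h.ne i hi),
    fun i hi => hK ▸ h.ksub i hi,
    fun i hi b hb u hu v hv => h.const i hi b (hK ▸ hb) u (h'.sub i hu) v (h'.sub i hv)⟩

theorem mem_nb {v b : ℕ} : b ∈ G.nb v ↔ b < G.m ∧ G.adj v b = true := by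
  simp [nb]

theorem Consistent.nb_inter {c : Slots} (h : G.Consistent c) {i : ℕ} (hi : i < G.k) {u v : ℕ}
    (hu : u ∈ c.X i) (hv : v ∈ c.X i) : G.nb u ∩ c.K i = G.nb v ∩ c.K i := by
  ext b
  simp only [Finset.mem_inter, mem_nb]
  constructor <;> rintro ⟨⟨h1, h2⟩, h3⟩
  · exact ⟨⟨h1, by rw [← h2]; exact h.const i hi b h3 v hv u hu⟩, h3⟩
  · exact ⟨⟨h1, by rw [← h2]; exact h.const i hi b h3 u hu v hv⟩, h3⟩

theorem card_col_le (W : Finset ℕ) (j : ℕ) : (G.col W j).card ≤ W.card :=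
  Finset.card_le_card (Finset.filter_subset _ _)

theorem col_mono {W W' : Finset ℕ} (h : W ⊆ W') (j : ℕ) : G.col W j ⊆ G.col W' j :=
  Finset.filter_subset_filter _ h

/-! ### The degree guesses -/

theorem all_guessDegrees (hn : 0 < G.n) : G.guessDegrees.All fun c =>
    G.Consistent c ∧ G.SameDegrees c ∧ ∀ i, c.K i = ∅ := by
  -- `Q i j q` says that the thresholds before the position `(i, j, q)` of the loops are guessed.
  let Q : ℕ → ℕ → ℕ → Slots → Prop := fun i j q c =>
    (G.Consistent c ∧ ∀ i, c.K i = ∅) ∧ ∀ i' < G.k, ∀ j' < G.r, ∀ q' < G.D,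
      (i' < i ∨ i' = i ∧ (j' < j ∨ j' = j ∧ q' < q)) → ∀ u ∈ c.X i', ∀ v ∈ c.X i',
        (q' + 1) * G.t j' ≤ G.D * G.deg j' u → (q' + 1) * G.t j' ≤ G.D * G.deg j' v
  have h0 : Q 0 0 0 G.start := by
    refine ⟨⟨⟨fun i _ => subset_rfl, fun i _ => ?_, fun i _ => by simp [start],
      fun i _ b hb => by simp [start] at hb⟩, fun i => rfl⟩, fun i' _ j' _ q' _ hlt => by omega⟩
    simpa [start, Finset.nonempty_range_iff] using hn.ne'
  have key : ∀ i < G.k, ∀ j < G.r, ∀ q < G.D, ∀ c, Q i j q c →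
      (c.split i fun v => decide ((q + 1) * G.t j ≤ G.D * G.deg j v)).All (Q i j (q + 1)) := by
    intro i hi j hj q hq c hc
    refine (c.all_split i _).mono fun c' h => ?_
    obtain ⟨hn, hK, -, hP⟩ := h
    refine ⟨⟨hc.1.1.narrow hn hK, by rw [hK]; exact hc.1.2⟩, ?_⟩
    intro i' hi' j' hj' q' hq' hlt u hu v hv
    by_cases hlt' : i' < i ∨ i' = i ∧ (j' < j ∨ j' = j ∧ q' < q)
    · exact hc.2 i' hi' j' hj' q' hq' hlt' u (hn.sub _ hu) v (hn.sub _ hv)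
    · obtain ⟨rfl, rfl, rfl⟩ : i' = i ∧ j' = j ∧ q' = q := by omega
      have := hP u hu v hv
      simp only [decide_eq_decide] at this
      exact this.1
  have h := all_iter (P := fun i => Q i 0 0) (b := G.start) G.k h0
    (f := fun i => .iter G.r fun j => .iter G.D fun q s =>
      s.split i fun v => decide ((q + 1) * G.t j ≤ G.D * G.deg j v)) ?_
  · refine h.mono fun c hc => ⟨hc.1.1, ?_, hc.1.2⟩
    exact fun i hi j hj q hq => hc.2 i hi j hj q hq (Or.inl hi)
  · intro i hi c hc
    refine (all_iter (P := fun j => Q i j 0) G.r hc ?_).mono ?_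
    · intro j hj c hc
      refine (all_iter (P := fun q => Q i j q) G.D hc (key i hi j hj)).mono ?_
      rintro c ⟨h1, h2⟩
      exact ⟨h1, fun i' hi' j' hj' q' hq' hlt => h2 i' hi' j' hj' q' hq' (by omega)⟩
    · rintro c ⟨h1, h2⟩
      exact ⟨h1, fun i' hi' j' hj' q' hq' hlt => h2 i' hi' j' hj' q' hq' (by omega)⟩

theorem ex_guessDegrees {o : ℕ → ℕ} (ho : ∀ i < G.k, o i < G.n) :
    G.guessDegrees.Ex fun c => ∀ i < G.k, o i ∈ c.X i := by
  refine ex_iter (P := fun _ (c : Slots) => ∀ i < G.k, o i ∈ c.X i) _ (by simpa [start] using ho) ?_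
  intro i _ c hc
  refine ex_iter (P := fun _ (c : Slots) => ∀ i < G.k, o i ∈ c.X i) _ hc fun j _ c hc => ?_
  exact ex_iter (P := fun _ (c : Slots) => ∀ i < G.k, o i ∈ c.X i) _ hc fun q _ c hc =>
    c.ex_split i _ _ o hc

theorem size_guessDegrees : G.guessDegrees.size ≤ 2 ^ (G.D * G.r * G.k) := by
  rw [pow_mul, pow_mul]
  exact size_iter_le_pow _ _ fun i _ c => size_iter_le_pow _ _ fun j _ c =>
    size_iter_le_pow _ _ fun q _ c => c.size_split _ _

/-! ### The greedy pass -/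

theorem pass_ok_of_succ {c : Slots} {i : ℕ} (h : (G.pass c (i + 1)).ok = true) :
    (G.pass c i).ok = true := by
  by_contra hne
  rw [pass, passStep, if_neg hne] at h
  exact hne h

theorem pass_ok_of_le {c : Slots} {i j : ℕ} (hij : i ≤ j) (h : (G.pass c j).ok = true) :
    (G.pass c i).ok = true := by
  induction j, hij using Nat.le_induction with
  | base => exact h
  | succ j _ ih => exact ih (pass_ok_of_succ h)

theorem pass_succ {c : Slots} {i : ℕ} (h : (G.pass c (i + 1)).ok = true) :
    (G.cands c (G.pass c i).W i).Nonempty ∧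
    (G.pass c (i + 1)).W = (G.pass c i).W ∪ G.nb (rep (G.cands c (G.pass c i).W i)) ∧
    (G.pass c (i + 1)).sel = Function.update (G.pass c i).sel i
      (rep (G.cands c (G.pass c i).W i)) := by
  have h' := pass_ok_of_succ h
  rw [pass, passStep, if_pos h'] at h ⊢
  split_ifs at h ⊢ with h1
  exact ⟨h1, rfl, rfl⟩

theorem pass_sel {c : Slots} {i : ℕ} (h : (G.pass c i).ok = true) {l : ℕ} (hl : l < i) :
    (G.pass c i).sel l = rep (G.cands c (G.pass c l).W l) := by
  induction i with
  | zero => omega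
  | succ i ih =>
    rw [(pass_succ h).2.2]
    by_cases e : l = i
    · subst e; simp
    · rw [Function.update_of_ne e]
      exact ih (pass_ok_of_succ h) (by omega)

theorem pass_sel_mem {c : Slots} {i : ℕ} (h : (G.pass c i).ok = true) {l : ℕ} (hl : l < i) :
    (G.pass c i).sel l ∈ G.cands c (G.pass c l).W l := by
  rw [pass_sel h hl]
  exact rep_mem (pass_succ (pass_ok_of_le (Nat.succ_le_of_lt hl) h)).1

theorem pass_W {c : Slots} {i : ℕ} (h : (G.pass c i).ok = true) :
    (G.pass c i).W = G.known c ∪ (Finset.range i).biUnion fun l => G.nb ((G.pass c i).sel l) := by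
  induction i with
  | zero => simp [pass]
  | succ i ih =>
    have hb : ((Finset.range i).biUnion fun l => G.nb ((G.pass c (i + 1)).sel l)) =
        (Finset.range i).biUnion fun l => G.nb ((G.pass c i).sel l) := by
      refine Finset.biUnion_congr rfl fun l hl => ?_
      have hl := Finset.mem_range.1 hl
      rw [pass_sel h (by omega), pass_sel (pass_ok_of_succ h) hl]
    have h1 := (pass_succ h).2.1
    rw [h1, Finset.range_add_one, Finset.biUnion_insert, hb, pass_sel h (Nat.lt_succ_self i),
      Finset.union_comm (G.nb _), ← Finset.union_assoc, ← ih (pass_ok_of_succ h)]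

/-- After a successful pass, the covered set is the neighbourhood of the selection. -/
theorem pass_cover {c : Slots} (hc : G.Consistent c) (h : (G.pass c G.k).ok = true) :
    (G.pass c G.k).W = (Finset.range G.k).biUnion fun l => G.nb ((G.pass c G.k).sel l) := by
  rw [pass_W h, Finset.union_eq_right, known]
  refine Finset.biUnion_subset.2 fun l hl => ?_
  have hlk := Finset.mem_range.1 hl
  have hm := (Finset.mem_filter.1 (pass_sel_mem h hlk)).1
  rw [hc.nb_inter hlk (rep_mem (hc.ne l hlk)) hm]
  exact Finset.inter_subset_left.trans (Finset.subset_biUnion_of_mem (fun l => G.nb _) hl)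

theorem pass_W_mono {c : Slots} (i : ℕ) : (G.pass c i).W ⊆ (G.pass c (i + 1)).W := by
  rw [pass, passStep]
  split_ifs
  · exact Finset.subset_union_left
  · exact subset_rfl
  · exact subset_rfl

theorem pass_W_mono' {c : Slots} {i j : ℕ} (h : i ≤ j) : (G.pass c i).W ⊆ (G.pass c j).W := by
  induction j, h using Nat.le_induction with
  | base => exact subset_rfl
  | succ j _ ih => exact ih.trans (pass_W_mono j)

theorem badColor_eq_zero {c : Slots} {W : Finset ℕ} {i v : ℕ} (h : G.badColor c W i v = 0) {j : ℕ}
    (hj : j < G.r) : ¬ G.bad c W i j v := by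
  intro hb
  have h1 : j + 1 ≤ G.badColor c W i v :=
    Finset.le_sup (f := (· + 1)) (Finset.mem_filter.2 ⟨Finset.mem_range.2 hj, hb⟩)
  omega

/-- Vertices of one slot have almost the same degree, if one of them does not satisfy the colour
on its own. -/
theorem SameDegrees.deg_le {c : Slots} (h : G.SameDegrees c) {i j : ℕ} (hi : i < G.k) (hj : j < G.r)
    {u v : ℕ} (hu : u ∈ c.X i) (hv : v ∈ c.X i) (hlt : G.deg j v < G.t j) :
    G.D * G.deg j u ≤ G.D * G.deg j v + G.t j := by
  by_contra! hgt
  have ht : 0 < G.t j := by omega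
  have hdm := Nat.div_add_mod (G.D * G.deg j v) (G.t j)
  have hml := Nat.mod_lt (G.D * G.deg j v) ht
  have hD : 0 < G.D := by
    rcases Nat.eq_zero_or_pos G.D with h0 | h0
    · simp [h0] at hgt
    · exact h0
  set q := G.D * G.deg j v / G.t j with hq
  have hqD : q < G.D := Nat.div_lt_of_lt_mul (by
    rw [mul_comm (G.t j)]; exact Nat.mul_lt_mul_of_pos_left hlt hD)
  have e : (q + 1) * G.t j = G.t j * q + G.t j := by ring
  have := h i hi j hj q hqD u hu v hv (by omega)
  omega

theorem card_col_union_sdiff (W N : Finset ℕ) (j : ℕ) :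
    (G.col (W ∪ N) j).card = (G.col W j).card + (G.col (N \ W) j).card := by
  rw [← Finset.card_union_of_disjoint]
  · congr 1
    ext b
    simp only [col, Finset.mem_filter, Finset.mem_union, Finset.mem_sdiff]
    tauto
  · rw [Finset.disjoint_left]
    intro b h h'
    simp only [col, Finset.mem_filter, Finset.mem_sdiff] at h h'
    exact h'.1.2 h.1

theorem deg_le_add (v : ℕ) (W K : Finset ℕ) (j : ℕ) :
    G.deg j v ≤ (G.col (G.nb v \ W) j).card + (G.col (G.nb v ∩ (W \ K)) j).card +
      (G.col (G.nb v ∩ K) j).card := by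
  refine le_trans (Finset.card_le_card ?_) ((Finset.card_union_le _ _).trans
    (Nat.add_le_add_right (Finset.card_union_le _ _) _))
  intro b
  simp only [col, Finset.mem_filter, Finset.mem_union, Finset.mem_sdiff, Finset.mem_inter]
  tauto

/-- The comparison of the selection with the hypothetical solution, slot by slot: each slot loses
at most `t j / D` by the rounding of degrees and at most `t j / D` by unforeseen overlaps. -/
theorem pass_invariant {c : Slots} (hc : G.Consistent c) (hd : G.SameDegrees c)
    (hok : (G.pass c G.k).ok = true) {o : ℕ → ℕ} (ho : ∀ i < G.k, o i ∈ c.X i) {j : ℕ} (hj : j < G.r)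
    (hlt : (G.col (G.pass c G.k).W j).card < G.t j) {i : ℕ} (hi : i ≤ G.k) :
    G.D * (G.col (G.known c) j).card + ∑ l ∈ Finset.range i, G.D * G.deg j (o l) ≤
      G.D * (G.col (G.pass c i).W j).card +
        ∑ l ∈ Finset.range i, (G.D * (G.col (G.nb (o l) ∩ c.K l) j).card + 2 * G.t j) := by
  induction i with
  | zero => simp [pass]
  | succ i ih =>
    have ih := ih (by omega)
    have hok' := pass_ok_of_le hi hok
    obtain ⟨hne, hW, -⟩ := pass_succ hok'
    set v := rep (G.cands c (G.pass c i).W i) with hv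
    have hvm : v ∈ c.X i ∧ G.badColor c (G.pass c i).W i v = 0 :=
      Finset.mem_filter.1 (rep_mem hne)
    have hWk := pass_W_mono' (G := G) (c := c) hi
    have hWi := pass_W_mono' (G := G) (c := c) (show i ≤ G.k by omega)
    have hbad := badColor_eq_zero hvm.2 hj
    have hov : G.D * (G.col (G.nb v ∩ ((G.pass c i).W \ c.K i)) j).card ≤ G.t j := by
      by_contra! h
      exact hbad ⟨(Finset.card_le_card (col_mono hWi j)).trans_lt hlt, h⟩
    have hdeg := hd.deg_le (show i < G.k by omega) hj (ho i (by omega)) hvm.1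
      ((Finset.card_le_card (col_mono ((by rw [hW]; exact Finset.subset_union_right :
        G.nb v ⊆ (G.pass c (i + 1)).W).trans hWk) j)).trans_lt hlt)
    have h3 := Nat.mul_le_mul_left G.D (deg_le_add (G := G) v (G.pass c i).W (c.K i) j)
    rw [hc.nb_inter (show i < G.k by omega) hvm.1 (ho i (by omega))] at h3
    rw [Finset.sum_range_succ, Finset.sum_range_succ, hW, card_col_union_sdiff]
    simp only [mul_add] at h3 ⊢
    omega

/-- If the hypothetical solution is in the slots, a successful pass selects a good set. -/
theorem accepts_of_ok {c : Slots} (hc : G.Consistent c) (hd : G.SameDegrees c)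
    (hok : (G.pass c G.k).ok = true) {o : ℕ → ℕ} (ho : ∀ i < G.k, o i ∈ c.X i)
    (hsol : ∀ j < G.r,
      G.t j ≤ (G.col ((Finset.range G.k).biUnion fun l => G.nb (o l)) j).card) :
    G.accepts c := by
  refine ⟨hok, fun j hj => ?_⟩
  rcases le_or_gt (G.t j) (G.col (G.pass c G.k).W j).card with hle | hlt
  · exact Nat.mul_le_mul (Nat.sub_le _ _) hle
  have hinv := pass_invariant hc hd hok ho hj hlt le_rfl
  have hcov : (G.col ((Finset.range G.k).biUnion fun l => G.nb (o l)) j).card ≤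
      (G.col (G.known c) j).card +
        ∑ l ∈ Finset.range G.k, (G.col (G.nb (o l) \ c.K l) j).card := by
    have hsub : G.col ((Finset.range G.k).biUnion fun l => G.nb (o l)) j ⊆
        G.col (G.known c) j ∪
          (Finset.range G.k).biUnion fun l => G.col (G.nb (o l) \ c.K l) j := by
      intro b hb
      simp only [col, Finset.mem_filter, Finset.mem_biUnion, Finset.mem_union, Finset.mem_range,
        known, Finset.mem_sdiff] at hb ⊢
      obtain ⟨⟨l, hl, hbl⟩, hbj⟩ := hb
      by_cases hK : b ∈ c.K l
      · refine Or.inl ⟨⟨l, hl, ?_⟩, hbj⟩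
        rw [hc.nb_inter hl (rep_mem (hc.ne l hl)) (ho l hl)]
        exact Finset.mem_inter.2 ⟨hbl, hK⟩
      · exact Or.inr ⟨l, hl, ⟨hbl, hK⟩, hbj⟩
    exact (Finset.card_le_card hsub).trans ((Finset.card_union_le _ _).trans
      (Nat.add_le_add_left Finset.card_biUnion_le _))
  have hsplit : ∀ l, G.deg j (o l) = (G.col (G.nb (o l) \ c.K l) j).card +
      (G.col (G.nb (o l) ∩ c.K l) j).card := by
    intro l
    rw [deg, ← Finset.card_union_of_disjoint]
    · congr 1
      ext b
      simp only [col, Finset.mem_filter, Finset.mem_union, Finset.mem_sdiff, Finset.mem_inter]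
      tauto
    · rw [Finset.disjoint_left]
      intro b h h'
      simp only [col, Finset.mem_filter, Finset.mem_sdiff, Finset.mem_inter] at h h'
      exact h.1.2 h'.1.2
  have h1 := Nat.mul_le_mul_left G.D ((hsol j hj).trans hcov)
  simp only [hsplit, mul_add, Finset.sum_add_distrib, Finset.sum_const, Finset.card_range,
    smul_eq_mul] at hinv
  rw [mul_add, Finset.mul_sum] at h1
  rw [Nat.sub_mul]
  have e : (G.k + G.k) * G.t j = G.k * (2 * G.t j) := by ring
  omega

end CoverData

namespace CoverData

variable {G : CoverData}

/-! ### Refinement of a slot -/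

theorem badColor_spec {c : Slots} {W : Finset ℕ} {i v : ℕ} (h : G.badColor c W i v ≠ 0) :
    ∃ j < G.r, G.badColor c W i v = j + 1 ∧ G.bad c W i j v := by
  have hne : ((Finset.range G.r).filter fun j => G.bad c W i j v).Nonempty := by
    rw [Finset.nonempty_iff_ne_empty]
    intro h0
    exact h (by rw [badColor, h0]; rfl)
  obtain ⟨j, hj, e⟩ := Finset.exists_mem_eq_sup _ hne (· + 1)
  have hj := Finset.mem_filter.1 hj
  exact ⟨j, Finset.mem_range.1 hj.1, e, hj.2⟩

theorem badColor_le (c : Slots) (W : Finset ℕ) (i v : ℕ) : G.badColor c W i v ≤ G.r :=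
  Finset.sup_le fun _ hj => Finset.mem_range.1 (Finset.mem_filter.1 hj).1

/-- `c'` differs from `c` in slot `i` only. -/
structure _root_.Slots.NarrowAt (i : ℕ) (c c' : Slots) : Prop where
  narrow : c.Narrow c'
  X_eq : ∀ l, l ≠ i → c'.X l = c.X l
  K_eq : ∀ l, l ≠ i → c'.K l = c.K l

theorem _root_.Slots.NarrowAt.trans {i : ℕ} {c₁ c₂ c₃ : Slots} (h : c₁.NarrowAt i c₂)
    (h' : c₂.NarrowAt i c₃) : c₁.NarrowAt i c₃ :=
  ⟨h.1.trans h'.1, fun l hl => (h'.2 l hl).trans (h.2 l hl),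
    fun l hl => (h'.3 l hl).trans (h.3 l hl)⟩

theorem _root_.Slots.NarrowAt.refl (i : ℕ) (c : Slots) : c.NarrowAt i c :=
  ⟨.refl c, fun _ _ => rfl, fun _ _ => rfl⟩

theorem all_guessColor (c : Slots) (W : Finset ℕ) (i : ℕ) :
    (G.guessColor c W i).All fun c' => c.NarrowAt i c' ∧ c'.K = c.K ∧
      ∀ u ∈ c'.X i, ∀ v ∈ c'.X i, G.badColor c W i u = G.badColor c W i v := by
  refine (all_iter (P := fun j c' => c.NarrowAt i c' ∧ c'.K = c.K ∧ ∀ j' < j,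
    ∀ u ∈ c'.X i, ∀ v ∈ c'.X i, G.badColor c W i u ≤ j' → G.badColor c W i v ≤ j') G.r
    ⟨.refl i c, rfl, fun _ h => by omega⟩ ?_).mono ?_
  · intro j _ c' hc'
    refine (c'.all_split i _).mono fun c'' h => ?_
    obtain ⟨h1, h2, h3, h4⟩ := h
    refine ⟨hc'.1.trans ⟨h1, h3, fun l _ => by rw [h2]⟩, h2.trans hc'.2.1, ?_⟩
    intro j' hj' u hu v hv
    by_cases e : j' = j
    · subst e
      have := h4 u hu v hv
      simp only [decide_eq_decide] at this
      exact this.1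
    · exact hc'.2.2 j' (by omega) u (h1.sub i hu) v (h1.sub i hv)
  · rintro c' ⟨h1, h2, h3⟩
    refine ⟨h1, h2, ?_⟩
    have key : ∀ u ∈ c'.X i, ∀ v ∈ c'.X i, G.badColor c W i u ≤ G.badColor c W i v := by
      intro u hu v hv
      by_contra! hlt
      have := badColor_le (G := G) c W i u
      have := h3 _ (by omega) v hv u hu le_rfl
      omega
    exact fun u hu v hv => le_antisymm (key u hu v hv) (key v hv u hu)

theorem all_guessTrace (W : Finset ℕ) (i J : ℕ) (c : Slots)
    (hc : ∀ b ∈ c.K i, ∀ u ∈ c.X i, ∀ v ∈ c.X i, G.adj u b = G.adj v b) :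
    (G.guessTrace W i J c).All fun c' => c.NarrowAt i c' ∧
      c'.K i = c.K i ∪ ((Finset.range G.m).filter fun b => G.f b + 1 = J ∧ b ∈ W) ∧
      ∀ b ∈ c'.K i, ∀ u ∈ c'.X i, ∀ v ∈ c'.X i, G.adj u b = G.adj v b := by
  refine all_iter (P := fun b c' => c.NarrowAt i c' ∧
      c'.K i = c.K i ∪ ((Finset.range b).filter fun b => G.f b + 1 = J ∧ b ∈ W) ∧
      ∀ b ∈ c'.K i, ∀ u ∈ c'.X i, ∀ v ∈ c'.X i, G.adj u b = G.adj v b) G.m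
    ⟨.refl i c, by simp, hc⟩ ?_
  rintro b _ c' ⟨h1, h2, h3⟩
  split_ifs with hb
  · refine (c'.all_learn G i b).mono fun c'' h => ?_
    obtain ⟨k1, k2, k3, k4, k5⟩ := h
    refine ⟨h1.trans ⟨k1, k4, k3⟩, ?_, ?_⟩
    · rw [k2, h2, Finset.range_add_one, Finset.filter_insert, if_pos ⟨hb.1, hb.2.1⟩,
        Finset.union_insert]
    · intro b' hb' u hu v hv
      rw [k2, Finset.mem_insert] at hb'
      rcases hb' with rfl | hb'
      · exact k5 u hu v hv
      · exact h3 b' hb' u (k1.sub i hu) v (k1.sub i hv)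
  · refine ⟨h1, ?_, h3⟩
    rw [Finset.range_add_one, Finset.filter_insert]
    split_ifs with hb'
    · have : b ∈ c'.K i := by tauto
      rw [Finset.union_insert, ← h2, Finset.insert_eq_of_mem this]
    · exact h2

/-- The outcome of refining slot `i`: its members are now bad in the common colour `j`, and their
neighbours among the vertices of colour `j` of `W` are known. -/
structure Refined (c : Slots) (W : Finset ℕ) (i j : ℕ) (c' : Slots) : Prop where
  lt : j < G.r
  narrow : c.NarrowAt i c'
  K_eq : c'.K i = c.K i ∪ G.col W j
  bad : ∀ v ∈ c'.X i, G.bad c W i j v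
  const : ∀ b ∈ c'.K i, ∀ u ∈ c'.X i, ∀ v ∈ c'.X i, G.adj u b = G.adj v b

/-- The hypothesis under which slots are refined. -/
structure Stuck (G : CoverData) (c : Slots) (W : Finset ℕ) (i : ℕ) : Prop where
  cons : G.Consistent c
  lt : i < G.k
  sub : W ⊆ Finset.range G.m
  ne : ∀ v ∈ c.X i, G.badColor c W i v ≠ 0

theorem filter_color {W : Finset ℕ} (hW : W ⊆ Finset.range G.m) (j : ℕ) :
    ((Finset.range G.m).filter fun b => G.f b + 1 = j + 1 ∧ b ∈ W) = G.col W j := by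
  ext b
  simp only [col, Finset.mem_filter, Finset.mem_range, add_left_inj]
  exact ⟨fun h => ⟨h.2.2, h.2.1⟩, fun h => ⟨Finset.mem_range.1 (hW h.1), h.2, h.1⟩⟩

/-- After the colour has been guessed, tracing leads to a refined slot. -/
theorem refined_of_guessColor {c c₁ : Slots} {W : Finset ℕ} {i : ℕ} (h : G.Stuck c W i)
    (h1 : c.NarrowAt i c₁ ∧ c₁.K = c.K ∧
      ∀ u ∈ c₁.X i, ∀ v ∈ c₁.X i, G.badColor c W i u = G.badColor c W i v) :
    ∃ j < G.r, G.badColor c W i (rep (c₁.X i)) = j + 1 ∧ (∀ v ∈ c₁.X i, G.bad c W i j v) ∧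
      (G.guessTrace W i (j + 1) c₁).All (G.Refined c W i j) := by
  obtain ⟨hn, hK, hcon⟩ := h1
  have hne := hn.narrow.ne i (h.cons.ne i h.lt)
  have hr := rep_mem hne
  obtain ⟨j, hj, e, hb⟩ := badColor_spec (h.ne _ (hn.narrow.sub i hr))
  have hbad : ∀ v ∈ c₁.X i, G.bad c W i j v := by
    intro v hv
    obtain ⟨j', hj', e', hb'⟩ := badColor_spec (h.ne _ (hn.narrow.sub i hv))
    have := hcon v hv _ hr
    obtain rfl : j' = j := by omega
    exact hb'
  refine ⟨j, hj, e, hbad, (G.all_guessTrace W i (j + 1) c₁ ?_).mono fun c' h' => ?_⟩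
  · intro b hb u hu v hv
    exact h.cons.const i h.lt b (hK ▸ hb) u (hn.narrow.sub i hu) v (hn.narrow.sub i hv)
  · refine ⟨hj, hn.trans h'.1, ?_, fun v hv => hbad v (h'.1.narrow.sub i hv), h'.2.2⟩
    rw [h'.2.1, hK, filter_color h.sub]

theorem all_refine {c : Slots} {W : Finset ℕ} {i : ℕ} (h : G.Stuck c W i) :
    (G.refine c W i).All fun c' => ∃ j, G.Refined c W i j c' := by
  refine (all_guessColor c W i).bind fun c₁ h1 => ?_
  obtain ⟨j, -, e, -, h2⟩ := refined_of_guessColor h h1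
  rw [e]
  exact h2.mono fun c' h' => ⟨j, h'⟩

theorem ex_refine {c : Slots} {W : Finset ℕ} {i : ℕ} {o : ℕ → ℕ} (ho : ∀ l < G.k, o l ∈ c.X l) :
    (G.refine c W i).Ex fun c' => ∀ l < G.k, o l ∈ c'.X l := by
  have h1 : (G.guessColor c W i).Ex fun c' => ∀ l < G.k, o l ∈ c'.X l :=
    ex_iter (P := fun _ (c : Slots) => ∀ l < G.k, o l ∈ c.X l) _ ho fun j _ c hc =>
      c.ex_split i _ _ o hc
  refine h1.bind fun c' hc' => ?_
  refine ex_iter (P := fun _ (c : Slots) => ∀ l < G.k, o l ∈ c.X l) _ hc' fun b _ c hc => ?_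
  split_ifs
  · exact c.ex_learn G i b _ o hc
  · exact hc

theorem Refined.consistent {c c' : Slots} {W : Finset ℕ} {i j : ℕ} (h : G.Stuck c W i)
    (h' : G.Refined c W i j c') : G.Consistent c' := by
  obtain ⟨hj, hn, hK, hb, hcon⟩ := h'
  refine ⟨fun l hl => (hn.narrow.sub l).trans (h.cons.sub l hl),
    fun l hl => hn.narrow.ne l (h.cons.ne l hl), fun l hl => ?_, fun l hl => ?_⟩
  · by_cases e : l = i
    · subst e
      rw [hK]
      exact Finset.union_subset (h.cons.ksub l hl) ((Finset.filter_subset _ _).trans h.sub)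
    · rw [hn.K_eq l e]
      exact h.cons.ksub l hl
  · by_cases e : l = i
    · subst e
      exact hcon
    · rw [hn.K_eq l e, hn.X_eq l e]
      exact h.cons.const l hl

theorem nb_subset (v : ℕ) : G.nb v ⊆ Finset.range G.m := Finset.filter_subset _ _

theorem pass_sub (c : Slots) (i : ℕ) : (G.pass c i).W ⊆ Finset.range G.m := by
  induction i with
  | zero =>
    exact Finset.biUnion_subset.2 fun l _ => Finset.inter_subset_left.trans (nb_subset _)
  | succ i ih =>
    rw [pass, passStep]
    split_ifs
    · exact Finset.union_subset ih (nb_subset _)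
    · exact ih
    · exact ih

theorem pass_fail {c : Slots} (i : ℕ) (h : (G.pass c i).ok = false) :
    (G.pass c i).slot < i ∧ G.cands c (G.pass c i).W (G.pass c i).slot = ∅ := by
  induction i with
  | zero => simp [pass] at h
  | succ i ih =>
    rw [pass, passStep] at h ⊢
    split_ifs at h ⊢ with h1 h2
    · exact ⟨Nat.lt_succ_self i, Finset.not_nonempty_iff_eq_empty.1 h2⟩
    · have := ih (by simpa using h1)
      exact ⟨by omega, this.2⟩

theorem stuck_of_fail {c : Slots} (hc : G.Consistent c) (h : ¬ (G.pass c G.k).ok = true) :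
    G.Stuck c (G.pass c G.k).W (G.pass c G.k).slot := by
  have h1 := pass_fail (G := G) (c := c) G.k (by simpa using h)
  refine ⟨hc, h1.1, pass_sub c _, fun v hv h0 => ?_⟩
  have : v ∈ G.cands c (G.pass c G.k).W (G.pass c G.k).slot := Finset.mem_filter.2 ⟨hv, h0⟩
  rw [h1.2] at this
  simp at this

/-! ### The rounds succeed -/

theorem all_round {c : Slots} (hc : G.Consistent c) : (G.round c).All G.Consistent := by
  rw [round]
  split_ifs with h
  · exact hc
  · exact (all_refine (stuck_of_fail hc h)).mono fun c' ⟨j, h'⟩ =>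
      h'.consistent (stuck_of_fail hc h)

theorem card_col_inter_sdiff (c : Slots) (W : Finset ℕ) (i j v : ℕ) :
    (G.nb v ∩ (c.K i ∪ G.col W j)).card =
      (G.nb v ∩ c.K i).card + (G.col (G.nb v ∩ (W \ c.K i)) j).card := by
  rw [← Finset.card_union_of_disjoint]
  · congr 1
    ext b
    simp only [col, Finset.mem_filter, Finset.mem_union, Finset.mem_sdiff, Finset.mem_inter]
    tauto
  · rw [Finset.disjoint_left]
    intro b h h'
    simp only [col, Finset.mem_filter, Finset.mem_sdiff, Finset.mem_inter] at h h'
    exact h'.1.2.2 h.2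

theorem bad_pos {c : Slots} {W : Finset ℕ} {i j v : ℕ} (h : G.bad c W i j v) :
    0 < (G.col (G.nb v ∩ (W \ c.K i)) j).card := by
  have h2 := h.2
  by_contra! h0
  have h0 : (G.col (G.nb v ∩ (W \ c.K i)) j).card = 0 := by omega
  rw [h0] at h2
  omega

/-- A refinement adds a vertex to `K i`, as bad vertices have an overlap with `W` outside `K i`. -/
theorem Refined.progress {c c' : Slots} {W : Finset ℕ} {i j : ℕ} (h : G.Stuck c W i)
    (h' : G.Refined c W i j c') :
    (∑ l ∈ Finset.range G.k, (c.K l).card) + 1 ≤ ∑ l ∈ Finset.range G.k, (c'.K l).card := by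
  refine Nat.succ_le_of_lt (Finset.sum_lt_sum (fun l _ => ?_) ⟨i, Finset.mem_range.2 h.lt, ?_⟩)
  · by_cases e : l = i
    · subst e
      rw [h'.K_eq]
      exact Finset.card_le_card Finset.subset_union_left
    · rw [h'.narrow.K_eq l e]
  · rw [h'.K_eq]
    refine Finset.card_lt_card ?_
    obtain ⟨v, hv⟩ := h'.narrow.narrow.ne i (h.cons.ne i h.lt)
    obtain ⟨b, hb⟩ := Finset.card_pos.1 (bad_pos (h'.bad v hv))
    simp only [col, Finset.mem_filter, Finset.mem_inter, Finset.mem_sdiff] at hb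
    refine ⟨Finset.subset_union_left, fun hs => hb.1.2.2 (hs ?_)⟩
    exact Finset.mem_union_right _ (Finset.mem_filter.2 ⟨hb.1.2.1, hb.2⟩)

theorem ex_rounds {o : ℕ → ℕ} (N : ℕ) {c : Slots} (hc : G.Consistent c) (hd : G.SameDegrees c)
    (ho : ∀ l < G.k, o l ∈ c.X l) :
    (DTree.iter N (fun _ => G.round) c).Ex fun c' => G.Consistent c' ∧ G.SameDegrees c' ∧
      (∀ l < G.k, o l ∈ c'.X l) ∧ ((G.pass c' G.k).ok = true ∨
        N ≤ ∑ l ∈ Finset.range G.k, (c'.K l).card) := by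
  refine ex_iter (P := fun N c' => G.Consistent c' ∧ G.SameDegrees c' ∧
      (∀ l < G.k, o l ∈ c'.X l) ∧ ((G.pass c' G.k).ok = true ∨
        N ≤ ∑ l ∈ Finset.range G.k, (c'.K l).card)) N ⟨hc, hd, ho, Or.inr (Nat.zero_le _)⟩ ?_
  rintro N' _ c' ⟨hc, hd, ho, h⟩
  rw [round]
  split_ifs with hok
  · exact ⟨hc, hd, ho, Or.inl hok⟩
  · have hs := stuck_of_fail hc hok
    refine (ex_refine ho).mono_of_all (all_refine hs) fun c'' ho' ⟨j, h'⟩ => ?_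
    refine ⟨h'.consistent hs, hd.narrow h'.narrow.narrow, ho', Or.inr ?_⟩
    have := h'.progress hs
    have := h.resolve_left hok
    omega

theorem all_guesses (hn : 0 < G.n) : G.guesses.All G.Consistent :=
  (all_guessDegrees hn).bind fun _ h =>
    all_iter (P := fun _ => G.Consistent) _ h.1 fun _ _ _ hc => all_round hc

/-- If there is a solution, then some run of the guessing algorithm finds a good selection. -/
theorem ex_guesses {o : ℕ → ℕ} (hn : 0 < G.n) (ho : ∀ i < G.k, o i < G.n)
    (hsol : ∀ j < G.r,
      G.t j ≤ (G.col ((Finset.range G.k).biUnion fun l => G.nb (o l)) j).card) :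
    G.guesses.Ex G.accepts := by
  have h1 := (ex_guessDegrees ho).mono_of_all (all_guessDegrees hn)
    (Q := fun c => (∀ i < G.k, o i ∈ c.X i) ∧ G.Consistent c ∧ G.SameDegrees c)
    fun c h h' => ⟨h, h'.1, h'.2.1⟩
  refine h1.bind fun c ⟨ho, hc, hd⟩ => ?_
  refine (ex_rounds (G.k * G.m + 1) hc hd ho).mono_of_all (all_true _) ?_
  rintro c' ⟨hc, hd, ho, h⟩ -
  refine accepts_of_ok hc hd (h.resolve_right fun hle => ?_) ho hsol
  have : ∑ l ∈ Finset.range G.k, (c'.K l).card ≤ ∑ l ∈ Finset.range G.k, G.m :=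
    Finset.sum_le_sum fun l hl => by
      simpa using Finset.card_le_card (hc.ksub l (Finset.mem_range.1 hl))
  rw [Finset.sum_const, Finset.card_range, smul_eq_mul] at this
  omega

end CoverData

namespace CoverData

variable {G : CoverData}

/-! ### The number of runs -/

/-- A bound of Kővári–Sós–Turán type: in the absence of `K_{d,d}`, few vertices have at least `2 d`
neighbours, and at least the fraction `1 / D`, in a given set. -/
theorem card_le_of_kfree {d : ℕ} (hG : G.KFree d) {S V : Finset ℕ} (hS : S ⊆ Finset.range G.n)
    (hV : V ⊆ Finset.range G.m) (h2 : ∀ v ∈ S, 2 * d ≤ (G.nb v ∩ V).card)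
    (hD : ∀ v ∈ S, V.card ≤ G.D * (G.nb v ∩ V).card) : S.card ≤ d * (2 * G.D) ^ d := by
  rcases S.eq_empty_or_nonempty with rfl | ⟨v₀, hv₀⟩
  · simp
  have hpos : 0 < V.card.choose d := by
    refine Nat.choose_pos ?_
    have := h2 v₀ hv₀
    have := Finset.card_le_card (Finset.inter_subset_right (s₁ := G.nb v₀) (s₂ := V))
    omega
  -- the vertex `v` has a fair share of the `d`-subsets of `V` in its neighbourhood
  have h3 : ∀ v ∈ S, V.card.choose d ≤ (2 * G.D) ^ d * (G.nb v ∩ V).card.choose d := by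
    intro v hv
    set q := (G.nb v ∩ V).card with hq
    have hq2 := h2 v hv
    have a1 : V.card.descFactorial d ≤ (2 * G.D) ^ d * q.descFactorial d :=
      calc V.card.descFactorial d ≤ V.card ^ d := Nat.descFactorial_le_pow _ _
        _ ≤ ((2 * G.D) * (q + 1 - d)) ^ d := by
          refine Nat.pow_le_pow_left ((hD v hv).trans ?_) d
          rw [mul_comm 2, mul_assoc]
          exact Nat.mul_le_mul_left _ (by omega)
        _ = (2 * G.D) ^ d * (q + 1 - d) ^ d := mul_pow _ _ _
        _ ≤ (2 * G.D) ^ d * q.descFactorial d :=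
          Nat.mul_le_mul_left _ (Nat.pow_sub_le_descFactorial _ _)
    rw [Nat.descFactorial_eq_factorial_mul_choose, Nat.descFactorial_eq_factorial_mul_choose] at a1
    have e : (2 * G.D) ^ d * (d.factorial * q.choose d) =
        d.factorial * ((2 * G.D) ^ d * q.choose d) := by ring
    rw [e] at a1
    exact Nat.le_of_mul_le_mul_left a1 d.factorial_pos
  -- count the pairs of a vertex and a `d`-subset of its neighbours in `V`
  have h4 : ∑ v ∈ S, (G.nb v ∩ V).card.choose d ≤ V.card.choose d * d := by
    have e1 : ∀ v ∈ S, (G.nb v ∩ V).card.choose d =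
        ((V.powersetCard d).filter fun T => T ⊆ G.nb v).card := by
      intro v _
      rw [← Finset.card_powersetCard]
      congr 1
      ext T
      simp only [Finset.mem_powersetCard, Finset.mem_filter, Finset.subset_inter_iff]
      tauto
    rw [Finset.sum_congr rfl e1]
    have e2 := Finset.sum_card_bipartiteAbove_eq_sum_card_bipartiteBelow
      (s := S) (t := V.powersetCard d) (fun v T => T ⊆ G.nb v)
    rw [show (∑ v ∈ S, ((V.powersetCard d).filter fun T => T ⊆ G.nb v).card) = _ from e2,
      ← Finset.card_powersetCard, ← smul_eq_mul]
    refine Finset.sum_le_card_nsmul _ _ _ fun T hT => ?_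
    by_contra! hlt
    obtain ⟨hTV, hTd⟩ := Finset.mem_powersetCard.1 hT
    obtain ⟨S', hS', hcard⟩ := Finset.exists_subset_card_eq hlt.le
    refine hG S' (hS'.trans ((Finset.filter_subset _ _).trans hS)) T (hTV.trans hV) hcard hTd ?_
    intro x hx y hy
    exact (mem_nb.1 ((Finset.mem_filter.1 (hS' hx)).2 hy)).2
  have h5 : S.card * V.card.choose d ≤ (2 * G.D) ^ d * (V.card.choose d * d) := by
    rw [← smul_eq_mul]
    refine (Finset.card_nsmul_le_sum S _ _ h3).trans ?_
    rw [← Finset.mul_sum]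
    exact Nat.mul_le_mul_left _ h4
  refine Nat.le_of_mul_le_mul_right (h5.trans (le_of_eq ?_)) hpos
  ring

/-- A bound on the number of runs for the guesses in slot `i`. As long as fewer than `d` common
neighbours of the slot are known, each new one pays for `r + D` binary guesses; after that, there are
fewer than `d` vertices left, and each of them pays for one run. -/
def weight (G : CoverData) (d : ℕ) (c : Slots) (i : ℕ) : ℕ :=
  if d ≤ (G.nb (rep (c.X i)) ∩ c.K i).card then (c.X i).card
  else 2 * d * 2 ^ (G.r + 2 * d * G.D) *
    2 ^ ((G.r + G.D) * (d - (G.nb (rep (c.X i)) ∩ c.K i).card))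

theorem kfree_pos {d : ℕ} (hG : G.KFree d) : 0 < d := by
  rcases Nat.eq_zero_or_pos d with rfl | h
  · exact absurd (by simp) (hG ∅ (by simp) ∅ (by simp) rfl rfl)
  · exact h

/-- A slot with `d` known common neighbours has fewer than `d` members. -/
theorem Consistent.card_lt {d : ℕ} (hG : G.KFree d) {c : Slots} (hc : G.Consistent c) {i : ℕ}
    (hi : i < G.k) (hd : d ≤ (G.nb (rep (c.X i)) ∩ c.K i).card) : (c.X i).card < d := by
  by_contra! hle
  obtain ⟨S, hS, hSd⟩ := Finset.exists_subset_card_eq hle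
  obtain ⟨T, hT, hTd⟩ := Finset.exists_subset_card_eq hd
  refine hG S (hS.trans (hc.sub i hi)) T
    (hT.trans (Finset.inter_subset_left.trans (nb_subset _))) hSd hTd fun x hx y hy => ?_
  have h := hT hy
  rw [hc.nb_inter hi (rep_mem (hc.ne i hi)) (hS hx)] at h
  exact (mem_nb.1 (Finset.mem_inter.1 h).1).2

theorem one_le_weight {d : ℕ} (hG : G.KFree d) {c : Slots} (hc : G.Consistent c) {i : ℕ}
    (hi : i < G.k) : 1 ≤ G.weight d c i := by
  unfold weight
  have := kfree_pos hG
  split_ifs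
  · exact Finset.card_pos.2 (hc.ne i hi)
  · have : 0 < 2 * d := by omega
    exact Nat.mul_pos (Nat.mul_pos this (Nat.two_pow_pos _)) (Nat.two_pow_pos _)

theorem size_guessColor (c : Slots) (W : Finset ℕ) (i : ℕ) :
    (G.guessColor c W i).size ≤ 2 ^ G.r :=
  size_iter_le_pow _ _ fun _ _ c => c.size_split _ _

theorem size_guessTrace {W : Finset ℕ} (hW : W ⊆ Finset.range G.m) (i j : ℕ) (c : Slots) :
    (G.guessTrace W i (j + 1) c).size ≤ 2 ^ (G.col W j).card := by
  refine (size_iter_le (c := fun b => if G.f b + 1 = j + 1 ∧ b ∈ W then 2 else 1) _ _ ?_).trans ?_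
  · intro b _ c
    by_cases h : G.f b + 1 = j + 1 ∧ b ∈ W
    · rw [if_pos h]
      split_ifs
      · exact c.size_learn G i b
      · simp [size, sum]
    · rw [if_neg h, if_neg (by tauto)]
      simp [size, sum]
  · rw [Finset.prod_ite, Finset.prod_const, Finset.prod_const_one, mul_one, filter_color hW]

theorem sum_guessColor (c : Slots) (W : Finset ℕ) (i : ℕ) (Y : Finset ℕ) :
    ((G.guessColor c W i).sum fun c' => (c'.X i ∩ Y).card) = (c.X i ∩ Y).card :=
  sum_iter_eq (g := fun c' : Slots => (c'.X i ∩ Y).card) _ _ fun _ c => c.sum_split i _ Y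

theorem sum_guessTrace (W : Finset ℕ) (i J : ℕ) (c : Slots) (Y : Finset ℕ) :
    ((G.guessTrace W i J c).sum fun c' => (c'.X i ∩ Y).card) = (c.X i ∩ Y).card := by
  refine sum_iter_eq (g := fun c' : Slots => (c'.X i ∩ Y).card) _ _ fun b c => ?_
  split_ifs
  · exact c.sum_learn G i b Y
  · rfl

/-- The weight of slot `i` after a refinement, in terms of the weight before: it drops by a factor
`2 ^ (r + |W_j| + 1)`, unless `2 d` new common neighbours became known at once. -/
theorem weight_refined {d : ℕ} (hG : G.KFree d) {c c' : Slots} {W : Finset ℕ} {i j : ℕ}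
    (h : G.Stuck c W i) (h' : G.Refined c W i j c')
    (hQ : (G.nb (rep (c.X i)) ∩ c.K i).card < d) :
    G.weight d c' i * 2 ^ (G.r + (G.col W j).card + 1) ≤ G.weight d c i +
      (c'.X i ∩ (c.X i).filter fun v =>
        2 * d ≤ (G.col (G.nb v ∩ (W \ c.K i)) j).card).card *
          2 ^ (G.r + (G.col W j).card + 1) := by
  have hc' := h'.consistent h
  have hr := rep_mem (hc'.ne i h.lt)
  have hrc := h'.narrow.narrow.sub i hr
  have hbad := h'.bad _ hr
  have hq0 := bad_pos hbad
  have hQ' := card_col_inter_sdiff (G := G) c W i j (rep (c'.X i))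
  rw [h.cons.nb_inter h.lt hrc (rep_mem (h.cons.ne i h.lt)), ← h'.K_eq] at hQ'
  have hQlt := hc'.card_lt hG h.lt
  set w := (G.col W j).card with hw
  set Q := (G.nb (rep (c.X i)) ∩ c.K i).card with hQdef
  set Q' := (G.nb (rep (c'.X i)) ∩ c'.K i).card with hQ'def
  set q := (G.col (G.nb (rep (c'.X i)) ∩ (W \ c.K i)) j).card with hqdef
  have hwq : w + 2 ≤ G.D * q := by
    have h1 : w < G.t j := hbad.1
    have h2 : G.t j < G.D * q := hbad.2
    omega
  have hP : G.weight d c i = 2 * d * 2 ^ (G.r + 2 * d * G.D) * 2 ^ ((G.r + G.D) * (d - Q)) := by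
    rw [weight, if_neg (by omega)]
  by_cases hd' : d ≤ Q'
  · have hwt : G.weight d c' i = (c'.X i).card := by rw [weight, if_pos hd']
    rw [hwt]
    by_cases hq2 : 2 * d ≤ q
    · have hall : (c'.X i ∩ (c.X i).filter fun v =>
          2 * d ≤ (G.col (G.nb v ∩ (W \ c.K i)) j).card) = c'.X i := by
        refine Finset.inter_eq_left.2 fun v hv => Finset.mem_filter.2
          ⟨h'.narrow.narrow.sub i hv, ?_⟩
        have e := card_col_inter_sdiff (G := G) c W i j v
        rw [h.cons.nb_inter h.lt (h'.narrow.narrow.sub i hv) (rep_mem (h.cons.ne i h.lt)),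
          ← h'.K_eq, hc'.nb_inter h.lt hv hr] at e
        omega
      rw [hall]
      exact Nat.le_add_left _ _
    · refine le_trans ?_ (Nat.le_add_right _ _)
      have hX := hQlt hd'
      have h1 : G.D * q ≤ 2 * d * G.D := by
        rw [mul_comm]
        exact Nat.mul_le_mul_right _ (by omega)
      rw [hP]
      calc (c'.X i).card * 2 ^ (G.r + w + 1)
          ≤ (2 * d) * 2 ^ (G.r + 2 * d * G.D) :=
            Nat.mul_le_mul (by omega) (Nat.pow_le_pow_right (by omega) (by omega))
        _ ≤ _ := Nat.le_mul_of_pos_right _ (Nat.two_pow_pos _)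
  · refine le_trans ?_ (Nat.le_add_right _ _)
    rw [hP, weight, if_neg hd', mul_assoc _ (2 ^ ((G.r + G.D) * (d - Q'))), ← pow_add]
    refine Nat.mul_le_mul_left _ (Nat.pow_le_pow_right (by omega) ?_)
    have e : d - Q = (d - Q') + q := by omega
    rw [e, mul_add, add_mul G.r G.D q]
    have : G.r * 1 ≤ G.r * q := Nat.mul_le_mul_left _ hq0
    omega

/-- The weight of the refined slot does not increase in total. -/
theorem sum_weight_refine {d : ℕ} (hG : G.KFree d) {c : Slots} {W : Finset ℕ} {i : ℕ}
    (h : G.Stuck c W i) : ((G.refine c W i).sum fun c' => G.weight d c' i) ≤ G.weight d c i := by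
  by_cases hQ : d ≤ (G.nb (rep (c.X i)) ∩ c.K i).card
  · -- from now on, the runs correspond to a partition of the slot
    have hw : G.weight d c i = (G.refine c W i).sum fun c' => (c'.X i ∩ c.X i).card := by
      rw [weight, if_pos hQ, refine, sum_bind]
      simp only [sum_guessTrace, sum_guessColor, Finset.inter_self]
    rw [hw]
    refine sum_le_of_all (all_refine h) fun c' ⟨j, h'⟩ => ?_
    have hsub := h'.narrow.narrow.sub i
    have hr := rep_mem ((h'.consistent h).ne i h.lt)
    have hQ' := card_col_inter_sdiff (G := G) c W i j (rep (c'.X i))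
    rw [h.cons.nb_inter h.lt (hsub hr) (rep_mem (h.cons.ne i h.lt)), ← h'.K_eq] at hQ'
    rw [weight, if_pos (by omega), Finset.inter_eq_left.2 hsub]
  · push Not at hQ
    have hP : 2 * d * 2 ^ (G.r + 2 * d * G.D) ≤ G.weight d c i := by
      rw [weight, if_neg (by omega)]
      exact Nat.le_mul_of_pos_right _ (Nat.two_pow_pos _)
    -- it suffices to lose a factor `2 ^ r` after the colour has been guessed
    have key : ∀ c₁, (c.NarrowAt i c₁ ∧ c₁.K = c.K ∧
        ∀ u ∈ c₁.X i, ∀ v ∈ c₁.X i, G.badColor c W i u = G.badColor c W i v) →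
        2 ^ G.r * ((G.guessTrace W i (G.badColor c W i (rep (c₁.X i))) c₁).sum fun c' =>
          G.weight d c' i) ≤ G.weight d c i := by
      intro c₁ h1
      obtain ⟨j, hj, e, hbad, htr⟩ := refined_of_guessColor h h1
      rw [e]
      set w := (G.col W j).card with hw
      set Y := (c.X i).filter fun v => 2 * d ≤ (G.col (G.nb v ∩ (W \ c.K i)) j).card with hY
      have hsum := sum_le_of_all htr
        (g := fun c' => 2 ^ (G.r + w + 1) * G.weight d c' i)
        (g' := fun c' => G.weight d c i + 2 ^ (G.r + w + 1) * (c'.X i ∩ Y).card)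
        fun c' h' => by
          have := weight_refined hG h h' hQ
          rw [mul_comm, mul_comm _ (Finset.card _)]
          exact this
      rw [sum_mul, sum_add, sum_mul, sum_const, sum_guessTrace] at hsum
      have hsize := Nat.mul_le_mul_right (G.weight d c i) (size_guessTrace h.sub i j c₁)
      rw [← hw] at hsize
      have hkst : (c₁.X i ∩ Y).card ≤ d * (2 * G.D) ^ d := by
        have hcol : ∀ v, G.nb v ∩ G.col (W \ c.K i) j = G.col (G.nb v ∩ (W \ c.K i)) j := by
          intro v
          ext b
          simp only [col, Finset.mem_filter, Finset.mem_inter]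
          tauto
        refine card_le_of_kfree hG (V := G.col (W \ c.K i) j)
          ((Finset.inter_subset_left.trans (h1.1.narrow.sub i)).trans (h.cons.sub i h.lt))
          ((Finset.filter_subset _ _).trans (Finset.sdiff_subset.trans h.sub)) ?_ ?_
        · intro v hv
          rw [hcol]
          exact (Finset.mem_filter.1 (Finset.mem_inter.1 hv).2).2
        · intro v hv
          rw [hcol]
          have hb := hbad v (Finset.mem_inter.1 hv).1
          have := Finset.card_le_card (G.col_mono (Finset.sdiff_subset (s := W) (t := c.K i)) j)
          have := hb.1
          have := hb.2
          omega
      have hD : (2 * G.D) ^ d ≤ 2 ^ (2 * d * G.D) := by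
        rw [show 2 * d * G.D = 2 * G.D * d by ring, pow_mul]
        exact Nat.pow_le_pow_left Nat.lt_two_pow_self.le d
      have hlast : 2 ^ (G.r + w + 1) * (c₁.X i ∩ Y).card ≤ 2 ^ w * G.weight d c i := by
        calc 2 ^ (G.r + w + 1) * (c₁.X i ∩ Y).card
            ≤ 2 ^ (G.r + w + 1) * (d * 2 ^ (2 * d * G.D)) :=
              Nat.mul_le_mul_left _ (hkst.trans (Nat.mul_le_mul_left _ hD))
          _ = 2 ^ w * (2 * d * 2 ^ (G.r + 2 * d * G.D)) := by ring
          _ ≤ _ := Nat.mul_le_mul_left _ hP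
      refine Nat.le_of_mul_le_mul_left (c := 2 ^ (w + 1)) ?_ (Nat.two_pow_pos _)
      calc _ = 2 ^ (G.r + w + 1) * ((G.guessTrace W i (j + 1) c₁).sum fun c' =>
            G.weight d c' i) := by rw [← mul_assoc, ← pow_add]; congr 2; omega
        _ ≤ _ := hsum
        _ ≤ 2 ^ w * G.weight d c i + 2 ^ w * G.weight d c i := add_le_add hsize hlast
        _ = 2 ^ (w + 1) * G.weight d c i := by ring
    have hA := sum_le_size_mul (all_guessColor c W i) key
    rw [sum_mul, ← sum_bind] at hA
    refine Nat.le_of_mul_le_mul_left (hA.trans ?_) (Nat.two_pow_pos G.r)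
    exact Nat.mul_le_mul_right _ (size_guessColor c W i)

/-- The total weight of the slots does not increase in a round. -/
theorem sum_weight_round {d : ℕ} (hG : G.KFree d) {c : Slots} (hc : G.Consistent c) :
    ((G.round c).sum fun c' => ∏ l ∈ Finset.range G.k, G.weight d c' l) ≤
      ∏ l ∈ Finset.range G.k, G.weight d c l := by
  rw [round]
  split_ifs with h
  · exact le_rfl
  · have hs := stuck_of_fail hc h
    set i := (G.pass c G.k).slot
    have hi := Finset.mem_range.2 hs.lt
    refine (sum_le_of_all (all_refine hs) (g' := fun c' =>
      (∏ l ∈ (Finset.range G.k).erase i, G.weight d c l) * G.weight d c' i) ?_).trans ?_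
    · rintro c' ⟨j, h'⟩
      rw [← Finset.prod_erase_mul _ _ hi]
      refine Nat.mul_le_mul_right _ (le_of_eq (Finset.prod_congr rfl fun l hl => ?_))
      have hl := Finset.ne_of_mem_erase hl
      rw [weight, weight, h'.narrow.X_eq l hl, h'.narrow.K_eq l hl]
    · rw [sum_mul, ← Finset.prod_erase_mul _ _ hi]
      exact Nat.mul_le_mul_left _ (sum_weight_refine hG hs)

theorem size_guesses {d : ℕ} (hG : G.KFree d) (hn : 0 < G.n) : G.guesses.size ≤
    2 ^ (G.D * G.r * G.k) *
      (2 * d * 2 ^ (G.r + 2 * d * G.D) * 2 ^ ((G.r + G.D) * d)) ^ G.k := by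
  rw [size, guesses, sum_bind]
  refine (sum_le_size_mul (all_guessDegrees hn) fun c ⟨hc, _, hK⟩ => ?_).trans
    (Nat.mul_le_mul_right _ size_guessDegrees)
  have h1 : ∀ N, ((DTree.iter N (fun _ => G.round) c).sum fun c' =>
      ∏ l ∈ Finset.range G.k, G.weight d c' l) ≤ ∏ l ∈ Finset.range G.k, G.weight d c l := by
    intro N
    induction N with
    | zero => exact le_rfl
    | succ N ih =>
      refine le_trans ?_ ih
      rw [DTree.iter, sum_bind]
      exact sum_le_of_all (all_iter (P := fun _ => G.Consistent) N hc
        fun _ _ _ hc => all_round hc) fun c' hc' => sum_weight_round hG hc'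
  refine (sum_le_of_all (all_iter (P := fun _ => G.Consistent) _ hc
    fun _ _ _ hc => all_round hc) fun c' hc' => ?_).trans ((h1 _).trans (le_of_eq ?_))
  · exact Finset.one_le_prod' fun l hl => one_le_weight hG hc' (Finset.mem_range.1 hl)
  · have hd := kfree_pos hG
    have : ∀ l, G.weight d c l = 2 * d * 2 ^ (G.r + 2 * d * G.D) * 2 ^ ((G.r + G.D) * d) := by
      intro l
      rw [weight, hK l, if_neg (by simp; omega)]
      simp
    simp [this]

/-! ### The number of guesses in a run -/

theorem depth_guesses : G.guesses.depth ≤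
    G.k * (G.r * G.D) + (G.k * G.m + 1) * (G.r + G.m) := by
  refine (depth_bind_le (c := (G.k * G.m + 1) * (G.r + G.m)) fun c => ?_).trans
    (Nat.add_le_add_right ?_ _)
  · refine depth_iter_le _ _ fun _ c => ?_
    rw [round]
    split_ifs
    · simp [depth]
    · refine (depth_bind_le (c := G.m) fun c' => ?_).trans (Nat.add_le_add_right ?_ _)
      · refine (depth_iter_le (c := 1) _ _ fun b c => ?_).trans (by omega)
        split_ifs
        · exact c.depth_learn G _ b
        · simp [depth]
      · exact (depth_iter_le (c := 1) _ _ fun j c => c.depth_split _ _).trans (by omega)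
  · refine depth_iter_le _ _ fun i c => depth_iter_le _ _ fun j c => ?_
    exact (depth_iter_le (c := 1) _ _ fun q c => c.depth_split _ _).trans (by omega)

end CoverData

/-! ### Loop programs -/

/-- Programs whose only loops are counting loops. -/
inductive LoopProg where
  | skip
  | assign (x : ℕ) (e : RamExpr)
  | store (a : ℕ) (i e : RamExpr)
  | seq (p q : LoopProg)
  | ite (e₁ e₂ : RamExpr) (p q : LoopProg)
  /-- run `p` with `reg x` equal to `0, …, reg n - 1` -/
  | loop (x n : ℕ) (p : LoopProg)

infixr:60 " ⨾ " => LoopProg.seq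

namespace RamState

/-- Change a register. -/
def setReg (s : RamState) (x v : ℕ) : RamState := ⟨Function.update s.reg x v, s.arr⟩

/-- Change an array. -/
def setArr (s : RamState) (a : ℕ) (h : ℕ → ℕ) : RamState := ⟨s.reg, Function.update s.arr a h⟩

variable (s : RamState)

@[simp] theorem reg_setReg (x v y : ℕ) : (s.setReg x v).reg y = if y = x then v else s.reg y :=
  Function.update_apply _ _ _ _

@[simp] theorem arr_setReg (x v : ℕ) : (s.setReg x v).arr = s.arr := rfl

@[simp] theorem reg_setArr (a : ℕ) (h : ℕ → ℕ) : (s.setArr a h).reg = s.reg := rfl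

@[simp] theorem arr_setArr (a b : ℕ) (h : ℕ → ℕ) :
    (s.setArr a h).arr b = if b = a then h else s.arr b :=
  Function.update_apply _ _ _ _

theorem setReg_setReg (x v w : ℕ) : (s.setReg x v).setReg x w = s.setReg x w := by
  simp [setReg]

theorem setReg_comm {x y : ℕ} (h : x ≠ y) (v w : ℕ) :
    (s.setReg x v).setReg y w = (s.setReg y w).setReg x v := by
  simp [setReg, Function.update_comm h]

theorem setArr_setArr (a : ℕ) (h h' : ℕ → ℕ) : (s.setArr a h).setArr a h' = s.setArr a h' := by
  simp [setArr]

theorem setArr_setReg (a : ℕ) (h : ℕ → ℕ) (x v : ℕ) :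
    (s.setReg x v).setArr a h = (s.setArr a h).setReg x v := rfl

theorem setReg_self (x : ℕ) : s.setReg x (s.reg x) = s := by
  simp [setReg]

theorem setArr_self (a : ℕ) : s.setArr a (s.arr a) = s := by
  simp [setArr]

end RamState

namespace LoopProg

/-- The program of the random access machine. -/
def compile : LoopProg → RamProg
  | skip => .skip
  | assign x e => .assign x e
  | store a i e => .store a i e
  | seq p q => .seq p.compile q.compile
  | ite e₁ e₂ p q => .ifLt e₁ e₂ p.compile q.compile
  | loop x n p => .seq (.assign x (.lit 0))
      (.whileLt (.var x) (.var n) (.seq p.compile (.assign x (.add (.var x) (.lit 1)))))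

/-- The effect of `i` iterations of a loop with body `F` and counter `x`. -/
def iterate (F : RamState → RamState) (x : ℕ) : ℕ → RamState → RamState
  | 0, s => s.setReg x 0
  | i + 1, s => (F (iterate F x i s)).setReg x (i + 1)

/-- The final state of a run. -/
def den : LoopProg → RamState → RamState
  | skip, s => s
  | assign x e, s => s.setReg x (e.eval s)
  | store a i e, s => s.setArr a (Function.update (s.arr a) (i.eval s) (e.eval s))
  | seq p q, s => q.den (p.den s)
  | ite e₁ e₂ p q, s => if e₁.eval s < e₂.eval s then p.den s else q.den s
  | loop x n p, s => iterate p.den x (s.reg n) s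

theorem den_seq (p q : LoopProg) (s : RamState) : (seq p q).den s = q.den (p.den s) := rfl

/-- The registers that may be changed. -/
def regs : LoopProg → List ℕ
  | skip => []
  | assign x _ => [x]
  | store _ _ _ => []
  | seq p q => p.regs ++ q.regs
  | ite _ _ p q => p.regs ++ q.regs
  | loop x _ p => x :: p.regs

/-- The arrays that may be changed. -/
def arrs : LoopProg → List ℕ
  | skip => []
  | assign _ _ => []
  | store a _ _ => [a]
  | seq p q => p.arrs ++ q.arrs
  | ite _ _ p q => p.arrs ++ q.arrs
  | loop _ _ p => p.arrs

/-- The registers that bound loops. -/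
def bounds : LoopProg → List ℕ
  | seq p q => p.bounds ++ q.bounds
  | ite _ _ p q => p.bounds ++ q.bounds
  | loop _ n p => n :: p.bounds
  | _ => []

/-- The body of a loop does not change its counter. -/
def Proper : LoopProg → Prop
  | seq p q => p.Proper ∧ q.Proper
  | ite _ _ p q => p.Proper ∧ q.Proper
  | loop x _ p => x ∉ p.regs ∧ p.Proper
  | _ => True

instance decidableProper : (p : LoopProg) → Decidable p.Proper
  | skip => isTrue trivial
  | assign _ _ => isTrue trivial
  | store _ _ _ => isTrue trivial
  | seq p q => @instDecidableAnd _ _ (decidableProper p) (decidableProper q)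
  | ite _ _ p q => @instDecidableAnd _ _ (decidableProper p) (decidableProper q)
  | loop x _ p =>
    @instDecidableAnd _ _ (inferInstanceAs (Decidable (x ∉ p.regs))) (decidableProper p)

/-- The loop bounds are constant, and loop counters are only changed by their loops. -/
def WellFormed (p : LoopProg) : Prop := p.Proper ∧ ∀ n ∈ p.bounds, n ∉ p.regs

instance (p : LoopProg) : Decidable p.WellFormed := inferInstanceAs (Decidable (_ ∧ _))

/-- A measure of the length of the program. -/
def size : LoopProg → ℕ
  | skip => 1
  | assign _ e => e.cost + 1
  | store _ i e => i.cost + e.cost + 1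
  | seq p q => p.size + q.size
  | ite e₁ e₂ p q => e₁.cost + e₂.cost + 1 + p.size + q.size
  | loop _ _ p => p.size + 12

/-- The nesting depth of loops. -/
def nesting : LoopProg → ℕ
  | seq p q => max p.nesting q.nesting
  | ite _ _ p q => max p.nesting q.nesting
  | loop _ _ p => p.nesting + 1
  | _ => 0

theorem reg_iterate {F : RamState → RamState} {x y : ℕ} (hxy : y ≠ x)
    (hF : ∀ s, (F s).reg y = s.reg y) (i : ℕ) (s : RamState) :
    (iterate F x i s).reg y = s.reg y := by
  induction i with
  | zero => simp [iterate, hxy]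
  | succ i ih => simp [iterate, hxy, hF, ih]

theorem reg_iterate_self (F : RamState → RamState) (x i : ℕ) (s : RamState) :
    (iterate F x i s).reg x = i := by
  cases i <;> simp [iterate]

theorem arr_iterate {F : RamState → RamState} {x a : ℕ}
    (hF : ∀ s, (F s).arr a = s.arr a) (i : ℕ) (s : RamState) :
    (iterate F x i s).arr a = s.arr a := by
  induction i with
  | zero => simp [iterate]
  | succ i ih => simp [iterate, hF, ih]

theorem den_reg {p : LoopProg} {x : ℕ} (hx : x ∉ p.regs) (s : RamState) :
    (p.den s).reg x = s.reg x := by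
  induction p generalizing s with
  | skip => rfl
  | assign y e =>
    have : x ≠ y := by simpa [regs] using hx
    simp [den, this]
  | store a i e => rfl
  | seq p q hp hq =>
    simp only [regs, List.mem_append, not_or] at hx
    rw [den, hq hx.2, hp hx.1]
  | ite e₁ e₂ p q hp hq =>
    simp only [regs, List.mem_append, not_or] at hx
    rw [den]
    split_ifs
    · exact hp hx.1 s
    · exact hq hx.2 s
  | loop y n p hp =>
    simp only [regs, List.mem_cons, not_or] at hx
    exact reg_iterate hx.1 (hp hx.2) _ _

theorem den_arr {p : LoopProg} {a : ℕ} (ha : a ∉ p.arrs) (s : RamState) :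
    (p.den s).arr a = s.arr a := by
  induction p generalizing s with
  | skip => rfl
  | assign y e => rfl
  | store b i e =>
    have : a ≠ b := by simpa [arrs] using ha
    simp [den, this]
  | seq p q hp hq =>
    simp only [arrs, List.mem_append, not_or] at ha
    rw [den, hq ha.2, hp ha.1]
  | ite e₁ e₂ p q hp hq =>
    simp only [arrs, List.mem_append, not_or] at ha
    rw [den]
    split_ifs
    · exact hp ha.1 s
    · exact hq ha.2 s
  | loop y n p hp => exact arr_iterate (hp ha) _ _

theorem exec_aux {p : LoopProg} (hp : p.Proper) {s : RamState} {M : ℕ} (hM : 1 ≤ M)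
    (hb : ∀ n ∈ p.bounds, s.reg n ≤ M ∧ n ∉ p.regs) :
    ∃ T ≤ p.size * M ^ p.nesting, RamExec p.compile s T (p.den s) := by
  induction p generalizing s with
  | skip => exact ⟨1, by simp [size, nesting], .skip s⟩
  | assign x e => exact ⟨_, by simp [size, nesting], .assign x e s⟩
  | store a i e => exact ⟨_, by simp [size, nesting], .store a i e s⟩
  | seq p q ihp ihq =>
    simp only [bounds, regs, List.mem_append, not_or] at hb
    obtain ⟨T₁, h₁, e₁⟩ := ihp hp.1 fun n hn => ⟨(hb n (Or.inl hn)).1, (hb n (Or.inl hn)).2.1⟩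
    obtain ⟨T₂, h₂, e₂⟩ := ihq hp.2 (s := p.den s) fun n hn => by
      obtain ⟨h1, h2, h3⟩ := hb n (Or.inr hn)
      exact ⟨by rwa [den_reg h2], h3⟩
    refine ⟨T₁ + T₂, ?_, .seq e₁ e₂⟩
    simp only [size, nesting, add_mul]
    refine add_le_add (h₁.trans ?_) (h₂.trans ?_)
    · exact Nat.mul_le_mul_left _ (Nat.pow_le_pow_right hM (le_max_left _ _))
    · exact Nat.mul_le_mul_left _ (Nat.pow_le_pow_right hM (le_max_right _ _))
  | ite e₁ e₂ p q ihp ihq =>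
    simp only [bounds, regs, List.mem_append, not_or] at hb
    have hone : 1 ≤ M ^ max p.nesting q.nesting := Nat.one_le_pow _ _ hM
    have hc : e₁.cost + e₂.cost + 1 ≤ (e₁.cost + e₂.cost + 1) * M ^ max p.nesting q.nesting :=
      Nat.le_mul_of_pos_right _ hone
    by_cases h : e₁.eval s < e₂.eval s
    · obtain ⟨T, hT, e⟩ := ihp hp.1 fun n hn => ⟨(hb n (Or.inl hn)).1, (hb n (Or.inl hn)).2.1⟩
      refine ⟨_, ?_, by rw [den, if_pos h]; exact .ifTrue h e⟩
      simp only [size, nesting, add_mul _ _ (M ^ _)] at hc ⊢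
      have := hT.trans (Nat.mul_le_mul_left p.size
        (Nat.pow_le_pow_right hM (le_max_left p.nesting q.nesting)))
      omega
    · obtain ⟨T, hT, e⟩ := ihq hp.2 fun n hn => ⟨(hb n (Or.inr hn)).1, (hb n (Or.inr hn)).2.2⟩
      refine ⟨_, ?_, by rw [den, if_neg h]; exact .ifFalse h e⟩
      simp only [size, nesting, add_mul _ _ (M ^ _)] at hc ⊢
      have := hT.trans (Nat.mul_le_mul_left q.size
        (Nat.pow_le_pow_right hM (le_max_right p.nesting q.nesting)))
      omega
  | loop x n p ih =>
    simp only [bounds, regs, List.mem_cons, forall_eq_or_imp, not_or] at hb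
    obtain ⟨⟨hN, hnx, hnp⟩, hb⟩ := hb
    set N := s.reg n with hNdef
    set B := p.size * M ^ p.nesting with hB
    -- run the remaining `d` iterations
    have key : ∀ d, d ≤ N → ∃ T ≤ d * (B + 7) + 3, RamExec
        (.whileLt (.var x) (.var n) (.seq p.compile (.assign x (.add (.var x) (.lit 1)))))
        (iterate p.den x (N - d) s) T (iterate p.den x N s) := by
      intro d
      induction d with
      | zero =>
        intro _
        refine ⟨3, by omega, .whileFalse ?_⟩
        simp [RamExpr.eval, reg_iterate_self, reg_iterate hnx (fun s => den_reg hnp s), ← hNdef]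
      | succ d ihd =>
        intro hd
        obtain ⟨T', hT', e'⟩ := ihd (by omega)
        have hreg : ∀ y, y ≠ x → y ∉ p.regs →
            (iterate p.den x (N - (d + 1)) s).reg y = s.reg y := fun y h1 h2 =>
          reg_iterate h1 (fun s => den_reg h2 s) _ _
        obtain ⟨T, hT, e⟩ := ih hp.2 (s := iterate p.den x (N - (d + 1)) s) fun y hy => by
          obtain ⟨h1, h2, h3⟩ := hb y hy
          exact ⟨by rwa [hreg y h2 h3], h3⟩
        have e2 := RamExec.assign x (.add (.var x) (.lit 1))
          (p.den (iterate p.den x (N - (d + 1)) s))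
        have hstep : (⟨Function.update (p.den (iterate p.den x (N - (d + 1)) s)).reg x
            ((RamExpr.add (.var x) (.lit 1)).eval (p.den (iterate p.den x (N - (d + 1)) s))),
            (p.den (iterate p.den x (N - (d + 1)) s)).arr⟩ : RamState) =
            iterate p.den x (N - d) s := by
          have hd' : N - d = N - (d + 1) + 1 := by omega
          rw [hd', iterate, RamState.setReg, RamExpr.eval, RamExpr.eval, RamExpr.eval,
            den_reg hp.1, reg_iterate_self]
        rw [hstep] at e2
        refine ⟨_, ?_, .whileTrue ?_ (.seq e e2) e'⟩
        · simp only [RamExpr.cost]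
          rw [Nat.succ_mul]
          omega
        · simp only [RamExpr.eval, reg_iterate_self, hreg n hnx hnp]
          omega
    obtain ⟨T, hT, e⟩ := key N le_rfl
    rw [Nat.sub_self] at e
    refine ⟨2 + T, ?_, .seq (.assign x (.lit 0) s) e⟩
    have h1 : N * (B + 7) ≤ M * (B + 7) := Nat.mul_le_mul_right _ hN
    have h2 : M ≤ M ^ (p.nesting + 1) := Nat.le_self_pow (by omega) M
    have h3 : M * B = p.size * M ^ (p.nesting + 1) := by rw [hB, pow_succ]; ring
    simp only [size, nesting]
    rw [add_mul p.size, ← h3]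
    have h4 : M * (B + 7) = M * B + 7 * M := by ring
    omega

/-- A well-formed loop program halts in polynomial time, in the state given by `den`. -/
theorem exec {p : LoopProg} (hp : p.WellFormed) {s : RamState} {M : ℕ} (hM : 1 ≤ M)
    (hb : ∀ n ∈ p.bounds, s.reg n ≤ M) :
    ∃ T ≤ p.size * M ^ p.nesting, RamExec p.compile s T (p.den s) :=
  exec_aux hp.1 hM fun n hn => ⟨hb n hn, hp.2 n hn⟩

/-- The invariant rule for loops. -/
theorem den_loop {x n : ℕ} {p : LoopProg} {s : RamState} {N : ℕ} (Inv : ℕ → RamState → Prop)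
    (hN : s.reg n = N) (h0 : Inv 0 (s.setReg x 0))
    (h : ∀ i < N, ∀ s', s'.reg x = i → Inv i s' → Inv (i + 1) ((p.den s').setReg x (i + 1))) :
    Inv N ((loop x n p).den s) := by
  rw [den, hN]
  have : ∀ i ≤ N, Inv i (iterate p.den x i s) := by
    intro i
    induction i with
    | zero => exact fun _ => h0
    | succ i ih => exact fun hi => h i (by omega) _ (reg_iterate_self _ _ _ _) (ih (by omega))
  exact this N le_rfl

end LoopProg

/-! ### Truth values and basic loops -/

open Classical in
/-- The truth value of a proposition. -/
noncomputable def ind (P : Prop) : ℕ := if P then 1 else 0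

@[simp] theorem ind_and (P Q : Prop) : ind P + ind Q - 1 = ind (P ∧ Q) := by
  unfold ind; split_ifs <;> first | rfl | tauto

@[simp] theorem ind_or (P Q : Prop) : 1 - (1 - (ind P + ind Q)) = ind (P ∨ Q) := by
  unfold ind; split_ifs <;> first | rfl | tauto

@[simp] theorem ind_not (P : Prop) : 1 - ind P = ind (¬ P) := by
  unfold ind; split_ifs <;> rfl

@[simp] theorem ind_pos {P : Prop} : 0 < ind P ↔ P := by
  unfold ind; split_ifs with h <;> simp [h]

theorem ind_true {P : Prop} (h : P) : ind P = 1 := by simp [ind, h]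

theorem ind_false {P : Prop} (h : ¬ P) : ind P = 0 := by simp [ind, h]

theorem sum_ind (N : ℕ) (P : ℕ → Prop) [DecidablePred P] :
    ∑ i ∈ Finset.range N, ind (P i) = ((Finset.range N).filter P).card := by
  rw [Finset.card_filter]
  refine Finset.sum_congr rfl fun i _ => ?_
  unfold ind
  split_ifs <;> rfl

namespace RamExpr

/-- The truth value of `a < b`. -/
def isLt (a b : RamExpr) : RamExpr := .sub (.lit 1) (.sub (.lit 1) (.sub b a))

/-- The truth value of `a = b`. -/
def isEq (a b : RamExpr) : RamExpr := .sub (.lit 1) (.add (.sub a b) (.sub b a))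

/-- Conjunction of truth values. -/
def and (a b : RamExpr) : RamExpr := .sub (.add a b) (.lit 1)

/-- Disjunction of truth values. -/
def or (a b : RamExpr) : RamExpr := .sub (.lit 1) (.sub (.lit 1) (.add a b))

/-- Negation of a truth value. -/
def not (a : RamExpr) : RamExpr := .sub (.lit 1) a

variable (s : RamState)

@[simp] theorem eval_lit (c : ℕ) : (lit c).eval s = c := rfl
@[simp] theorem eval_var (x : ℕ) : (var x).eval s = s.reg x := rfl
@[simp] theorem eval_get (a : ℕ) (e : RamExpr) : (get a e).eval s = s.arr a (e.eval s) := rfl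
@[simp] theorem eval_add (a b : RamExpr) : (add a b).eval s = a.eval s + b.eval s := rfl
@[simp] theorem eval_sub (a b : RamExpr) : (sub a b).eval s = a.eval s - b.eval s := rfl

@[simp] theorem eval_isLt (a b : RamExpr) : (isLt a b).eval s = ind (a.eval s < b.eval s) := by
  simp only [isLt, eval_sub, eval_lit, ind]
  split_ifs <;> omega

@[simp] theorem eval_isEq (a b : RamExpr) : (isEq a b).eval s = ind (a.eval s = b.eval s) := by
  simp only [isEq, eval_sub, eval_lit, eval_add, ind]
  split_ifs <;> omega

@[simp] theorem eval_and (a b : RamExpr) : (and a b).eval s = a.eval s + b.eval s - 1 := rfl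
@[simp] theorem eval_or (a b : RamExpr) : (or a b).eval s = 1 - (1 - (a.eval s + b.eval s)) := rfl
@[simp] theorem eval_not (a : RamExpr) : (not a).eval s = 1 - a.eval s := rfl

end RamExpr

namespace LoopProg

/-- `reg c := ∑ x < reg n, e` -/
def sumLoop (c x n : ℕ) (e : RamExpr) : LoopProg :=
  assign c (.lit 0) ⨾ loop x n (assign c (.add (.var c) e))

/-- `arr a (idx x) := e x` for all `x < reg n`. -/
def mapLoop (a x n : ℕ) (idx e : RamExpr) : LoopProg := loop x n (store a idx e)

/-- Let `reg c` be the last `x < reg n` with `0 < e`, or `0` if there is none. -/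
def lastLoop (c x n : ℕ) (e : RamExpr) : LoopProg :=
  assign c (.lit 0) ⨾ loop x n (ite (.lit 0) e (assign c (.var x)) skip)

theorem den_sumLoop {c x n : ℕ} {e : RamExpr} {s : RamState} {N : ℕ} (g : ℕ → ℕ) (hcx : x ≠ c)
    (hnc : n ≠ c) (hN : s.reg n = N)
    (h : ∀ i < N, ∀ v, e.eval ((s.setReg c v).setReg x i) = g i) :
    (sumLoop c x n e).den s = (s.setReg c (∑ i ∈ Finset.range N, g i)).setReg x N := by
  rw [sumLoop, den]
  refine den_loop (fun i s' => s' = (s.setReg c (∑ i ∈ Finset.range i, g i)).setReg x i)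
    (by simp [den, hnc, hN]) rfl ?_
  rintro i hi s' - rfl
  rw [den, RamExpr.eval_add, h i hi, Finset.sum_range_succ, RamState.setReg_comm _ hcx,
    RamState.setReg_setReg, RamState.setReg_setReg]
  simp [hcx.symm]

theorem den_mapLoop {a x n : ℕ} {idx e : RamExpr} {s : RamState} {N : ℕ} (base : ℕ) (g : ℕ → ℕ)
    (hN : s.reg n = N)
    (hidx : ∀ i < N, ∀ h, idx.eval ((s.setArr a h).setReg x i) = base + i)
    (he : ∀ i < N, ∀ h, h (base + i) = s.arr a (base + i) →
      e.eval ((s.setArr a h).setReg x i) = g i) :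
    (mapLoop a x n idx e).den s = (s.setArr a fun y =>
      if base ≤ y ∧ y < base + N then g (y - base) else s.arr a y).setReg x N := by
  rw [mapLoop]
  refine den_loop (fun i s' => s' = (s.setArr a fun y =>
      if base ≤ y ∧ y < base + i then g (y - base) else s.arr a y).setReg x i) hN ?_ ?_
  · have : (fun y => if base ≤ y ∧ y < base + 0 then g (y - base) else s.arr a y) = s.arr a := by
      funext y
      exact if_neg (by omega)
    rw [this, RamState.setArr_self]
  · rintro i hi s' - rfl
    rw [den, hidx i hi, he i hi _ (if_neg (by omega)), RamState.setArr_setReg,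
      RamState.setReg_setReg, RamState.setArr_setArr]
    congr 2
    funext y
    simp only [RamState.arr_setReg, RamState.arr_setArr, if_true, Function.update_apply]
    by_cases h : y = base + i
    · subst h
      simp
    · rw [if_neg h]
      split_ifs <;> first | rfl | omega

theorem den_lastLoop {c x n : ℕ} {e : RamExpr} {s : RamState} {N : ℕ} (P : ℕ → Prop)
    [DecidablePred P] (hcx : x ≠ c) (hnc : n ≠ c) (hN : s.reg n = N)
    (h : ∀ i < N, ∀ v, e.eval ((s.setReg c v).setReg x i) = ind (P i)) :
    (lastLoop c x n e).den s =
      (s.setReg c (rep ((Finset.range N).filter P))).setReg x N := by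
  rw [lastLoop, den]
  refine den_loop (fun i s' => s' = (s.setReg c (rep ((Finset.range i).filter P))).setReg x i)
    (by simp [den, hnc, hN]) rfl ?_
  rintro i hi s' - rfl
  rw [den, h i hi, Finset.range_add_one, Finset.filter_insert]
  by_cases hP : P i
  · have hle : rep ((Finset.range i).filter P) ≤ i :=
      Finset.sup_le fun j hj => (Finset.mem_range.1 (Finset.mem_filter.1 hj).1).le
    have hrep : rep (insert i ((Finset.range i).filter P)) = i := by
      rw [rep, Finset.sup_insert]
      exact max_eq_left hle
    rw [if_pos (by simpa using hP), if_pos hP, hrep, den, RamState.setReg_comm _ hcx,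
      RamState.setReg_setReg, RamState.setReg_setReg]
    simp
  · rw [if_neg (by simpa using hP), if_neg hP, den, RamState.setReg_setReg]

end LoopProg

open LoopProg RamExpr

/-! ### Representation of the guessing algorithm in memory -/

namespace CoverData

variable {G : CoverData}

/-- The instance and the tables computed from it are in memory: the registers `0, 1, 2, 3, 6, 7`
hold `n`, `m`, `r`, `k`, `D` and the number of rounds, the arrays `0, 1, 2` the input, and the arrays
`4, 5, 6, 7` the multiples of `m`, of `n` and of `D`, and the numbers `(D - 2 k) t j`. -/
structure Static (G : CoverData) (s : RamState) : Prop where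
  kn : G.k < G.n
  n : s.reg 0 = G.n
  m : s.reg 1 = G.m
  r : s.reg 2 = G.r
  k : s.reg 3 = G.k
  D : s.reg 6 = G.D
  fuel : s.reg 7 = G.k * G.m + 1
  adj : ∀ a < G.n, ∀ b < G.m, s.arr 0 (a * G.m + b) = ind (G.adj a b = true)
  f : ∀ b < G.m, s.arr 1 b = G.f b
  t : ∀ j < G.r, s.arr 2 j = G.t j
  rowM : ∀ a < G.n, s.arr 4 a = a * G.m
  rowN : ∀ a < G.n, s.arr 5 a = a * G.n
  mulD : ∀ x ≤ G.m, s.arr 6 x = G.D * x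
  thr : ∀ j < G.r, s.arr 7 j = (G.D - (G.k + G.k)) * G.t j

/-- The slots `c` are in the arrays `9` and `10`, row by row; the advice `α` is in array `8`, and
register `8` holds the position `p` up to which it has been used. -/
structure Rep (G : CoverData) (α : ℕ → ℕ) (c : Slots) (p : ℕ) (s : RamState) : Prop
    extends Static G s where
  adv : s.arr 8 = α
  pos : s.reg 8 = p
  Xsub : ∀ i < G.k, c.X i ⊆ Finset.range G.n
  Ksub : ∀ i < G.k, c.K i ⊆ Finset.range G.m
  X : ∀ i < G.k, ∀ v < G.n, s.arr 9 (i * G.n + v) = ind (v ∈ c.X i)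
  K : ∀ i < G.k, ∀ b < G.m, s.arr 10 (i * G.m + b) = ind (b ∈ c.K i)

theorem Static.congr {s s' : RamState} (h : Static G s)
    (hr : ∀ x ∈ [0, 1, 2, 3, 6, 7], s'.reg x = s.reg x)
    (ha : ∀ a ∈ [0, 1, 2, 4, 5, 6, 7], s'.arr a = s.arr a) : Static G s' := by
  simp only [List.mem_cons, List.not_mem_nil, or_false, forall_eq_or_imp, forall_eq] at hr ha
  obtain ⟨r0, r1, r2, r3, r6, r7⟩ := hr
  obtain ⟨a0, a1, a2, a4, a5, a6, a7⟩ := ha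
  constructor
  · exact h.kn
  · rw [r0, h.n]
  · rw [r1, h.m]
  · rw [r2, h.r]
  · rw [r3, h.k]
  · rw [r6, h.D]
  · rw [r7, h.fuel]
  · rw [a0]; exact h.adj
  · rw [a1]; exact h.f
  · rw [a2]; exact h.t
  · rw [a4]; exact h.rowM
  · rw [a5]; exact h.rowN
  · rw [a6]; exact h.mulD
  · rw [a7]; exact h.thr

theorem Rep.congr {α : ℕ → ℕ} {c : Slots} {p : ℕ} {s s' : RamState} (h : Rep G α c p s)
    (hr : ∀ x ∈ [0, 1, 2, 3, 6, 7, 8], s'.reg x = s.reg x)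
    (ha : ∀ a ∈ [0, 1, 2, 4, 5, 6, 7, 8, 9, 10], s'.arr a = s.arr a) : Rep G α c p s' :=
  { h.toStatic.congr (fun x hx => hr x (by simp at hx ⊢; tauto))
      (fun a hx => ha a (by simp at hx ⊢; tauto)) with
    adv := by rw [ha 8 (by simp), h.adv]
    pos := by rw [hr 8 (by simp), h.pos]
    Xsub := h.Xsub
    Ksub := h.Ksub
    X := by rw [ha 9 (by simp)]; exact h.X
    K := by rw [ha 10 (by simp)]; exact h.K }

theorem Rep.den {α : ℕ → ℕ} {c : Slots} {p : ℕ} {s : RamState} (h : Rep G α c p s)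
    (P : LoopProg) (hr : ∀ x ∈ [0, 1, 2, 3, 6, 7, 8], x ∉ P.regs)
    (ha : ∀ a ∈ [0, 1, 2, 4, 5, 6, 7, 8, 9, 10], a ∉ P.arrs) : Rep G α c p (P.den s) :=
  h.congr (fun x hx => den_reg (hr x hx) s) fun a hx => den_arr (ha a hx) s

theorem Rep.setReg {α : ℕ → ℕ} {c : Slots} {p : ℕ} {s : RamState} (h : Rep G α c p s) (x v : ℕ)
    (hx : x ∉ [0, 1, 2, 3, 6, 7, 8]) : Rep G α c p (s.setReg x v) :=
  h.congr (fun y hy => by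
    rw [RamState.reg_setReg, if_neg]; rintro rfl; exact hx hy) fun a _ => rfl

theorem Rep.setArr {α : ℕ → ℕ} {c : Slots} {p : ℕ} {s : RamState} (h : Rep G α c p s) (a : ℕ)
    (f : ℕ → ℕ) (hx : a ∉ [0, 1, 2, 4, 5, 6, 7, 8, 9, 10]) : Rep G α c p (s.setArr a f) :=
  h.congr (fun y _ => rfl) fun b hb => by
    rw [RamState.arr_setArr, if_neg]; rintro rfl; exact hx hb

/-- The adjacency of `a` and `b`. -/
def adjAt (a b : RamExpr) : RamExpr := .get 0 (.add (.get 4 a) b)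

/-- Membership of `v` in slot `i`. -/
def xAt (i v : RamExpr) : RamExpr := .get 9 (.add (.get 5 i) v)

/-- Whether the adjacency to `b` is known for slot `i`. -/
def kAt (i b : RamExpr) : RamExpr := .get 10 (.add (.get 4 i) b)

/-- A row-major address lies in row `i` only if its row is `i`. -/
theorem row_iff {n l v i : ℕ} (hv : v < n) : (i * n ≤ l * n + v ∧ l * n + v < i * n + n) ↔ l = i := by
  constructor
  · rintro ⟨h1, h2⟩
    have h3 : i < l + 1 := by
      by_contra! h
      have := Nat.mul_le_mul_right n h
      rw [Nat.succ_mul] at this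
      omega
    have h4 : l < i + 1 := by
      by_contra! h
      have := Nat.mul_le_mul_right n h
      rw [Nat.succ_mul] at this
      omega
    omega
  · rintro rfl
    omega

/-! ### Guessing -/

/-- Split the slot given by register `10` according to the truth values in array `12`. -/
def splitProg : LoopProg :=
  sumLoop 13 11 0 ((xAt (.var 10) (.var 11)).and (.get 12 (.var 11))) ⨾
  sumLoop 14 11 0 ((xAt (.var 10) (.var 11)).and (RamExpr.not (.get 12 (.var 11)))) ⨾
  ite (.lit 0) (.var 13)
    (ite (.lit 0) (.var 14)
      (ite (.lit 0) (.get 8 (.var 8)) (assign 15 (.lit 1)) (assign 15 (.lit 0)) ⨾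
        assign 8 (.add (.var 8) (.lit 1)))
      (assign 15 (.lit 1)))
    (assign 15 (.lit 0)) ⨾
  mapLoop 9 11 0 (.add (.get 5 (.var 10)) (.var 11))
    ((xAt (.var 10) (.var 11)).and (RamExpr.isEq (.get 12 (.var 11)) (.var 15)))

theorem walk_split (c : Slots) (i : ℕ) (P : ℕ → Bool) (α : ℕ → ℕ) (p : ℕ) :
    (c.split i P).walk α p =
      if ((c.X i).filter fun v => P v = true).Nonempty ∧
        ((c.X i).filter fun v => P v = false).Nonempty then
        if α p = 0 then
          (⟨Function.update c.X i ((c.X i).filter fun v => P v = false), c.K⟩, p + 1)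
        else (⟨Function.update c.X i ((c.X i).filter fun v => P v = true), c.K⟩, p + 1)
      else (c, p) := by
  unfold Slots.split splitSet
  split_ifs <;> simp [DTree.bind, walk, *]

/-- Restricting a slot in memory. -/
theorem Rep.restrict {α : ℕ → ℕ} {c : Slots} {p : ℕ} {s : RamState} (h : Rep G α c p s)
    (hi : s.reg 10 < G.k) (P : ℕ → Bool) (hP : ∀ v < G.n, s.arr 12 v = ind (P v = true)) (β : Bool)
    (hβ : s.reg 15 = ind (β = true)) :
    Rep G α ⟨Function.update c.X (s.reg 10) ((c.X (s.reg 10)).filter fun v => P v = β), c.K⟩ p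
      ((mapLoop 9 11 0 (.add (.get 5 (.var 10)) (.var 11))
        ((xAt (.var 10) (.var 11)).and (RamExpr.isEq (.get 12 (.var 11)) (.var 15)))).den s) := by
  rw [den_mapLoop (s.reg 10 * G.n)
    (fun v => ind (v ∈ (c.X (s.reg 10)).filter fun v => P v = β)) h.n]
  · refine { h.toStatic.congr (by simp) (by simp) with
      adv := by simpa using h.adv
      pos := by simpa using h.pos
      Xsub := fun i hi => ?_
      Ksub := h.Ksub
      X := fun i hi' v hv => ?_
      K := by simpa using h.K }
    · by_cases e : i = s.reg 10
      · subst e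
        simpa using (Finset.filter_subset _ _).trans (h.Xsub _ hi)
      · simpa [e] using h.Xsub _ hi
    · simp only [RamState.arr_setReg, RamState.arr_setArr, if_true]
      by_cases e : i = s.reg 10
      · rw [if_pos ((row_iff hv).2 e)]
        subst e
        simp
      · rw [if_neg (mt (row_iff hv).1 e), h.X _ hi' _ hv]
        simp [e]
  · intro v hv f
    simp [h.rowN _ (hi.trans h.kn)]
  · intro v hv f hf
    have e1 : P v = β ↔ ind (P v = true) = ind (β = true) := by
      cases P v <;> cases β <;> simp [ind]
    simp [xAt, h.rowN _ (hi.trans h.kn), hf, h.X _ hi _ hv, hP _ hv, hβ, e1]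

theorem splitProg_spec {α : ℕ → ℕ} {c : Slots} {p : ℕ} {s : RamState} (h : Rep G α c p s)
    (hi : s.reg 10 < G.k) (P : ℕ → Bool) (hP : ∀ v < G.n, s.arr 12 v = ind (P v = true)) :
    Rep G α ((c.split (s.reg 10) P).walk α p).1 ((c.split (s.reg 10) P).walk α p).2
      (splitProg.den s) := by
  have hs : ∀ β : Bool, ((Finset.range G.n).filter fun v => v ∈ c.X (s.reg 10) ∧ P v = β) =
      (c.X (s.reg 10)).filter fun v => P v = β := by
    intro β
    ext v
    simp only [Finset.mem_filter]
    exact ⟨fun h => h.2, fun hv => ⟨h.Xsub _ hi hv.1, hv⟩⟩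
  have h1 := den_sumLoop (c := 13) (x := 11) (n := 0) (s := s)
    (e := (xAt (.var 10) (.var 11)).and (.get 12 (.var 11)))
    (fun v => ind (v ∈ c.X (s.reg 10) ∧ P v = true)) (by decide) (by decide) h.n (by
      intro v hv a
      simp [xAt, h.rowN _ (hi.trans h.kn), h.X _ hi _ hv, hP _ hv])
  rw [sum_ind, hs] at h1
  set s1 := (s.setReg 13 ((c.X (s.reg 10)).filter fun v => P v = true).card).setReg 11 G.n with hs1
  have r1 : Rep G α c p s1 := (h.setReg _ _ (by simp)).setReg _ _ (by simp)
  have h2 := den_sumLoop (c := 14) (x := 11) (n := 0) (s := s1)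
    (e := (xAt (.var 10) (.var 11)).and (RamExpr.not (.get 12 (.var 11))))
    (fun v => ind (v ∈ c.X (s.reg 10) ∧ P v = false)) (by decide) (by decide) r1.n (by
      intro v hv a
      simp [s1, xAt, h.rowN _ (hi.trans h.kn), h.X _ hi _ hv, hP _ hv])
  rw [sum_ind, hs] at h2
  set s2 := (s1.setReg 14 ((c.X (s.reg 10)).filter fun v => P v = false).card).setReg 11 G.n
    with hs2
  have r2 : Rep G α c p s2 := (r1.setReg _ _ (by simp)).setReg _ _ (by simp)
  have e13 : s2.reg 13 = ((c.X (s.reg 10)).filter fun v => P v = true).card := by simp [s2, s1]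
  have e14 : s2.reg 14 = ((c.X (s.reg 10)).filter fun v => P v = false).card := by simp [s2]
  have e10 : s2.reg 10 = s.reg 10 := by simp [s2, s1]
  have e12 : ∀ v < G.n, s2.arr 12 v = ind (P v = true) := by simpa [s2, s1] using hP
  have e88 : s2.arr 8 (s2.reg 8) = α p := by rw [r2.adv, r2.pos]
  have e8 : s2.reg 8 = p := r2.pos
  rw [walk_split, splitProg, LoopProg.den, h1, LoopProg.den, h2, LoopProg.den]
  -- the case of only one value: the slot is not changed
  have hid : ∀ β : Bool, ((c.X (s.reg 10)).filter fun v => P v = !β) = ∅ →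
      (⟨Function.update c.X (s.reg 10) ((c.X (s.reg 10)).filter fun v => P v = β), c.K⟩ : Slots)
        = c := by
    intro β hβ
    rw [Finset.filter_eq_empty_iff] at hβ
    rw [Finset.filter_true_of_mem, Function.update_eq_self]
    intro v hv
    have := hβ hv
    revert this
    cases P v <;> cases β <;> simp
  simp only [LoopProg.den, RamExpr.eval_lit, RamExpr.eval_var, RamExpr.eval_get, e13, e14, e88,
    Finset.card_pos]
  have key : ∀ (β : Bool) (q : ℕ) (s3 : RamState), Rep G α c q s3 → s3.reg 10 = s.reg 10 →
      (∀ v < G.n, s3.arr 12 v = ind (P v = true)) → s3.reg 15 = ind (β = true) →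
      Rep G α ⟨Function.update c.X (s.reg 10) ((c.X (s.reg 10)).filter fun v => P v = β), c.K⟩ q
        ((mapLoop 9 11 0 (.add (.get 5 (.var 10)) (.var 11))
        ((xAt (.var 10) (.var 11)).and (RamExpr.isEq (.get 12 (.var 11)) (.var 15)))).den s3) := by
    intro β q s3 h3 h10 h12 h15
    have := h3.restrict (by rw [h10]; exact hi) P h12 β h15
    rwa [h10] at this
  have rpos : ∀ v, Rep G α c (p + 1) ((s2.setReg 15 v).setReg 8 (p + 1)) := by
    intro v
    refine { r2.toStatic.congr (by simp) (by simp) with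
      adv := r2.adv
      pos := by simp
      Xsub := r2.Xsub
      Ksub := r2.Ksub
      X := r2.X
      K := r2.K }
  by_cases ht : ((c.X (s.reg 10)).filter fun v => P v = true).Nonempty
  · by_cases hf : ((c.X (s.reg 10)).filter fun v => P v = false).Nonempty
    · by_cases h0 : α p = 0
      · simp only [ht, hf, h0, and_self, if_true, lt_self_iff_false, if_false]
        exact key false (p + 1) _ (by simpa [e8] using rpos 0) (by simpa using e10)
          (by simpa using e12) (by simp [ind])
      · simp only [ht, hf, h0, and_self, if_true, Nat.pos_of_ne_zero h0, if_false]
        exact key true (p + 1) _ (by simpa [e8] using rpos 1) (by simpa using e10)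
          (by simpa using e12) (by simp [ind])
    · simp only [ht, hf, and_false, if_true, if_false]
      have := key true p (s2.setReg 15 1) (r2.setReg _ _ (by simp)) (by simpa using e10)
        (by simpa using e12) (by simp [ind])
      rwa [hid true (by simpa using hf)] at this
  · simp only [ht, false_and, if_false]
    have := key false p (s2.setReg 15 0) (r2.setReg _ _ (by simp)) (by simpa using e10)
      (by simpa using e12) (by simp [ind])
    rwa [hid false (by simpa using ht)] at this

end CoverData

namespace CoverData

variable {G : CoverData}

/-! ### The degree guesses in memory -/

section

variable {α : ℕ → ℕ} {c : Slots} {p : ℕ} {s : RamState}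

theorem walk_iter_succ {β : Type} (α : ℕ → ℕ) (n : ℕ) (f : ℕ → β → DTree β) (b : β) (p : ℕ) :
    (iter (n + 1) f b).walk α p =
      (f n ((iter n f b).walk α p).1).walk α ((iter n f b).walk α p).2 :=
  walk_bind _ _ _ _

/-- A loop whose body implements the body of a guessing iteration. -/
theorem den_iter {x y : ℕ} {P : LoopProg} {N : ℕ} (f : ℕ → Slots → DTree Slots)
    (h : Rep G α c p s) (hy : s.reg y = N) (hx : x ∉ [0, 1, 2, 3, 6, 7, 8])
    (Q : RamState → Prop) (hQ : Q s) (hQx : ∀ s v, Q s → Q (s.setReg x v))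
    (hP : ∀ i < N, ∀ c p s, Rep G α c p s → Q s → s.reg x = i →
      Rep G α ((f i c).walk α p).1 ((f i c).walk α p).2 (P.den s) ∧ Q (P.den s)) :
    Rep G α ((iter N f c).walk α p).1 ((iter N f c).walk α p).2 ((loop x y P).den s) ∧
      Q ((loop x y P).den s) := by
  refine den_loop (fun i s => Rep G α ((iter i f c).walk α p).1 ((iter i f c).walk α p).2 s ∧ Q s)
    hy ⟨h.setReg _ _ hx, hQx _ _ hQ⟩ ?_
  rintro i hi s' hs ⟨h', hQ'⟩
  rw [walk_iter_succ]
  have := hP i hi _ _ s' h' hQ' hs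
  exact ⟨this.1.setReg _ _ hx, hQx _ _ this.2⟩

/-- Split the slot given by register `10` according to the truth value of `e`. -/
def splitBy (e : RamExpr) : LoopProg := mapLoop 12 11 0 (.var 11) e ⨾ splitProg

theorem splitBy_spec (h : Rep G α c p s) (hi : s.reg 10 < G.k) (P : ℕ → Bool) {e : RamExpr}
    (he : ∀ v < G.n, ∀ f, e.eval ((s.setArr 12 f).setReg 11 v) = ind (P v = true)) :
    Rep G α ((c.split (s.reg 10) P).walk α p).1 ((c.split (s.reg 10) P).walk α p).2
      ((splitBy e).den s) := by
  rw [splitBy, LoopProg.den, den_mapLoop 0 (fun v => ind (P v = true)) h.n (by simp)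
    fun v hv f _ => he v hv f]
  set s₁ := (s.setArr 12 fun y => if 0 ≤ y ∧ y < 0 + G.n then ind (P (y - 0) = true)
    else s.arr 12 y).setReg 11 G.n with hs₁
  have h₁ : Rep G α c p s₁ := (h.setArr 12 _ (by simp)).setReg 11 _ (by simp)
  have h10 : s₁.reg 10 = s.reg 10 := by simp [s₁]
  have := splitProg_spec h₁ (by rwa [h10]) P (by intro v hv; simp [s₁, hv])
  rwa [h10] at this

/-- Compute the degrees of all vertices in the colour given by register `16`. -/
def degProg : LoopProg :=
  loop 11 0 (sumLoop 13 12 1 ((adjAt (.var 11) (.var 12)).and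
    (RamExpr.isEq (.get 1 (.var 12)) (.var 16))) ⨾ store 15 (.var 11) (.var 13))

theorem degProg_spec (h : Rep G α c p s) :
    ∀ v < G.n, (degProg.den s).arr 15 v = G.deg (s.reg 16) v := by
  refine (den_loop (fun i s' => (Rep G α c p s' ∧ s'.reg 16 = s.reg 16) ∧
    ∀ v < i, s'.arr 15 v = G.deg (s.reg 16) v) h.n ⟨⟨h.setReg _ _ (by simp), by simp⟩, by simp⟩ ?_).2
  rintro i hi s' hs ⟨⟨h', h16⟩, hd⟩
  rw [LoopProg.den, den_sumLoop (fun b => ind (G.adj i b = true ∧ G.f b = s.reg 16)) (by decide)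
    (by decide) h'.m (by
      intro b hb v
      simp [adjAt, hs, h'.rowM _ hi, h'.adj _ hi _ hb, h'.f _ hb, h16]), sum_ind]
  have e : ((Finset.range G.m).filter fun b => G.adj i b = true ∧ G.f b = s.reg 16).card =
      G.deg (s.reg 16) i := by
    rw [deg, col, nb, Finset.filter_filter]
  rw [e]
  refine ⟨⟨(((h'.setReg _ _ (by simp)).setReg _ _ (by simp)).setArr _ _ (by simp)).setReg _ _
    (by simp), by simp [LoopProg.den, h16]⟩, ?_⟩
  intro v hv
  by_cases hvi : v = i
  · subst hvi
    simp [LoopProg.den, hs]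
  · simp [LoopProg.den, hs, hvi, hd v (by omega)]

/-- Guess the degrees of all sought vertices. -/
def degreesProg : LoopProg :=
  loop 10 3 (loop 16 2 (degProg ⨾ assign 24 (.lit 0) ⨾
    loop 17 6 (assign 24 (.add (.var 24) (.get 2 (.var 16))) ⨾
      splitBy (RamExpr.not (RamExpr.isLt (.get 6 (.get 15 (.var 11))) (.var 24))))))

theorem deg_le_m (j v : ℕ) : G.deg j v ≤ G.m :=
  (card_col_le _ _).trans ((Finset.card_le_card (nb_subset v)).trans (by simp))

theorem degreesProg_spec (h : Rep G α G.start p s) :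
    Rep G α (G.guessDegrees.walk α p).1 (G.guessDegrees.walk α p).2 (degreesProg.den s) := by
  refine (den_iter (x := 10) (y := 3) _ h h.k (by simp) (fun _ => True) trivial
    (fun _ _ h => h) ?_).1
  rintro i hi c p s h - h10
  refine ⟨(den_iter (x := 16) (y := 2) (N := G.r) _ h h.r (by simp) (fun s => s.reg 10 = i) h10
    (by simp) ?_).1, trivial⟩
  intro j hj c p s h h10 h16
  have hdeg := degProg_spec h
  rw [h16] at hdeg
  have h1 := h.den degProg (by decide) (by decide)
  have e10 : (degProg.den s).reg 10 = i := by rw [den_reg (by decide), h10]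
  have e16 : (degProg.den s).reg 16 = j := by rw [den_reg (by decide), h16]
  have hinv := den_loop (x := 17) (n := 6) (N := G.D)
    (p := assign 24 (.add (.var 24) (.get 2 (.var 16))) ⨾
      splitBy (RamExpr.not (RamExpr.isLt (.get 6 (.get 15 (.var 11))) (.var 24))))
    (s := (degProg.den s).setReg 24 0)
    (fun q s' => Rep G α
      ((iter q (fun q s => Slots.split s i fun v => decide ((q + 1) * G.t j ≤ G.D * G.deg j v)) c).walk
        α p).1
      ((iter q (fun q s => Slots.split s i fun v => decide ((q + 1) * G.t j ≤ G.D * G.deg j v)) c).walk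
        α p).2 s' ∧ s'.reg 10 = i ∧ s'.reg 16 = j ∧ s'.reg 24 = q * G.t j ∧
        ∀ v < G.n, s'.arr 15 v = G.deg j v)
    (by simpa using h1.D) ⟨(h1.setReg _ _ (by simp)).setReg _ _ (by simp), by simp [e10],
      by simp [e16], by simp, by simpa using hdeg⟩ ?_
  · refine ⟨hinv.1, ?_⟩
    exact hinv.2.1
  · rintro q hq s' hs ⟨g1, g10, g16, g24, g15⟩
    rw [LoopProg.den, LoopProg.den]
    have e24 : (RamExpr.add (.var 24) (.get 2 (.var 16))).eval s' = (q + 1) * G.t j := by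
      simp [g24, g16, g1.t _ hj, Nat.succ_mul]
    rw [e24]
    set s1 := s'.setReg 24 ((q + 1) * G.t j) with hs1
    have r1 : Rep G α _ _ s1 := g1.setReg 24 _ (by simp)
    have e1 : s1.reg 10 = i := by simp [s1, g10]
    have := splitBy_spec r1 (by rw [e1]; exact hi)
      (fun v => decide ((q + 1) * G.t j ≤ G.D * G.deg j v))
      (e := RamExpr.not (RamExpr.isLt (.get 6 (.get 15 (.var 11))) (.var 24))) (by
        intro v hv f
        simp [s1, g15 v hv, g1.mulD _ (deg_le_m j v)])
    rw [e1] at this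
    refine ⟨by rw [walk_iter_succ]; exact this.setReg _ _ (by simp), ?_, ?_, ?_, ?_⟩
    · rw [RamState.reg_setReg, if_neg (by decide), den_reg (by decide), e1]
    · rw [RamState.reg_setReg, if_neg (by decide), den_reg (by decide)]
      simp [s1, g16]
    · rw [RamState.reg_setReg, if_neg (by decide), den_reg (by decide)]
      simp [s1]
    · rw [RamState.arr_setReg, den_arr (by decide)]
      simpa [s1] using g15

/-- Forget everything known about the sought vertices, and return to the start of the advice. -/
def initProg : LoopProg :=
  assign 8 (.lit 0) ⨾ loop 10 3 (mapLoop 9 11 0 (.add (.get 5 (.var 10)) (.var 11)) (.lit 1) ⨾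
    mapLoop 10 12 1 (.add (.get 4 (.var 10)) (.var 12)) (.lit 0))

theorem initProg_spec (h : Static G s) (hα : s.arr 8 = α) : Rep G α G.start 0 (initProg.den s) := by
  have := den_loop (x := 10) (n := 3) (N := G.k)
    (p := mapLoop 9 11 0 (.add (.get 5 (.var 10)) (.var 11)) (.lit 1) ⨾
      mapLoop 10 12 1 (.add (.get 4 (.var 10)) (.var 12)) (.lit 0))
    (s := s.setReg 8 0)
    (fun i s' => (Static G s' ∧ s'.arr 8 = α ∧ s'.reg 8 = 0) ∧
      (∀ l < i, ∀ v < G.n, s'.arr 9 (l * G.n + v) = 1) ∧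
      ∀ l < i, ∀ b < G.m, s'.arr 10 (l * G.m + b) = 0)
    (by simpa using h.k) ⟨⟨h.congr (by simp) (by simp), by simpa using hα, by simp⟩, by simp, by simp⟩ ?_
  · obtain ⟨⟨h1, h2, h3⟩, h4, h5⟩ := this
    refine { h1 with
      adv := h2
      pos := h3
      Xsub := fun i _ => subset_rfl
      Ksub := by simp [start]
      X := fun i hi v hv => ?_
      K := fun i hi b hb => ?_ }
    · rw [ind_true (by simpa [start] using hv)]
      exact h4 i hi v hv
    · rw [ind_false (by simp [start])]
      exact h5 i hi b hb
  · rintro i hi s' hs ⟨⟨h1, h2, h3⟩, h4, h5⟩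
    rw [LoopProg.den, den_mapLoop (i * G.n) (fun _ => 1) h1.n
      (by intro v hv f; simp [hs, h1.rowN _ (hi.trans h1.kn)]) (by simp),
      den_mapLoop (i * G.m) (fun _ => 0) (by simpa using h1.m)
      (by intro v hv f; simp [hs, h1.rowM _ (hi.trans h1.kn)]) (by simp)]
    refine ⟨⟨h1.congr (by simp) (by simp), by simpa using h2, by simpa using h3⟩, ?_, ?_⟩
    · intro l hl v hv
      by_cases e : l = i
      · simp only [RamState.arr_setReg, RamState.arr_setArr]
        simp [(row_iff (n := G.n) hv).2 e]
      · simp [h4 l (by omega) v hv]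
    · intro l hl v hv
      by_cases e : l = i
      · simp only [RamState.arr_setReg, RamState.arr_setArr]
        simp [(row_iff (n := G.m) hv).2 e]
      · simp [h5 l (by omega) v hv]

end

end CoverData

namespace CoverData

variable {G : CoverData} {α : ℕ → ℕ} {c : Slots} {p : ℕ} {s : RamState}

/-! ### The greedy pass in memory -/

/-- The set `W` is in array `11`. -/
def Cov (G : CoverData) (W : Finset ℕ) (s : RamState) : Prop :=
  ∀ b < G.m, s.arr 11 b = ind (b ∈ W)

/-- Compute the set of vertices known to be covered. -/
def knownProg : LoopProg :=
  mapLoop 11 12 1 (.var 12) (.lit 0) ⨾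
  loop 23 3 (lastLoop 18 11 0 (xAt (.var 23) (.var 11)) ⨾
    mapLoop 11 12 1 (.var 12) ((RamExpr.get 11 (.var 12)).or
      ((adjAt (.var 18) (.var 12)).and (kAt (.var 23) (.var 12)))))

theorem rep_lt {S : Finset ℕ} {n : ℕ} (hn : 0 < n) (hS : S ⊆ Finset.range n) : rep S < n := by
  rcases S.eq_empty_or_nonempty with rfl | h
  · simpa [rep] using hn
  · exact Finset.mem_range.1 (hS (rep_mem h))

theorem Rep.filter_X (h : Rep G α c p s) {i : ℕ} (hi : i < G.k) :
    ((Finset.range G.n).filter fun v => v ∈ c.X i) = c.X i := by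
  ext v
  simp only [Finset.mem_filter]
  exact ⟨fun h => h.2, fun hv => ⟨h.Xsub _ hi hv, hv⟩⟩

theorem Static.n_pos (h : Static G s) : 0 < G.n := (Nat.zero_le _).trans_lt h.kn

/-- Add vertices to the set in array `11`. -/
theorem cov_union (h : Rep G α c p s) {W : Finset ℕ} (hW : Cov G W s) (N : Finset ℕ) (e : RamExpr)
    (he : ∀ b < G.m, ∀ f, e.eval ((s.setArr 11 f).setReg 12 b) = ind (b ∈ N)) :
    Rep G α c p ((mapLoop 11 12 1 (.var 12) ((RamExpr.get 11 (.var 12)).or e)).den s) ∧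
    Cov G (W ∪ N) ((mapLoop 11 12 1 (.var 12) ((RamExpr.get 11 (.var 12)).or e)).den s) := by
  rw [den_mapLoop 0 (fun b => ind (b ∈ W ∪ N)) h.m (by simp)]
  · refine ⟨(h.setArr _ _ (by simp)).setReg _ _ (by simp), ?_⟩
    intro b hb
    simp [hb]
  · intro b hb f hf
    rw [eval_or, he b hb f]
    simp only [zero_add] at hf
    simp [hf, hW b hb]

theorem knownProg_spec (h : Rep G α c p s) : Cov G (G.known c) (knownProg.den s) := by
  rw [knownProg, LoopProg.den, den_mapLoop 0 (fun _ => 0) h.m (by simp) (by simp)]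
  have h₁ : Rep G α c p ((s.setArr 11 fun y => if 0 ≤ y ∧ y < 0 + G.m then 0 else s.arr 11 y).setReg
    12 G.m) := (h.setArr 11 _ (by simp)).setReg 12 _ (by simp)
  refine (den_loop (fun i s' => Rep G α c p s' ∧
    Cov G ((Finset.range i).biUnion fun l => G.nb (_root_.rep (c.X l)) ∩ c.K l) s') h₁.k
    ⟨h₁.setReg _ _ (by simp), ?_⟩ ?_).2
  · intro b hb
    simp [hb, ind]
  · rintro i hi s' hs ⟨h', hc⟩
    rw [LoopProg.den, den_lastLoop (fun v => v ∈ c.X i) (by decide) (by decide) h'.n (by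
      intro v hv a
      simp [xAt, hs, h'.rowN _ (hi.trans h'.kn), h'.X _ hi _ hv]), h'.filter_X hi]
    set s₂ := (s'.setReg 18 (_root_.rep (c.X i))).setReg 11 G.n with hs₂
    have h₂ : Rep G α c p s₂ := (h'.setReg 18 _ (by simp)).setReg 11 _ (by simp)
    have hlt := rep_lt h'.n_pos (h'.Xsub i hi)
    have := cov_union h₂ (W := (Finset.range i).biUnion fun l => G.nb (_root_.rep (c.X l)) ∩ c.K l)
      (by simpa [Cov, s₂] using hc) (G.nb (_root_.rep (c.X i)) ∩ c.K i)
      ((adjAt (.var 18) (.var 12)).and (kAt (.var 23) (.var 12))) (by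
        intro b hb f
        simp [s₂, adjAt, kAt, hs, h'.rowM _ hlt, h'.adj _ hlt _ hb,
          h'.rowM _ (hi.trans h'.kn), h'.K _ hi _ hb, mem_nb, hb])
    refine ⟨this.1.setReg _ _ (by simp), ?_⟩
    rw [Finset.range_add_one, Finset.biUnion_insert, Finset.union_comm]
    simpa [Cov] using this.2

/-- Count the vertices of the colour given by register `16` in the set in array `11`. -/
def colorCount : LoopProg :=
  sumLoop 22 12 1 ((RamExpr.get 11 (.var 12)).and (RamExpr.isEq (.get 1 (.var 12)) (.var 16)))

theorem colorCount_spec (h : Rep G α c p s) {W : Finset ℕ} (hW : W ⊆ Finset.range G.m)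
    (hc : Cov G W s) :
    colorCount.den s = (s.setReg 22 (G.col W (s.reg 16)).card).setReg 12 G.m := by
  rw [colorCount, den_sumLoop (fun b => ind (b ∈ W ∧ G.f b = s.reg 16)) (by decide) (by decide) h.m
    (by intro b hb v; simp [hc b hb, h.f b hb]), sum_ind]
  congr 3
  ext b
  simp only [col, Finset.mem_filter]
  exact ⟨fun h => h.2, fun hb => ⟨hW hb.1, hb⟩⟩

/-- Compute the last bad colour of every vertex for the slot given by register `10`. -/
def badProg : LoopProg :=
  mapLoop 13 11 0 (.var 11) (.lit 0) ⨾
  loop 16 2 (colorCount ⨾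
    ite (.var 22) (.get 2 (.var 16))
      (loop 11 0 (sumLoop 13 12 1 (((adjAt (.var 11) (.var 12)).and
          ((RamExpr.get 11 (.var 12)).and (RamExpr.not (kAt (.var 10) (.var 12))))).and
          (RamExpr.isEq (.get 1 (.var 12)) (.var 16))) ⨾
        ite (.get 2 (.var 16)) (.get 6 (.var 13))
          (store 13 (.var 11) (.add (.var 16) (.lit 1))) skip))
      skip)

theorem sup_filter_succ (P : ℕ → Prop) [DecidablePred P] (j : ℕ) :
    ((Finset.range (j + 1)).filter P).sup (· + 1) =
      if P j then j + 1 else ((Finset.range j).filter P).sup (· + 1) := by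
  rw [Finset.range_add_one, Finset.filter_insert]
  split_ifs
  · rw [Finset.sup_insert]
    refine max_eq_left (Finset.sup_le fun i hi => ?_)
    have := Finset.mem_range.1 (Finset.mem_filter.1 hi).1
    show i + 1 ≤ j + 1
    omega
  · rfl

theorem badProg_spec (h : Rep G α c p s) (hi : s.reg 10 < G.k) {W : Finset ℕ}
    (hW : W ⊆ Finset.range G.m) (hc : Cov G W s) :
    ∀ v < G.n, (badProg.den s).arr 13 v = G.badColor c W (s.reg 10) v := by
  rw [badProg, LoopProg.den, den_mapLoop 0 (fun _ => 0) h.n (by simp) (by simp)]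
  set s₁ := (s.setArr 13 fun y => if 0 ≤ y ∧ y < 0 + G.n then 0 else s.arr 13 y).setReg 11 G.n
  have h₁ : Rep G α c p s₁ := (h.setArr 13 _ (by simp)).setReg 11 _ (by simp)
  refine (den_loop (fun j s' => (Rep G α c p s' ∧ s'.reg 10 = s.reg 10 ∧ Cov G W s') ∧
    ∀ v < G.n, s'.arr 13 v =
      ((Finset.range j).filter fun j => G.bad c W (s.reg 10) j v).sup (· + 1)) h₁.r
    ⟨⟨h₁.setReg _ _ (by simp), by simp [s₁], by simpa [Cov, s₁] using hc⟩, ?_⟩ ?_).2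
  · intro v hv
    simp [s₁, hv]
  rintro j hj s' hs ⟨⟨h', h10, hc'⟩, hb⟩
  rw [LoopProg.den, colorCount_spec h' hW hc', hs]
  set s₂ := (s'.setReg 22 (G.col W j).card).setReg 12 G.m with hs₂
  have h₂ : Rep G α c p s₂ := (h'.setReg 22 _ (by simp)).setReg 12 _ (by simp)
  have e22 : s₂.reg 22 = (G.col W j).card := by simp [s₂]
  have e16 : s₂.reg 16 = j := by simp [s₂, hs]
  have e10 : s₂.reg 10 = s.reg 10 := by simp [s₂, h10]
  have c₂ : Cov G W s₂ := by simpa [Cov, s₂] using hc'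
  have hb₂ : ∀ v < G.n, s₂.arr 13 v =
    ((Finset.range j).filter fun j => G.bad c W (s.reg 10) j v).sup (· + 1) := by
    simpa [s₂] using hb
  rw [LoopProg.den, eval_var, eval_get, eval_var, e22, e16, h₂.t j hj]
  split_ifs with hlt
  · have := den_loop (x := 11) (n := 0) (N := G.n) (s := s₂)
      (p := sumLoop 13 12 1 (((adjAt (.var 11) (.var 12)).and
          ((RamExpr.get 11 (.var 12)).and (RamExpr.not (kAt (.var 10) (.var 12))))).and
          (RamExpr.isEq (.get 1 (.var 12)) (.var 16))) ⨾
        ite (.get 2 (.var 16)) (.get 6 (.var 13))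
          (store 13 (.var 11) (.add (.var 16) (.lit 1))) skip)
      (fun u s' => (Rep G α c p s' ∧ s'.reg 10 = s.reg 10 ∧ s'.reg 16 = j ∧ Cov G W s') ∧
        ∀ v < G.n, s'.arr 13 v = if v < u then
          ((Finset.range (j + 1)).filter fun j => G.bad c W (s.reg 10) j v).sup (· + 1)
          else ((Finset.range j).filter fun j => G.bad c W (s.reg 10) j v).sup (· + 1)) h₂.n
      ⟨⟨h₂.setReg _ _ (by simp), by simp [e10], by simp [e16], by simpa [Cov] using c₂⟩,
        by simpa using hb₂⟩ ?_
    · obtain ⟨⟨g1, g2, g3, g4⟩, g5⟩ := this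
      refine ⟨⟨g1.setReg _ _ (by simp), by simpa using g2, by simpa [Cov] using g4⟩, ?_⟩
      intro v hv
      have := g5 v hv
      rw [if_pos hv] at this
      exact this
    · rintro u hu s₃ hs₃ ⟨⟨h₃, h10', h16, c₃⟩, hb₃⟩
      rw [LoopProg.den, den_sumLoop (fun b => ind ((G.adj u b = true ∧ b ∈ W ∧ b ∉ c.K (s.reg 10)) ∧
        G.f b = j)) (by decide) (by decide) h₃.m (by
          intro b hb v
          simp [adjAt, kAt, hs₃, h₃.rowM _ hu, h₃.adj _ hu _ hb, h10', h₃.rowM _ (hi.trans h₃.kn),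
            h₃.K _ hi _ hb, c₃ b hb, h₃.f b hb, h16]), sum_ind]
      have e : ((Finset.range G.m).filter fun b =>
          (G.adj u b = true ∧ b ∈ W ∧ b ∉ c.K (s.reg 10)) ∧ G.f b = j).card =
          (G.col (G.nb u ∩ (W \ c.K (s.reg 10))) j).card := by
        congr 1
        ext b
        simp only [col, nb, Finset.mem_filter, Finset.mem_inter, Finset.mem_sdiff]
        tauto
      rw [e]
      have hle : (G.col (G.nb u ∩ (W \ c.K (s.reg 10))) j).card ≤ G.m :=
        (card_col_le _ _).trans ((Finset.card_le_card (Finset.inter_subset_left.trans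
          (nb_subset u))).trans (by simp))
      set s₄ := (s₃.setReg 13 (G.col (G.nb u ∩ (W \ c.K (s.reg 10))) j).card).setReg 12 G.m with hs₄
      have h₄ : Rep G α c p s₄ := (h₃.setReg 13 _ (by simp)).setReg 12 _ (by simp)
      have f13 : s₄.reg 13 = (G.col (G.nb u ∩ (W \ c.K (s.reg 10))) j).card := by simp [s₄]
      have f16 : s₄.reg 16 = j := by simp [s₄, h16]
      have f11 : s₄.reg 11 = u := by simp [s₄, hs₃]
      have f10 : s₄.reg 10 = s.reg 10 := by simp [s₄, h10']
      have c₄ : Cov G W s₄ := by simpa [Cov, s₄] using c₃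
      have hb₄ : s₄.arr 13 = s₃.arr 13 := by simp [s₄]
      simp only [LoopProg.den, eval_var, eval_get, f13, f16, h₄.t j hj, h₄.mulD _ hle]
      split_ifs with hbad
      · refine ⟨⟨(h₄.setArr _ _ (by simp)).setReg _ _ (by simp), by simpa using f10,
          by simpa using f16, by simpa [Cov] using c₄⟩, ?_⟩
        intro v hv
        simp only [RamState.arr_setReg, RamState.arr_setArr, if_true, eval_add, eval_var, eval_lit,
          f11, f16, Function.update_apply, hb₄]
        by_cases e : v = u
        · subst e
          rw [if_pos rfl, if_pos (by omega), sup_filter_succ, if_pos ⟨hlt, hbad⟩]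
        · rw [if_neg e, hb₃ v hv]
          refine if_congr ?_ rfl rfl
          omega
      · refine ⟨⟨h₄.setReg _ _ (by simp), by simpa using f10,
          by simpa using f16, by simpa [Cov] using c₄⟩, ?_⟩
        intro v hv
        simp only [RamState.arr_setReg, hb₄]
        by_cases e : v = u
        · subst e
          rw [if_pos (by omega), sup_filter_succ, if_neg (fun hh => hbad hh.2), hb₃ v hv,
            if_neg (by omega)]
        · rw [hb₃ v hv]
          refine if_congr ?_ rfl rfl
          omega
  · rw [LoopProg.den]
    refine ⟨⟨h₂.setReg _ _ (by simp), by simpa using e10, by simpa [Cov] using c₂⟩, ?_⟩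
    intro v hv
    rw [sup_filter_succ, if_neg (fun hh => hlt hh.1)]
    simpa using hb₂ v hv

/-- Whether `v` is acceptable for the slot given by register `10`. -/
def okAt (v : RamExpr) : RamExpr := (xAt (.var 10) v).and (RamExpr.isEq (.get 13 v) (.lit 0))

/-- Select a vertex for the slot given by register `10`. Register `20` tells whether the pass has
been successful so far, and register `21` receives the slot where it fails. -/
def stepProg : LoopProg :=
  badProg ⨾ lastLoop 18 11 0 (okAt (.var 11)) ⨾
  ite (.lit 0) (okAt (.var 18))
    (store 14 (.var 10) (.var 18) ⨾
      mapLoop 11 12 1 (.var 12) ((RamExpr.get 11 (.var 12)).or (adjAt (.var 18) (.var 12))))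
    (assign 20 (.lit 0) ⨾ assign 21 (.var 10))

/-- The greedy pass. -/
def passProg : LoopProg :=
  knownProg ⨾ assign 20 (.lit 1) ⨾ loop 10 3 (ite (.lit 0) (.var 20) stepProg skip)

/-- The state of the greedy pass after `i` slots is in memory. -/
structure PassRep (G : CoverData) (c : Slots) (i : ℕ) (q : PassState) (s : RamState) : Prop where
  ok : s.reg 20 = ind (q.ok = true)
  cov : Cov G q.W s
  sel : q.ok = true → ∀ l < i, s.arr 14 l = q.sel l
  slot : q.ok = false → s.reg 21 = q.slot
  badColor : q.ok = false → ∀ v < G.n, s.arr 13 v = G.badColor c q.W q.slot v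

theorem PassRep.congr {i : ℕ} {q : PassState} {s' : RamState} (h : PassRep G c i q s)
    (hr : ∀ x ∈ [20, 21], s'.reg x = s.reg x) (ha : ∀ a ∈ [11, 13, 14], s'.arr a = s.arr a) :
    PassRep G c i q s' := by
  simp only [List.mem_cons, List.not_mem_nil, or_false, forall_eq_or_imp, forall_eq] at hr ha
  obtain ⟨r20, r21⟩ := hr
  obtain ⟨a11, a13, a14⟩ := ha
  refine ⟨by rw [r20, h.ok], ?_, ?_, ?_, ?_⟩
  · rw [Cov, a11]; exact h.cov
  · rw [a14]; exact h.sel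
  · rw [r21]; exact h.slot
  · rw [a13]; exact h.badColor

theorem stepProg_spec {i : ℕ} (h : Rep G α c p s) (h10 : s.reg 10 = i) (hi : i < G.k)
    (hq : PassRep G c i (G.pass c i) s) (hok : (G.pass c i).ok = true) :
    Rep G α c p (stepProg.den s) ∧ PassRep G c (i + 1) (G.pass c (i + 1)) (stepProg.den s) := by
  have hW := pass_sub (G := G) c i
  have hb := badProg_spec h (by omega) hW hq.cov
  rw [h10] at hb
  set q := G.pass c i with hqdef
  rw [stepProg, LoopProg.den, LoopProg.den]
  set s₁ := badProg.den s with hs₁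
  have h₁ : Rep G α c p s₁ := h.den badProg (by decide) (by decide)
  have e10 : s₁.reg 10 = i := by rw [hs₁, den_reg (by decide), h10]
  have e20 : s₁.reg 20 = 1 := by rw [hs₁, den_reg (by decide), hq.ok, ind_true hok]
  have c₁ : Cov G q.W s₁ := by rw [Cov, hs₁, den_arr (by decide)]; exact hq.cov
  have e14 : ∀ l < i, s₁.arr 14 l = q.sel l := by
    rw [hs₁, den_arr (by decide)]; exact hq.sel hok
  rw [den_lastLoop (fun v => v ∈ c.X i ∧ G.badColor c q.W i v = 0) (by decide) (by decide) h₁.n (by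
    intro v hv a
    simp [okAt, xAt, e10, h₁.rowN _ (hi.trans h₁.kn), h₁.X _ hi _ hv, hb v hv])]
  have hcand : ((Finset.range G.n).filter fun v => v ∈ c.X i ∧ G.badColor c q.W i v = 0) =
      G.cands c q.W i := by
    rw [cands, ← Finset.filter_filter, h.filter_X hi]
  rw [hcand]
  set S := G.cands c q.W i with hS
  have hlt : _root_.rep S < G.n :=
    rep_lt h.n_pos ((Finset.filter_subset _ _).trans (h.Xsub i hi))
  set s₂ := (s₁.setReg 18 (_root_.rep S)).setReg 11 G.n with hs₂
  have h₂ : Rep G α c p s₂ := (h₁.setReg 18 _ (by simp)).setReg 11 _ (by simp)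
  have c₂ : Cov G q.W s₂ := by simpa [Cov, s₂] using c₁
  have e18 : s₂.reg 18 = _root_.rep S := by simp [s₂]
  have e10' : s₂.reg 10 = i := by simp [s₂, e10]
  have hcond : (okAt (.var 18)).eval s₂ = ind (S.Nonempty) := by
    have : S.Nonempty ↔ _root_.rep S ∈ c.X i ∧ G.badColor c q.W i (_root_.rep S) = 0 :=
      ⟨fun hne => Finset.mem_filter.1 (rep_mem hne), fun hm => ⟨_, Finset.mem_filter.2 hm⟩⟩
    rw [this]
    simp [okAt, xAt, s₂, e10, h₁.rowN _ (hi.trans h₁.kn), h₁.X _ hi _ hlt, hb _ hlt]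
  rw [LoopProg.den, hcond, pass, ← hqdef, passStep, if_pos hok, ← hS]
  by_cases hne : S.Nonempty
  · rw [if_pos (by simpa using hne), if_pos hne, LoopProg.den, LoopProg.den, eval_var, eval_var,
      e10', e18]
    set s₃ := s₂.setArr 14 (Function.update (s₂.arr 14) i (_root_.rep S)) with hs₃
    have h₃ : Rep G α c p s₃ := h₂.setArr 14 _ (by simp)
    have := cov_union h₃ (W := q.W) (by simpa [Cov, s₃] using c₂) (G.nb (_root_.rep S))
      (adjAt (.var 18) (.var 12)) (by
        intro b hb f
        simp [s₃, adjAt, e18, h₂.rowM _ hlt, h₂.adj _ hlt _ hb, mem_nb, hb])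
    refine ⟨this.1, ?_, this.2, ?_, by simp, by simp⟩
    · rw [den_reg (by decide)]
      simp [s₃, s₂, e20, ind]
    · intro _ l hl
      rw [den_arr (by decide)]
      by_cases e : l = i
      · subst e
        simp [s₃]
      · simp [s₃, s₂, e, e14 l (by omega)]
  · rw [if_neg (by simpa using hne), if_neg hne, LoopProg.den, LoopProg.den, LoopProg.den, eval_lit,
      eval_var]
    refine ⟨(h₂.setReg 20 _ (by simp)).setReg 21 _ (by simp), ?_, ?_, by simp, ?_, ?_⟩
    · simp [ind]
    · simpa [Cov] using c₂
    · simp [e10']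
    · intro _ v hv
      simpa [s₂] using hb v hv

theorem passProg_spec (h : Rep G α c p s) :
    Rep G α c p (passProg.den s) ∧ PassRep G c G.k (G.pass c G.k) (passProg.den s) := by
  rw [passProg, LoopProg.den, LoopProg.den]
  set s₁ := (assign 20 (.lit 1)).den (knownProg.den s) with hs₁
  have h₁ : Rep G α c p s₁ := (h.den knownProg (by decide) (by decide)).setReg 20 _ (by simp)
  have q₁ : PassRep G c 0 (G.pass c 0) s₁ := by
    refine ⟨by simp [s₁, LoopProg.den, pass, ind], ?_, by simp, by simp [pass], by simp [pass]⟩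
    simpa [s₁, LoopProg.den, pass, Cov] using knownProg_spec h
  refine den_loop (fun i s' => Rep G α c p s' ∧ PassRep G c i (G.pass c i) s') h₁.k
    ⟨h₁.setReg _ _ (by simp), q₁.congr (by simp) (by simp)⟩ ?_
  rintro i hi s' hs ⟨h', hq⟩
  rw [LoopProg.den, eval_lit, eval_var, hq.ok]
  by_cases hok : (G.pass c i).ok = true
  · rw [if_pos (by simpa using hok)]
    have := stepProg_spec h' hs hi hq hok
    exact ⟨this.1.setReg _ _ (by simp), this.2.congr (by simp) (by simp)⟩
  · rw [if_neg (by simpa using hok), LoopProg.den, pass, passStep, if_neg hok]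
    refine ⟨h'.setReg _ _ (by simp), PassRep.congr (s := s') ?_ (by simp) (by simp)⟩
    exact ⟨hq.ok, hq.cov, fun h => absurd h hok, hq.slot, hq.badColor⟩

end CoverData

namespace CoverData

variable {G : CoverData} {α : ℕ → ℕ} {c : Slots} {p : ℕ} {s : RamState}

/-! ### Refinement and rounds in memory -/

/-- Guess the neighbours of the sought vertex of the slot given by register `10`, in the colour
given by register `19`. -/
def traceProg : LoopProg :=
  loop 12 1 (ite (.lit 0) (((RamExpr.isEq (.add (.get 1 (.var 12)) (.lit 1)) (.var 19)).and
      (.get 11 (.var 12))).and (RamExpr.not (kAt (.var 10) (.var 12))))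
    (splitBy (adjAt (.var 11) (.var 12)) ⨾
      store 10 (.add (.get 4 (.var 10)) (.var 12)) (.lit 1)) skip)

/-- Refine the slot given by register `21`. -/
def refineProg : LoopProg :=
  assign 10 (.var 21) ⨾
  loop 16 2 (splitBy (RamExpr.not (RamExpr.isLt (.var 16) (.get 13 (.var 11))))) ⨾
  lastLoop 18 11 0 (xAt (.var 10) (.var 11)) ⨾
  assign 19 (.get 13 (.var 18)) ⨾
  traceProg

theorem guessColor_spec {i : ℕ} (h : Rep G α c p s) (h10 : s.reg 10 = i) (hi : i < G.k)
    {W : Finset ℕ} (hb : ∀ v < G.n, s.arr 13 v = G.badColor c W i v) :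
    Rep G α ((G.guessColor c W i).walk α p).1 ((G.guessColor c W i).walk α p).2
      ((loop 16 2 (splitBy (RamExpr.not (RamExpr.isLt (.var 16) (.get 13 (.var 11)))))).den s) := by
  refine (den_iter (x := 16) (y := 2) (N := G.r) _ h h.r (by simp)
    (fun s => s.reg 10 = i ∧ ∀ v < G.n, s.arr 13 v = G.badColor c W i v) ⟨h10, hb⟩
    (by simp) ?_).1
  rintro j hj c' p' s' h' ⟨g10, g13⟩ hs
  have := splitBy_spec h' (by omega) (fun v => decide (G.badColor c W i v ≤ j))
    (e := RamExpr.not (RamExpr.isLt (.var 16) (.get 13 (.var 11)))) (by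
      intro v hv f
      simp [hs, g13 v hv])
  rw [g10] at this
  refine ⟨this, ?_, ?_⟩
  · rw [den_reg (by decide), g10]
  · rw [den_arr (by decide)]
    exact g13

theorem walk_learn (G : CoverData) (c : Slots) (i b : ℕ) (α : ℕ → ℕ) (p : ℕ) :
    (c.learn G i b).walk α p =
      (⟨((c.split i fun v => G.adj v b).walk α p).1.X,
        Function.update ((c.split i fun v => G.adj v b).walk α p).1.K i
          (insert b (((c.split i fun v => G.adj v b).walk α p).1.K i))⟩,
        ((c.split i fun v => G.adj v b).walk α p).2) := by
  rw [Slots.learn, walk_bind]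
  rfl

/-- Recording in memory that the adjacency to `b` is known for slot `i`. -/
theorem Rep.record (h : Rep G α c p s) {i b : ℕ} (hi : i < G.k) (hb : b < G.m) :
    Rep G α ⟨c.X, Function.update c.K i (insert b (c.K i))⟩ p
      (s.setArr 10 (Function.update (s.arr 10) (i * G.m + b) 1)) := by
  refine { h.toStatic.congr (by simp) (by simp) with
    adv := by simpa using h.adv
    pos := by simpa using h.pos
    Xsub := h.Xsub
    Ksub := fun l hl => ?_
    X := by simpa using h.X
    K := fun l hl b' hb' => ?_ }
  · by_cases e : l = i
    · subst e
      simpa [Finset.insert_subset_iff, hb] using h.Ksub l hl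
    · simpa [e] using h.Ksub l hl
  · simp only [RamState.arr_setArr, if_true, Function.update_apply]
    by_cases e : l = i
    · subst e
      by_cases e' : b' = b
      · subst e'
        simp [ind]
      · simp [e', h.K l hl b' hb']
    · rw [if_neg, h.K l hl b' hb', if_neg e]
      intro heq
      exact e ((row_iff (n := G.m) hb').1 (by omega))

theorem traceProg_spec {i : ℕ} (h : Rep G α c p s) (h10 : s.reg 10 = i) (hi : i < G.k)
    {W : Finset ℕ} (hc : Cov G W s) :
    Rep G α ((G.guessTrace W i (s.reg 19) c).walk α p).1
      ((G.guessTrace W i (s.reg 19) c).walk α p).2 (traceProg.den s) := by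
  refine (den_iter (x := 12) (y := 1) (N := G.m) _ h h.m (by simp)
    (fun s' => s'.reg 10 = i ∧ s'.reg 19 = s.reg 19 ∧ Cov G W s') ⟨h10, rfl, hc⟩
    (by simp [Cov]) ?_).1
  rintro b hb c' p' s' h' ⟨g10, g19, gc⟩ hs
  have hcond : (((RamExpr.isEq (.add (.get 1 (.var 12)) (.lit 1)) (.var 19)).and
      (.get 11 (.var 12))).and (RamExpr.not (kAt (.var 10) (.var 12)))).eval s' =
      ind ((G.f b + 1 = s.reg 19 ∧ b ∈ W) ∧ b ∉ c'.K i) := by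
    simp [kAt, hs, g10, g19, gc b hb, h'.f b hb, h'.rowM _ (hi.trans h'.kn), h'.K _ hi _ hb]
  rw [LoopProg.den, hcond]
  by_cases hP : (G.f b + 1 = s.reg 19 ∧ b ∈ W) ∧ b ∉ c'.K i
  · rw [if_pos (and_assoc.1 hP), if_pos (by simpa using hP)]
    have h1 := splitBy_spec h' (by omega) (fun v => G.adj v b)
      (e := adjAt (.var 11) (.var 12)) (by
        intro v hv f
        simp [adjAt, hs, h'.rowM _ hv, h'.adj _ hv _ hb])
    rw [g10] at h1
    rw [LoopProg.den, LoopProg.den]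
    set s₁ := (splitBy (adjAt (.var 11) (.var 12))).den s' with hs₁
    have e10 : s₁.reg 10 = i := by rw [hs₁, den_reg (by decide), g10]
    have e12 : s₁.reg 12 = b := by rw [hs₁, den_reg (by decide), hs]
    have e19 : s₁.reg 19 = s.reg 19 := by rw [hs₁, den_reg (by decide), g19]
    have ec : Cov G W s₁ := by rw [Cov, hs₁, den_arr (by decide)]; exact gc
    refine ⟨?_, by simpa using e10, by simpa using e19, by simpa [Cov] using ec⟩
    rw [walk_learn]
    simp only [eval_add, eval_get, eval_var, eval_lit, e10, e12, h1.rowM _ (hi.trans h1.kn)]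
    exact h1.record hi hb
  · rw [if_neg fun h => hP (and_assoc.2 h), if_neg (by simpa using hP), LoopProg.den]
    exact ⟨h', g10, g19, gc⟩

theorem refineProg_spec {i : ℕ} (h : Rep G α c p s) (h21 : s.reg 21 = i) (hi : i < G.k)
    {W : Finset ℕ} (hc : Cov G W s) (hb : ∀ v < G.n, s.arr 13 v = G.badColor c W i v) :
    Rep G α ((G.refine c W i).walk α p).1 ((G.refine c W i).walk α p).2 (refineProg.den s) := by
  rw [refine, walk_bind, refineProg, den_seq, den_seq, den_seq, den_seq]
  set s₁ := (assign 10 (.var 21)).den s with hs₁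
  have h₁ : Rep G α c p s₁ := h.setReg 10 _ (by simp)
  have e10 : s₁.reg 10 = i := by simp [s₁, LoopProg.den, h21]
  have h₂ := guessColor_spec h₁ e10 hi (W := W) (by simpa [s₁, LoopProg.den] using hb)
  set c₂ := ((G.guessColor c W i).walk α p).1
  set s₂ := (loop 16 2 (splitBy (RamExpr.not (RamExpr.isLt (.var 16) (.get 13 (.var 11)))))).den s₁
    with hs₂
  have e10₂ : s₂.reg 10 = i := by rw [hs₂, den_reg (by decide), e10]
  have ec₂ : Cov G W s₂ := by
    rw [Cov, hs₂, den_arr (by decide)]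
    simpa [s₁, LoopProg.den, Cov] using hc
  have eb₂ : ∀ v < G.n, s₂.arr 13 v = G.badColor c W i v := by
    rw [hs₂, den_arr (by decide)]
    simpa [s₁, LoopProg.den] using hb
  rw [den_lastLoop (fun v => v ∈ c₂.X i) (by decide) (by decide) h₂.n (by
      intro v hv a
      simp [xAt, e10₂, h₂.rowN _ (hi.trans h₂.kn), h₂.X _ hi _ hv]), h₂.filter_X hi]
  have hlt := rep_lt h.n_pos (h₂.Xsub i hi)
  set s₃ := (assign 19 (.get 13 (.var 18))).den
    ((s₂.setReg 18 (_root_.rep (c₂.X i))).setReg 11 G.n) with hs₃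
  have h₃ : Rep G α c₂ _ s₃ :=
    ((h₂.setReg 18 _ (by simp)).setReg 11 _ (by simp)).setReg 19 _ (by simp)
  have e19 : s₃.reg 19 = G.badColor c W i (_root_.rep (c₂.X i)) := by
    simp [s₃, LoopProg.den, eb₂ _ hlt]
  have := traceProg_spec h₃ (i := i) (by simp [s₃, LoopProg.den, e10₂]) hi (W := W)
    (by simpa [s₃, LoopProg.den, Cov] using ec₂)
  rwa [e19] at this

/-- A greedy pass, and a refinement if it fails. -/
def roundProg : LoopProg := passProg ⨾ ite (.var 20) (.lit 1) refineProg skip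

theorem roundProg_spec (h : Rep G α c p s) :
    Rep G α ((G.round c).walk α p).1 ((G.round c).walk α p).2 (roundProg.den s) := by
  obtain ⟨h1, h2⟩ := passProg_spec h
  rw [roundProg, LoopProg.den, LoopProg.den, eval_var, eval_lit, h2.ok, round]
  by_cases hok : (G.pass c G.k).ok = true
  · rw [if_pos hok, if_neg (by simp [hok, ind])]
    exact h1
  · rw [if_neg hok, if_pos (by simp [hok, ind])]
    have hf : (G.pass c G.k).ok = false := by simpa using hok
    exact refineProg_spec h1 (h2.slot hf) (pass_fail _ hf).1 h2.cov (h2.badColor hf)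

/-- All guesses. -/
def guessesProg : LoopProg := initProg ⨾ degreesProg ⨾ loop 25 7 roundProg

theorem guessesProg_spec (h : Static G s) (hα : s.arr 8 = α) :
    Rep G α (G.guesses.walk α 0).1 (G.guesses.walk α 0).2 (guessesProg.den s) := by
  rw [guesses, walk_bind, guessesProg, den_seq, den_seq]
  have h1 := degreesProg_spec (initProg_spec h hα)
  exact (den_iter (x := 25) (y := 7) _ h1 h1.fuel (by simp) (fun _ => True) trivial
    (fun _ _ h => h) fun i hi c p s h _ _ => ⟨roundProg_spec h, trivial⟩).1

/-! ### Checking and recording a selection -/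

/-- A final pass. If its selection satisfies all requirements up to the accuracy, then mark it in
array `3`. -/
def recordProg : LoopProg :=
  passProg ⨾ assign 26 (.var 20) ⨾
  loop 16 2 (colorCount ⨾ ite (.get 6 (.var 22)) (.get 7 (.var 16)) (assign 26 (.lit 0)) skip) ⨾
  ite (.lit 0) (.var 26)
    (mapLoop 3 11 0 (.var 11) (.lit 0) ⨾ loop 10 3 (store 3 (.get 14 (.var 10)) (.lit 1)))
    skip

/-- Array `3` marks the selection of a run with outcome `c`. -/
def Marks (G : CoverData) (c : Slots) (s : RamState) : Prop :=
  ∀ v < G.n, s.arr 3 v ≠ 0 ↔ ∃ i < G.k, (G.pass c G.k).sel i = v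

theorem recordProg_spec (h : Rep G α c p s) :
    Rep G α c p (recordProg.den s) ∧ (G.accepts c → Marks G c (recordProg.den s)) ∧
      (¬ G.accepts c → (recordProg.den s).arr 3 = s.arr 3) := by
  refine ⟨h.den recordProg (by decide) (by decide), ?_⟩
  obtain ⟨h1, h2⟩ := passProg_spec h
  rw [recordProg, den_seq, den_seq, den_seq]
  set q := G.pass c G.k with hq
  have hW : q.W ⊆ Finset.range G.m := pass_sub _ _
  set s₁ := (assign 26 (.var 20)).den (passProg.den s) with hs₁
  have h₁ : Rep G α c p s₁ := h1.setReg 26 _ (by simp)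
  have e26 : s₁.reg 26 = ind (q.ok = true) := by simp [s₁, LoopProg.den, h2.ok]
  have c₁ : Cov G q.W s₁ := by simpa [s₁, LoopProg.den, Cov] using h2.cov
  have e14 : q.ok = true → ∀ l < G.k, s₁.arr 14 l = q.sel l := by
    simpa [s₁, LoopProg.den] using h2.sel
  have e3 : s₁.arr 3 = s.arr 3 := by
    simp only [s₁, LoopProg.den, RamState.arr_setReg]
    exact den_arr (by decide) _
  have hcheck := den_loop (x := 16) (n := 2) (N := G.r)
    (p := colorCount ⨾ ite (.get 6 (.var 22)) (.get 7 (.var 16)) (assign 26 (.lit 0)) skip)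
    (fun j s' => Rep G α c p s' ∧ Cov G q.W s' ∧ s'.reg 26 = ind (q.ok = true ∧ ∀ j' < j,
      (G.D - (G.k + G.k)) * G.t j' ≤ G.D * (G.col q.W j').card)) h₁.r
    ⟨h₁.setReg _ _ (by simp), by simpa [Cov] using c₁, by simpa using e26⟩ ?_
  · set s₂ := (loop 16 2 (colorCount ⨾ ite (.get 6 (.var 22)) (.get 7 (.var 16))
      (assign 26 (.lit 0)) skip)).den s₁ with hs₂
    obtain ⟨h₂, -, g26⟩ := hcheck
    have g26 : s₂.reg 26 = ind (G.accepts c) := g26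
    have g14 : s₂.arr 14 = s₁.arr 14 := den_arr (by decide) _
    have g3 : s₂.arr 3 = s.arr 3 := by rw [← e3]; exact den_arr (by decide) _
    rw [LoopProg.den, eval_lit, eval_var, g26]
    constructor
    · intro hacc
      rw [if_pos (by simpa using hacc), LoopProg.den,
        den_mapLoop 0 (fun _ => 0) h₂.n (by simp) (by simp)]
      set s₃ := (s₂.setArr 3 fun y => if 0 ≤ y ∧ y < 0 + G.n then 0 else s₂.arr 3 y).setReg 11 G.n
        with hs₃
      have h₃ : Rep G α c p s₃ := (h₂.setArr 3 _ (by simp)).setReg 11 _ (by simp)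
      have := den_loop (x := 10) (n := 3) (N := G.k) (s := s₃)
        (p := store 3 (.get 14 (.var 10)) (.lit 1))
        (fun i s' => s'.arr 14 = s₁.arr 14 ∧ ∀ v < G.n, s'.arr 3 v ≠ 0 ↔ ∃ l < i, q.sel l = v) h₃.k
        ⟨by simpa [s₃] using g14, by intro v hv; simp [s₃, hv]⟩ ?_
      · exact this.2
      · rintro i hi s' hs ⟨k14, k3⟩
        refine ⟨by simpa [LoopProg.den] using k14, fun v hv => ?_⟩
        simp only [LoopProg.den, RamState.arr_setReg, RamState.arr_setArr, if_true, eval_get,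
          eval_var, hs, k14, e14 hacc.1 i hi, eval_lit, Function.update_apply]
        split_ifs with e
        · exact ⟨fun _ => ⟨i, by omega, e.symm⟩, fun _ => by omega⟩
        · rw [k3 v hv]
          constructor
          · rintro ⟨l, hl, hlv⟩
            exact ⟨l, by omega, hlv⟩
          · rintro ⟨l, hl, hlv⟩
            refine ⟨l, ?_, hlv⟩
            rcases Nat.lt_succ_iff_lt_or_eq.1 hl with h | h
            · exact h
            · subst h
              exact absurd hlv.symm e
    · intro hacc
      rw [if_neg (by simpa using hacc), LoopProg.den, g3]
  · rintro j hj s' hs ⟨h', c', g26⟩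
    rw [LoopProg.den, colorCount_spec h' hW c', hs]
    set s₂ := (s'.setReg 22 (G.col q.W j).card).setReg 12 G.m with hs₂
    have h₂ : Rep G α c p s₂ := (h'.setReg 22 _ (by simp)).setReg 12 _ (by simp)
    have e22 : s₂.reg 22 = (G.col q.W j).card := by simp [s₂]
    have e16 : s₂.reg 16 = j := by simp [s₂, hs]
    have hle : (G.col q.W j).card ≤ G.m :=
      (card_col_le _ _).trans ((Finset.card_le_card hW).trans (by simp))
    have hiff : (∀ j' < j + 1, (G.D - (G.k + G.k)) * G.t j' ≤ G.D * (G.col q.W j').card) ↔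
        (∀ j' < j, (G.D - (G.k + G.k)) * G.t j' ≤ G.D * (G.col q.W j').card) ∧
        (G.D - (G.k + G.k)) * G.t j ≤ G.D * (G.col q.W j).card := by
      constructor
      · exact fun h => ⟨fun j' hj' => h j' (by omega), h j (by omega)⟩
      · rintro ⟨h, h'⟩ j' hj'
        rcases Nat.lt_succ_iff_lt_or_eq.1 hj' with hlt | rfl
        · exact h j' hlt
        · exact h'
    rw [LoopProg.den, eval_get, eval_get, eval_var, eval_var, e22, e16, h₂.mulD _ hle, h₂.thr j hj]
    split_ifs with hlt
    · refine ⟨(h₂.setReg 26 _ (by simp)).setReg 16 _ (by simp),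
        by simpa [Cov, LoopProg.den, s₂] using c', ?_⟩
      rw [hiff, ind_false (by omega)]
      simp [LoopProg.den]
    · rw [LoopProg.den]
      refine ⟨h₂.setReg 16 _ (by simp), by simpa [Cov, s₂] using c', ?_⟩
      have : s₂.reg 26 = s'.reg 26 := by simp [s₂]
      rw [RamState.reg_setReg, if_neg (by decide), this, g26]
      congr 1
      rw [hiff]
      simp only [not_lt] at hlt
      simp [hlt]

/-! ### The next run -/

/-- Binary increment of the advice used so far. Register `9` tells whether there was no carry. -/
def nextProg : LoopProg :=
  assign 9 (.lit 0) ⨾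
  loop 11 8 (ite (.var 9) (.lit 1)
    (ite (.lit 0) (.get 8 (.sub (.sub (.var 8) (.var 11)) (.lit 1)))
      (store 8 (.sub (.sub (.var 8) (.var 11)) (.lit 1)) (.lit 0))
      (store 8 (.sub (.sub (.var 8) (.var 11)) (.lit 1)) (.lit 1) ⨾ assign 9 (.lit 1)))
    skip)

theorem nextProg_spec (h : Rep G α c p s) :
    Static G (nextProg.den s) ∧ (nextProg.den s).arr 8 = (incr 0 p α).2 ∧
      (nextProg.den s).reg 9 = ind ((incr 0 p α).1 = false) ∧
      (nextProg.den s).arr 3 = s.arr 3 := by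
  refine ⟨h.toStatic.congr (fun x hx => den_reg (p := nextProg) ?_ s)
    (fun a ha => den_arr (p := nextProg) ?_ s), ?_⟩
  · revert x; decide
  · revert a; decide
  rw [nextProg, LoopProg.den, LoopProg.den]
  -- after `i` positions, either the carry is gone, or the increment of the rest remains to be done
  have := den_loop (x := 11) (n := 8) (N := p) (s := s.setReg 9 0)
    (p := ite (.var 9) (.lit 1)
      (ite (.lit 0) (.get 8 (.sub (.sub (.var 8) (.var 11)) (.lit 1)))
        (store 8 (.sub (.sub (.var 8) (.var 11)) (.lit 1)) (.lit 0))
        (store 8 (.sub (.sub (.var 8) (.var 11)) (.lit 1)) (.lit 1) ⨾ assign 9 (.lit 1)))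
      skip)
    (fun i s' => s'.arr 3 = s.arr 3 ∧ s'.reg 8 = p ∧
      (s'.reg 9 = 0 ∧ incr 0 p α = incr 0 (p - i) (s'.arr 8) ∨
        s'.reg 9 = 1 ∧ incr 0 p α = (false, s'.arr 8)))
    (by simpa using h.pos) ⟨by simp, by simpa using h.pos, Or.inl (by simp [h.adv])⟩ ?_
  · obtain ⟨h3, -, h9 | h9⟩ := this
    · rw [Nat.sub_self] at h9
      refine ⟨?_, ?_, h3⟩
      · rw [h9.2]; rfl
      · rw [h9.2, eval_lit, h9.1]; simp [incr, ind]
    · refine ⟨?_, ?_, h3⟩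
      · rw [h9.2]; rfl
      · rw [h9.2, eval_lit, h9.1]; simp [ind]
  · rintro i hi s' hs ⟨h3, h8, h9⟩
    have hp : p - i = (p - (i + 1)) + 1 := by omega
    have hp' : p - i - 1 = p - (i + 1) := by omega
    rw [LoopProg.den, eval_var, eval_lit]
    rcases h9 with ⟨h9, hinc⟩ | ⟨h9, hinc⟩
    · rw [if_pos (by omega), LoopProg.den]
      rw [hp, incr] at hinc
      simp only [eval_get, eval_sub, eval_lit, eval_var, hs, h8, hp', zero_add] at hinc ⊢
      split_ifs with h0
      · rw [if_neg (by omega)] at hinc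
        refine ⟨by simpa [LoopProg.den] using h3, by simpa [LoopProg.den] using h8, Or.inl ⟨?_, ?_⟩⟩
        · simpa [LoopProg.den] using h9
        · simpa [LoopProg.den, hs, h8, hp'] using hinc
      · rw [if_pos (by omega)] at hinc
        refine ⟨by simpa [LoopProg.den] using h3, by simpa [LoopProg.den] using h8, Or.inr ⟨?_, ?_⟩⟩
        · simp [LoopProg.den]
        · simpa [LoopProg.den, hs, h8, hp'] using hinc
    · rw [if_neg (by omega), LoopProg.den]
      exact ⟨by simpa using h3, by simpa using h8, Or.inr ⟨by simpa using h9, by simpa using hinc⟩⟩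

end CoverData

theorem DTree.mem_toList_of_mem_rest {β : Type} {α : ℕ → ℕ} (t : DTree β) {p : ℕ} {b : β}
    (h : b ∈ t.rest α p) : b ∈ t.toList := by
  induction t generalizing p with
  | leaf b => exact h
  | node l r hl hr =>
    rw [rest] at h
    rw [toList, List.mem_append]
    split_ifs at h
    · exact (List.mem_append.1 h).imp hl id
    · exact Or.inr (hr h)

namespace CoverData

variable {G : CoverData} {s : RamState}

/-! ### Tables -/

/-- Compute `D`, the least number with `2 * k * den ≤ D * num`, by repeated addition. -/
def accuracyLoop : RamProg :=
  .whileLt (.var 28) (.var 27)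
    (.seq (.assign 28 (.add (.var 28) (.var 4))) (.assign 6 (.add (.var 6) (.lit 1))))

/-- Compute `2 * k * den`. -/
def targetProg : LoopProg :=
  assign 27 (.lit 0) ⨾ loop 10 3 (assign 27 (.add (.var 27) (.add (.var 5) (.var 5))))

theorem targetProg_spec (s : RamState) :
    (targetProg.den s).reg 27 = s.reg 3 * (s.reg 5 + s.reg 5) := by
  rw [targetProg, den_seq]
  refine (den_loop (fun i s' => s'.reg 27 = i * (s.reg 5 + s.reg 5) ∧ s'.reg 5 = s.reg 5)
    (N := s.reg 3) (by simp [LoopProg.den]) (by simp [LoopProg.den]) ?_).1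
  rintro i hi s' hs ⟨h27, h5⟩
  simp [LoopProg.den, h27, h5, Nat.succ_mul]

theorem accuracyLoop_exec {D : ℕ} (i : ℕ) (s : RamState) (hlt : ∀ i < D, i * s.reg 4 < s.reg 27)
    (hD : s.reg 27 ≤ D * s.reg 4) (h6 : s.reg 6 = D - i) (h28 : s.reg 28 = (D - i) * s.reg 4)
    (hi : i ≤ D) : RamExec accuracyLoop s (11 * i + 3)
      ((s.setReg 28 (D * s.reg 4)).setReg 6 D) := by
  induction i generalizing s with
  | zero =>
    have e : (s.setReg 28 (D * s.reg 4)).setReg 6 D = s := by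
      rw [Nat.sub_zero] at h6 h28
      rw [← h28, RamState.setReg_self, ← h6, RamState.setReg_self]
    rw [e]
    refine .whileFalse ?_
    simp only [eval_var, h28, Nat.sub_zero]
    omega
  | succ i ih =>
    have hs : D - i = D - (i + 1) + 1 := by omega
    set s₁ := s.setReg 28 ((RamExpr.add (.var 28) (.var 4)).eval s) with hs₁
    set s₂ := s₁.setReg 6 ((RamExpr.add (.var 6) (.lit 1)).eval s₁) with hs₂
    have h := ih s₂ (by simpa [s₂, s₁] using hlt) (by simpa [s₂, s₁] using hD)
      (by simp [s₂, s₁, h6, hs]) (by simp [s₂, s₁, h28, hs, Nat.succ_mul]) (by omega)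
    have e : (s₂.setReg 28 (D * s₂.reg 4)).setReg 6 D = (s.setReg 28 (D * s.reg 4)).setReg 6 D := by
      have : s₂.reg 4 = s.reg 4 := by simp [s₂, s₁]
      rw [this, hs₂, hs₁]
      rw [RamState.setReg_comm _ (show 6 ≠ 28 by decide), RamState.setReg_setReg,
        RamState.setReg_setReg]
    rw [e] at h
    have h' := RamExec.whileTrue (e₁ := .var 28) (e₂ := .var 27)
      (by simp only [eval_var, h28]; exact hlt _ (by omega))
      (.seq (.assign 28 (.add (.var 28) (.var 4)) s) (.assign 6 (.add (.var 6) (.lit 1)) s₁)) h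
    have ecost : 11 * (i + 1) + 3 = RamExpr.cost (.var 28) + RamExpr.cost (.var 27) + 1 +
      (RamExpr.cost (.add (.var 28) (.var 4)) + 1 + (RamExpr.cost (.add (.var 6) (.lit 1)) + 1)) +
        (11 * i + 3) := by
      simp only [RamExpr.cost]
      ring
    rw [ecost]
    exact h'

/-- `arr a x := x * reg y` for all `x < reg n`. Register `13` is left with `reg n * reg y`. -/
def tableProg (a n y : ℕ) : LoopProg :=
  assign 13 (.lit 0) ⨾
  loop 11 n (store a (.var 11) (.var 13) ⨾ assign 13 (.add (.var 13) (.var y)))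

theorem tableProg_spec (a n y : ℕ) (s : RamState) (hn : n ≠ 13) (hy : y ≠ 13) (hy' : y ≠ 11) :
    (∀ x < s.reg n, ((tableProg a n y).den s).arr a x = x * s.reg y) ∧
      ((tableProg a n y).den s).reg 13 = s.reg n * s.reg y := by
  rw [tableProg, den_seq]
  refine (den_loop (N := s.reg n) (fun i s' => s'.reg y = s.reg y ∧
    (∀ x < i, s'.arr a x = x * s.reg y) ∧ s'.reg 13 = i * s.reg y)
    (by simp [LoopProg.den, hn]) (by simp [LoopProg.den, hy, hy']) ?_).2
  rintro i hi s' hs ⟨hy1, ha, h13⟩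
  refine ⟨by simp [LoopProg.den, hy, hy', hy1], fun x hx => ?_, ?_⟩
  · by_cases e : x = i
    · subst e
      simp [LoopProg.den, hs, h13]
    · simp [LoopProg.den, hs, e, ha x (by omega)]
  · simp [LoopProg.den, h13, hy1, Nat.succ_mul]

/-- `arr 7 j := (D - 2 * k) * t j` -/
def thresholdProg : LoopProg :=
  loop 16 2 (assign 13 (.lit 0) ⨾
    loop 17 6 (ite (.var 17) (.add (.var 3) (.var 3)) skip
      (assign 13 (.add (.var 13) (.get 2 (.var 16))))) ⨾
    store 7 (.var 16) (.var 13))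

theorem thresholdProg_spec (s : RamState) : ∀ j < s.reg 2, (thresholdProg.den s).arr 7 j =
    (s.reg 6 - (s.reg 3 + s.reg 3)) * s.arr 2 j := by
  refine (den_loop (fun i s' => (s'.reg 3 = s.reg 3 ∧ s'.reg 6 = s.reg 6 ∧ s'.arr 2 = s.arr 2) ∧
    ∀ j < i, s'.arr 7 j = (s.reg 6 - (s.reg 3 + s.reg 3)) * s.arr 2 j) rfl (by simp) ?_).2
  rintro j hj s' hs ⟨⟨h3, h6, h2⟩, h7⟩
  rw [den_seq, den_seq]
  set s₁ := (assign 13 (.lit 0)).den s' with hs₁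
  have hl := den_loop (x := 17) (n := 6) (N := s.reg 6) (s := s₁)
    (p := ite (.var 17) (.add (.var 3) (.var 3)) skip
      (assign 13 (.add (.var 13) (.get 2 (.var 16)))))
    (fun q s' => ((s'.reg 3 = s.reg 3 ∧ s'.reg 6 = s.reg 6 ∧ s'.arr 2 = s.arr 2) ∧
      s'.reg 16 = j ∧ ∀ i < j, s'.arr 7 i = (s.reg 6 - (s.reg 3 + s.reg 3)) * s.arr 2 i) ∧
      s'.reg 13 = (q - (s.reg 3 + s.reg 3)) * s.arr 2 j) (by simp [s₁, LoopProg.den, h6])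
    ⟨⟨by simp [s₁, LoopProg.den, h3, h6, h2], by simp [s₁, LoopProg.den, hs],
      by simpa [s₁, LoopProg.den] using h7⟩, by simp [s₁, LoopProg.den]⟩ ?_
  · obtain ⟨⟨⟨k3, k6, k2⟩, k16, k7⟩, k13⟩ := hl
    rw [LoopProg.den, eval_var, eval_var, k16, k13]
    refine ⟨by simp [k3, k6, k2], fun i hi => ?_⟩
    by_cases e : i = j
    · subst e
      simp
    · simpa [e] using k7 i (by omega)
  · rintro q hq s₂ hs₂ ⟨⟨⟨k3, k6, k2⟩, k16, k7⟩, k13⟩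
    rw [LoopProg.den, eval_var, eval_add, eval_var, k3, hs₂]
    split_ifs with h
    · rw [LoopProg.den]
      refine ⟨⟨by simp [k3, k6, k2], by simpa using k16, by simpa using k7⟩, ?_⟩
      have e1 : q - (s.reg 3 + s.reg 3) = 0 := by omega
      have e2 : q + 1 - (s.reg 3 + s.reg 3) = 0 := by omega
      simp [k13, e1, e2]
    · refine ⟨⟨by simp [LoopProg.den, k3, k6, k2], by simpa [LoopProg.den] using k16,
        by simpa [LoopProg.den] using k7⟩, ?_⟩
      have e2 : q + 1 - (s.reg 3 + s.reg 3) = q - (s.reg 3 + s.reg 3) + 1 := by omega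
      simp [LoopProg.den, k13, k16, k2, e2, Nat.succ_mul]

/-- Compute the tables, and the number of rounds. -/
def tablesProg : LoopProg :=
  tableProg 4 0 1 ⨾ tableProg 5 0 0 ⨾ tableProg 6 1 6 ⨾ store 6 (.var 1) (.var 13) ⨾
  thresholdProg ⨾ assign 7 (.add (.get 4 (.var 3)) (.lit 1)) ⨾ assign 9 (.lit 1)

/-- The part of `Static` that concerns the input and the accuracy. -/
structure Input (G : CoverData) (s : RamState) : Prop where
  kn : G.k < G.n
  n : s.reg 0 = G.n
  m : s.reg 1 = G.m
  r : s.reg 2 = G.r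
  k : s.reg 3 = G.k
  D : s.reg 6 = G.D
  adj : ∀ a < G.n, ∀ b < G.m, s.arr 0 (a * G.m + b) = ind (G.adj a b = true)
  f : ∀ b < G.m, s.arr 1 b = G.f b
  t : ∀ j < G.r, s.arr 2 j = G.t j

theorem tablesProg_spec (h : Input G s) :
    Static G (tablesProg.den s) ∧ (tablesProg.den s).reg 9 = 1 ∧
      (tablesProg.den s).arr 8 = s.arr 8 := by
  have hreg : ∀ x ∈ [0, 1, 2, 3, 6], (tablesProg.den s).reg x = s.reg x := fun x hx =>
    den_reg (by revert x; decide) s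
  have harr : ∀ a ∈ [0, 1, 2, 8], (tablesProg.den s).arr a = s.arr a := fun x hx =>
    den_arr (by revert x; decide) s
  rw [tablesProg] at hreg harr ⊢
  simp only [den_seq] at hreg harr ⊢
  set s₁ := (tableProg 4 0 1).den s with hs₁
  set s₂ := (tableProg 5 0 0).den s₁ with hs₂
  set s₃ := (tableProg 6 1 6).den s₂ with hs₃
  set s₄ := (store 6 (.var 1) (.var 13)).den s₃ with hs₄
  set s₅ := thresholdProg.den s₄ with hs₅
  set s₆ := (assign 7 (.add (.get 4 (.var 3)) (.lit 1))).den s₅ with hs₆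
  set s₇ := (assign 9 (.lit 1)).den s₆ with hs₇
  have r₁ : ∀ x ∈ [0, 1, 2, 3, 6], s₁.reg x = s.reg x := fun x hx =>
    den_reg (by revert x; decide) s
  have r₂ : ∀ x ∈ [0, 1, 2, 3, 6], s₂.reg x = s.reg x := fun x hx => by
    rw [← r₁ x hx]; exact den_reg (by revert x; decide) _
  have r₃ : ∀ x ∈ [0, 1, 2, 3, 6], s₃.reg x = s.reg x := fun x hx => by
    rw [← r₂ x hx]; exact den_reg (by revert x; decide) _
  have r₅ : ∀ x ∈ [0, 1, 2, 3, 6], s₅.reg x = s.reg x := fun x hx => by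
    rw [← r₃ x hx]; exact den_reg (p := thresholdProg) (by revert x; decide) _
  have t4 := (tableProg_spec 4 0 1 s (by decide) (by decide) (by decide)).1
  have t5 := (tableProg_spec 5 0 0 s₁ (by decide) (by decide) (by decide)).1
  have t6 := tableProg_spec 6 1 6 s₂ (by decide) (by decide) (by decide)
  have t7 := thresholdProg_spec s₄
  rw [← hs₁, h.n, h.m] at t4
  rw [← hs₂, r₁ 0 (by simp), h.n] at t5
  rw [← hs₃, r₂ 1 (by simp), r₂ 6 (by simp), h.m, h.D] at t6
  have a4 : s₅.arr 4 = s₁.arr 4 := by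
    rw [hs₅, den_arr (by decide), hs₄, den_arr (by decide), hs₃, den_arr (by decide), hs₂,
      den_arr (by decide)]
  have a5 : s₅.arr 5 = s₂.arr 5 := by
    rw [hs₅, den_arr (by decide), hs₄, den_arr (by decide), hs₃, den_arr (by decide)]
  have a6 : s₅.arr 6 = s₄.arr 6 := by rw [hs₅, den_arr (by decide)]
  have e2 : s₄.arr 2 = s.arr 2 := by
    rw [hs₄, den_arr (by decide), hs₃, den_arr (by decide), hs₂, den_arr (by decide), hs₁,
      den_arr (by decide)]
  have e42 : ∀ x ∈ [0, 1, 2, 3, 6], s₄.reg x = s.reg x := fun x hx => r₃ x hx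
  rw [← hs₅, e42 2 (by simp), e42 6 (by simp), e42 3 (by simp), e2, h.r, h.D, h.k] at t7
  refine ⟨?_, by simp [s₇, LoopProg.den], harr 8 (by simp)⟩
  constructor
  · exact h.kn
  · rw [hreg 0 (by simp), h.n]
  · rw [hreg 1 (by simp), h.m]
  · rw [hreg 2 (by simp), h.r]
  · rw [hreg 3 (by simp), h.k]
  · rw [hreg 6 (by simp), h.D]
  · have : s₅.reg 3 = G.k := by rw [r₅ 3 (by simp), h.k]
    simp [s₇, s₆, LoopProg.den, this, a4, t4 _ h.kn]
  · rw [harr 0 (by simp)]; exact h.adj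
  · rw [harr 1 (by simp)]; exact h.f
  · rw [harr 2 (by simp)]; exact h.t
  · simpa [s₇, s₆, LoopProg.den, a4] using t4
  · simpa [s₇, s₆, LoopProg.den, a5] using t5
  · intro x hx
    have e1 : s₃.reg 1 = G.m := by rw [r₃ 1 (by simp), h.m]
    simp only [s₇, s₆, LoopProg.den, RamState.arr_setReg, a6, s₄, RamState.arr_setArr, if_true,
      eval_var, e1, t6.2]
    by_cases e : x = G.m
    · subst e
      simp [mul_comm]
    · rw [Function.update_of_ne e, t6.1 x (by omega), mul_comm]
  · intro j hj
    simp only [s₇, s₆, LoopProg.den, RamState.arr_setReg]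
    rw [t7 j hj, h.t j hj]

/-! ### Running through all guesses -/

/-- One run. -/
def runProg : LoopProg := guessesProg ⨾ recordProg

/-- All runs. -/
def searchLoop : RamProg := .whileLt (.lit 0) (.var 9) (.seq runProg.compile nextProg.compile)

/-- Array `3` marks the selection of an accepted run. -/
def Found (G : CoverData) (s : RamState) : Prop :=
  ∃ c, G.Consistent c ∧ G.accepts c ∧ Marks G c s

/-- The search visits the run described by the advice and all runs to its right; `L` is the list of
their outcomes. -/
theorem searchLoop_exec {M : ℕ} (hM : 1 ≤ M) (hb : ∀ x ∈ [G.n, G.m, G.r, G.k, G.D,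
    G.k * G.m + 1, G.guesses.depth], x ≤ M) (hn : 0 < G.n) (L : List Slots) {α : ℕ → ℕ}
    {s : RamState} (h : Static G s) (hα : s.arr 8 = α) (hV : G.guesses.Valid α 0)
    (hL : G.guesses.rest α 0 = L) (h9 : s.reg 9 = 1) :
    ∃ T s', RamExec searchLoop s T s' ∧
      T ≤ L.length * (runProg.size * M ^ runProg.nesting + nextProg.size * M ^ nextProg.nesting + 3)
        + 3 ∧ ((Found G s ∨ ∃ c ∈ L, G.accepts c) → Found G s') := by
  induction L generalizing α s with
  | nil =>
    exfalso
    have := rest_incr G.guesses hV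
    rw [hL] at this
    cases hc : (incr 0 ((G.guesses.walk α 0).2 - 0) α).1 with
    | false => simpa using (this.1 hc).2
    | true => simpa using (this.2 hc).2
  | cons c₀ L ih =>
    simp only [List.mem_cons, List.not_mem_nil, or_false, forall_eq_or_imp, forall_eq] at hb
    obtain ⟨b0, b1, b2, b3, b6, b7, b8⟩ := hb
    obtain ⟨T₁, hT₁, e₁⟩ := exec (p := runProg) (by decide) (s := s) hM (by
      have hsub : ∀ n ∈ runProg.bounds, n ∈ [0, 1, 2, 3, 6, 7] := by decide
      intro n hn
      have := hsub n hn
      simp only [List.mem_cons, List.not_mem_nil, or_false] at this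
      rcases this with rfl | rfl | rfl | rfl | rfl | rfl
      · rwa [h.n]
      · rwa [h.m]
      · rwa [h.r]
      · rwa [h.k]
      · rwa [h.D]
      · rwa [h.fuel])
    have hrun := recordProg_spec (guessesProg_spec h hα)
    set s₁ := runProg.den s with hs₁
    obtain ⟨h₁, hacc, hrej⟩ := hrun
    have h3 : (guessesProg.den s).arr 3 = s.arr 3 := den_arr (by decide) s
    rw [h3] at hrej
    change Rep G α _ _ s₁ at h₁
    change _ → Marks G _ s₁ at hacc
    change _ → s₁.arr 3 = s.arr 3 at hrej
    have hw := walk_le α G.guesses 0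
    obtain ⟨T₂, hT₂, e₂⟩ := exec (p := nextProg) (by decide) (s := s₁) hM (by
      have hsub : ∀ n ∈ nextProg.bounds, n ∈ [8] := by decide
      intro n hn
      have := hsub n hn
      simp only [List.mem_cons, List.not_mem_nil, or_false] at this
      subst this
      rw [h₁.pos]
      omega)
    obtain ⟨g1, g2, g3, g4⟩ := nextProg_spec h₁
    set s₂ := nextProg.den s₁ with hs₂
    have hinc := rest_incr G.guesses hV
    rw [Nat.sub_zero] at hinc
    have hc0 : (G.guesses.walk α 0).1 = c₀ := by
      cases hc : (incr 0 (G.guesses.walk α 0).2 α).1 with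
      | false =>
        have := (hinc.1 hc).2
        rw [hL] at this
        exact (List.cons.inj this).1.symm
      | true =>
        have := (hinc.2 hc).2
        rw [hL] at this
        exact (List.cons.inj this).1.symm
    rw [hc0] at h₁ hacc hrej
    have hcons : G.Consistent c₀ :=
      (all_guesses hn).of_mem c₀ (mem_toList_of_mem_rest _ (p := 0) (α := α) (by rw [hL]; simp))
    have hF : (Found G s ∨ G.accepts c₀) → Found G s₂ := by
      intro hor
      by_cases ha : G.accepts c₀
      · refine ⟨c₀, hcons, ha, ?_⟩
        rw [Marks, g4]
        exact hacc ha
      · obtain ⟨c, hc1, hc2, hc3⟩ := hor.resolve_right ha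
        refine ⟨c, hc1, hc2, ?_⟩
        rw [Marks, g4, hrej ha]
        exact hc3
    have hcost : RamExpr.cost (.lit 0) + RamExpr.cost (.var 9) + 1 = 3 := rfl
    have hcond : (RamExpr.lit 0).eval s < (RamExpr.var 9).eval s := by simp [h9]
    cases hc : (incr 0 (G.guesses.walk α 0).2 α).1 with
    | false =>
      obtain ⟨hV', hL'⟩ := hinc.1 hc
      rw [hL] at hL'
      rw [hc] at g3
      obtain ⟨T₃, s₃, e₃, hT₃, hF₃⟩ := ih g1 g2 hV' (List.cons.inj hL').2.symm
        (by rw [g3]; simp [ind])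
      refine ⟨_, s₃, .whileTrue hcond (.seq e₁ e₂) e₃, ?_, fun hor => hF₃ ?_⟩
      · rw [hcost, List.length_cons, Nat.succ_mul]
        omega
      · rcases hor with hor | ⟨c, hcL, hca⟩
        · exact Or.inl (hF (Or.inl hor))
        · rcases List.mem_cons.1 hcL with rfl | hcL
          · exact Or.inl (hF (Or.inr hca))
          · exact Or.inr ⟨c, hcL, hca⟩
    | true =>
      have hL' := (hinc.2 hc).2
      rw [hL] at hL'
      obtain rfl : L = [] := (List.cons.inj hL').2
      rw [hc] at g3
      refine ⟨_, s₂, .whileTrue hcond (.seq e₁ e₂) (.whileFalse ?_), ?_, fun hor => hF ?_⟩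
      · rw [eval_lit, eval_var, g3]
        simp [ind]
      · rw [hcost]
        simp only [List.length_cons, List.length_nil]
        omega
      · simpa using hor

end CoverData

namespace PCCDS

variable (I : PCCDS)

/-! ### From an instance to its numbered form -/

/-- The instance with vertices and colours as natural numbers, and the accuracy `D`. -/
def toData (D : ℕ) : CoverData where
  n := I.n
  m := I.m
  r := I.r
  k := I.k
  D := D
  adj a b := if h : a < I.n ∧ b < I.m then I.adj ⟨a, h.1⟩ ⟨b, h.2⟩ else false
  f b := if h : b < I.m then (I.f ⟨b, h⟩ : ℕ) else 0
  t j := if h : j < I.r then I.t ⟨j, h⟩ else 0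

variable {I} {D : ℕ}

theorem toData_adj (a : Fin I.n) (b : Fin I.m) : (I.toData D).adj a b = I.adj a b := by
  simp [toData]

theorem toData_f (b : Fin I.m) : (I.toData D).f b = I.f b := by
  simp [toData]

theorem toData_t (j : Fin I.r) : (I.toData D).t j = I.t j := by
  simp [toData]

theorem toData_kfree {d : ℕ} (h : I.KFree d) : (I.toData D).KFree d := by
  intro S hS T hT hSd hTd hadj
  have hS' : ∀ x ∈ S, x < I.n := fun x hx => Finset.mem_range.1 (hS hx)
  have hT' : ∀ x ∈ T, x < I.m := fun x hx => Finset.mem_range.1 (hT hx)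
  refine h ⟨S.attachFin hS', T.attachFin hT', by simpa using hSd, by simpa using hTd, ?_⟩
  intro x hx y hy
  rw [← toData_adj (D := D)]
  exact hadj x (Finset.mem_attachFin hS' |>.1 hx) y (Finset.mem_attachFin hT' |>.1 hy)

/-- Neighbourhoods in the two forms of the instance have the same size. -/
theorem card_nbr (S : Finset (Fin I.n)) (j : Fin I.r) (o : ℕ → ℕ) (K : ℕ)
    (hS : ∀ a : Fin I.n, a ∈ S ↔ ∃ l < K, o l = a) (ho : ∀ l < K, o l < I.n) :
    (I.nbr j S).card = ((I.toData D).col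
      ((Finset.range K).biUnion fun l => (I.toData D).nb (o l)) j).card := by
  rw [← Finset.card_map Fin.valEmbedding]
  congr 1
  ext b
  simp only [nbr, Finset.mem_map, Finset.mem_filter, Finset.mem_univ, true_and,
    Fin.valEmbedding_apply, CoverData.col, Finset.mem_biUnion, Finset.mem_range, CoverData.mem_nb]
  constructor
  · rintro ⟨b, ⟨hf, a, ha, hab⟩, rfl⟩
    obtain ⟨l, hl, hla⟩ := (hS a).1 ha
    refine ⟨⟨l, hl, b.2, ?_⟩, by rw [toData_f, hf]⟩
    rw [hla, toData_adj, hab]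
  · rintro ⟨⟨l, hl, hb, hab⟩, hf⟩
    refine ⟨⟨b, hb⟩, ⟨?_, ⟨o l, ho l hl⟩, (hS _).2 ⟨l, hl, rfl⟩, ?_⟩, rfl⟩
    · have hf' := toData_f (D := D) (I := I) ⟨b, hb⟩
      exact Fin.ext (by rw [← hf', hf])
    · rw [← toData_adj (D := D)]
      exact hab

/-- A solution can be listed with repetitions in exactly `k` slots. -/
theorem exists_slots (h : I.IsYes) (hn : 0 < I.n) : ∃ o : ℕ → ℕ, (∀ i < I.k, o i < I.n) ∧
    ∀ j < I.r, (I.toData D).t j ≤ ((I.toData D).col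
      ((Finset.range I.k).biUnion fun l => (I.toData D).nb (o l)) j).card := by
  obtain ⟨S, hSk, hS⟩ := h
  -- a solution with fewer than `k` vertices is padded with the vertex `0`
  set l := S.toList with hl
  have hlen : l.length ≤ I.k := by simpa [hl] using hSk
  let o : ℕ → ℕ := fun i => (l.getD i ⟨0, hn⟩ : Fin I.n)
  refine ⟨o, fun i _ => (l.getD i ⟨0, hn⟩).2, fun j hj => ?_⟩
  have h1 := card_nbr (D := D) (Finset.univ.filter fun a : Fin I.n => ∃ l < I.k, o l = a)
    ⟨j, hj⟩ o I.k (by simp) (fun i _ => (l.getD i ⟨0, hn⟩).2)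
  refine le_trans ?_ h1.le
  rw [toData_t (D := D) ⟨j, hj⟩]
  refine (hS ⟨j, hj⟩).trans (Finset.card_le_card fun b hb => ?_)
  obtain ⟨hf, a, ha, hab⟩ := (Finset.mem_filter.1 hb).2
  refine Finset.mem_filter.2 ⟨Finset.mem_univ _, hf, a, ?_, hab⟩
  refine Finset.mem_filter.2 ⟨Finset.mem_univ _, ?_⟩
  obtain ⟨i, hi, hia⟩ := List.getElem_of_mem (Finset.mem_toList.2 ha)
  refine ⟨i, by rw [← hl] at hi; omega, ?_⟩
  simp only [o, hl]
  rw [List.getD_eq_getElem _ _ hi, hia]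

/-- An accepted selection that is marked in array `3` is a good output. -/
theorem good_of_found {s : RamState} (h : (I.toData D).Found s) :
    (I.output s).card ≤ I.k ∧ ∀ j : Fin I.r,
      (D - (I.k + I.k)) * I.t j ≤ D * (I.nbr j (I.output s)).card := by
  obtain ⟨c, hc, ⟨hok, hacc⟩, hm⟩ := h
  set G := I.toData D with hG
  have hsel : ∀ l < I.k, (G.pass c G.k).sel l < I.n := fun l hl =>
    Finset.mem_range.1 (hc.sub l hl (Finset.mem_filter.1 (CoverData.pass_sel_mem hok hl)).1)
  have hmem : ∀ a : Fin I.n, a ∈ I.output s ↔ ∃ l < I.k, (G.pass c G.k).sel l = a := by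
    intro a
    rw [output, Finset.mem_filter]
    exact ⟨fun h => (hm a a.2).1 h.2, fun h => ⟨Finset.mem_univ _, (hm a a.2).2 h⟩⟩
  constructor
  · rw [← Finset.card_map Fin.valEmbedding]
    refine (Finset.card_le_card (t := (Finset.range I.k).image (G.pass c G.k).sel) ?_).trans
      (Finset.card_image_le.trans (Finset.card_range _).le)
    intro v hv
    obtain ⟨a, ha, rfl⟩ := Finset.mem_map.1 hv
    obtain ⟨l, hl, e⟩ := (hmem a).1 ha
    exact Finset.mem_image.2 ⟨l, Finset.mem_range.2 hl, e⟩
  · intro j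
    have h1 := card_nbr (D := D) (I.output s) j _ I.k hmem hsel
    have h2 := CoverData.pass_cover hc hok
    have h3 := hacc j j.2
    rw [h2, toData_t] at h3
    rw [h1]
    exact h3

/-! ### The program -/

/-- The search for a good selection, in the cases that are not trivial. -/
def searchProg : RamProg :=
  .seq CoverData.targetProg.compile (.seq CoverData.accuracyLoop
    (.seq CoverData.tablesProg.compile CoverData.searchLoop))

/-- Mark all vertices. -/
def allProg : LoopProg := mapLoop 3 11 0 (.var 11) (.lit 1)

/-- The algorithm. If `n ≤ k`, then all vertices are selected. If `k = 0`, `r = 0` or `1 ≤ ε`, then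
none are. -/
def mainProg : RamProg :=
  .ifLt (.var 3) (.var 0)
    (.ifLt (.lit 0) (.var 3) (.ifLt (.lit 0) (.var 2) (.ifLt (.var 4) (.var 5)
      searchProg .skip) .skip) .skip)
    allProg.compile

theorem input_adj (ε : ℚ) {a b : ℕ} (ha : a < I.n) (hb : b < I.m) :
    (I.input ε).arr 0 (a * I.m + b) = ind ((I.toData D).adj a b = true) := by
  have hiff : (∃ (a' : Fin I.n) (b' : Fin I.m), a * I.m + b = (a' : ℕ) * I.m + (b' : ℕ) ∧
      I.adj a' b' = true) ↔ (I.toData D).adj a b = true := by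
    constructor
    · rintro ⟨a', b', e, h⟩
      have e1 : a = a' := (CoverData.row_iff hb).1 (by rw [e]; have := b'.2; omega)
      have e2 : b = b' := by rw [e1] at e; omega
      rw [e1, e2, toData_adj, h]
    · intro h
      exact ⟨⟨a, ha⟩, ⟨b, hb⟩, rfl, by rw [← toData_adj (D := D)]; exact h⟩
  simp only [input, ind]
  by_cases h : (I.toData D).adj a b = true
  · rw [if_pos (hiff.2 h), if_pos h]
  · rw [if_neg (mt hiff.1 h), if_neg h]

/-- The state after the computation of `D` meets the requirements of the search. -/
theorem input_data {ε : ℚ} {s : RamState} (hkn : I.k < I.n)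
    (hr : ∀ x ∈ [0, 1, 2, 3], s.reg x = (I.input ε).reg x) (hD : s.reg 6 = D)
    (ha : s.arr = (I.input ε).arr) : (I.toData D).Input s := by
  constructor
  · exact hkn
  · exact hr 0 (by simp)
  · exact hr 1 (by simp)
  · exact hr 2 (by simp)
  · exact hr 3 (by simp)
  · exact hD
  · intro a h b h'
    rw [ha]
    exact input_adj ε h h'
  · intro b hb
    rw [ha]
    rfl
  · intro j hj
    rw [ha]
    rfl

/-- The exponent in the bound on the time of a single run, to the base of a common bound on all loop
counters. -/
def timeExponent : ℕ :=
  CoverData.targetProg.nesting + CoverData.tablesProg.nesting + CoverData.runProg.nesting +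
    CoverData.nextProg.nesting + 1

/-- The constant factor in the bound on the time of the search. -/
def timeFactor : ℕ :=
  CoverData.targetProg.size + CoverData.tablesProg.size + CoverData.runProg.size +
    CoverData.nextProg.size + 25

theorem le_factor {N x : ℕ} (h : x ≤ 3 * N ^ 3) : x ≤ 3 * N ^ 3 * (D + 1) :=
  h.trans (Nat.le_mul_of_pos_right _ (by omega))

/-- The search halts in time proportional to the number of runs, up to a polynomial factor, and finds
a good selection in a yes-instance. -/
theorem searchProg_exec {ε : ℚ} (hkn : I.k < I.n)
    (hD : I.k * (ε.den + ε.den) ≤ D * ε.num.toNat)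
    (hD' : ∀ i < D, i * ε.num.toNat < I.k * (ε.den + ε.den)) :
    ∃ T s, RamExec searchProg (I.input ε) T s ∧
      T ≤ timeFactor * ((3 * (I.n + I.m + 1) ^ 3 * (D + 1)) ^ timeExponent *
        (I.toData D).guesses.size) ∧ (I.IsYes → (I.toData D).Found s) := by
  set N := I.n + I.m + 1 with hN
  set M := 3 * N ^ 3 * (D + 1) with hM
  set G := I.toData D with hG
  have hrm : I.r ≤ I.m := by simpa using Fintype.card_le_of_surjective I.f I.f_surj
  have hN1 : 1 ≤ N := by omega
  have hN13 : N ≤ N ^ 3 := Nat.le_self_pow (by omega) N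
  have hN23 : N * N ≤ N ^ 3 := by
    calc N * N = N ^ 2 := by ring
      _ ≤ N ^ 3 := Nat.pow_le_pow_right hN1 (by omega)
  have hkm : I.k * I.m + 1 ≤ N * N := by
    have h1 : I.k * I.m ≤ N * I.m := Nat.mul_le_mul_right _ (by omega)
    have h2 : N * (I.m + 1) ≤ N * N := Nat.mul_le_mul_left _ (by omega)
    rw [mul_add] at h2
    omega
  have hM1 : 1 ≤ M := le_factor (by omega)
  have bD : D ≤ M := by
    calc D ≤ 1 * (D + 1) := by omega
      _ ≤ _ := Nat.mul_le_mul_right _ (by omega)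
  have bn : I.n ≤ M := le_factor (by omega)
  have bm : I.m ≤ M := le_factor (by omega)
  have br : I.r ≤ M := le_factor (by omega)
  have bk : I.k ≤ M := le_factor (by omega)
  have bkm : I.k * I.m + 1 ≤ M := le_factor (by omega)
  have bdepth : G.guesses.depth ≤ M := by
    refine CoverData.depth_guesses.trans ?_
    change I.k * (I.r * D) + (I.k * I.m + 1) * (I.r + I.m) ≤ M
    have h1 : I.k * (I.r * D) ≤ N ^ 3 * (D + 1) := by
      calc I.k * (I.r * D) ≤ N * (N * (D + 1)) := by gcongr <;> omega
        _ = N * N * (D + 1) := by ring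
        _ ≤ _ := Nat.mul_le_mul_right _ hN23
    have h2 : (I.k * I.m + 1) * (I.r + I.m) ≤ 2 * N ^ 3 * (D + 1) := by
      calc (I.k * I.m + 1) * (I.r + I.m) ≤ (N * N) * (N + N) := by gcongr <;> omega
        _ = 2 * N ^ 3 * 1 := by ring
        _ ≤ _ := Nat.mul_le_mul_left _ (by omega)
    calc _ ≤ N ^ 3 * (D + 1) + 2 * N ^ 3 * (D + 1) := add_le_add h1 h2
      _ = M := by rw [hM]; ring
  -- the four parts of the program
  obtain ⟨T₁, hT₁, e₁⟩ := exec (p := CoverData.targetProg) (by decide) (s := I.input ε) hM1 (by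
    have hsub : ∀ n ∈ CoverData.targetProg.bounds, n ∈ [3] := by decide
    intro n hn
    have := hsub n hn
    simp only [List.mem_cons, List.not_mem_nil, or_false] at this
    subst this
    exact bk)
  have h27 := CoverData.targetProg_spec (I.input ε)
  have hreg : ∀ x ∈ [0, 1, 2, 3, 4, 6, 28], (CoverData.targetProg.den (I.input ε)).reg x =
      (I.input ε).reg x := fun x hx => den_reg (by revert x; decide) _
  have harr : (CoverData.targetProg.den (I.input ε)).arr = (I.input ε).arr :=
    funext fun a => den_arr (by revert a; simp [CoverData.targetProg, arrs]) _
  set s₁ := CoverData.targetProg.den (I.input ε) with hs₁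
  have f27 : s₁.reg 27 = I.k * (ε.den + ε.den) := h27
  have f4 : s₁.reg 4 = ε.num.toNat := hreg 4 (by simp)
  have e₂ := CoverData.accuracyLoop_exec (D := D) D s₁ (by rwa [f27, f4]) (by rwa [f27, f4])
    (by rw [hreg 6 (by simp), Nat.sub_self]; rfl)
    (by rw [hreg 28 (by simp), Nat.sub_self, Nat.zero_mul]; rfl) le_rfl
  set s₂ := (s₁.setReg 28 (D * s₁.reg 4)).setReg 6 D with hs₂
  have hin : G.Input s₂ := input_data (ε := ε) hkn (by
    intro x hx
    have h6 : x ≠ 6 := by rintro rfl; simp at hx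
    have h28 : x ≠ 28 := by rintro rfl; simp at hx
    have hx' : x ∈ [0, 1, 2, 3, 4, 6, 28] := by revert x; decide
    simp only [s₂, RamState.reg_setReg, h6, h28, if_false]
    exact hreg x hx') (by simp [s₂]) harr
  obtain ⟨T₃, hT₃, e₃⟩ := exec (p := CoverData.tablesProg) (by decide) (s := s₂) hM1 (by
    have hsub : ∀ n ∈ CoverData.tablesProg.bounds, n ∈ [0, 1, 2, 6] := by decide
    intro n hn
    have := hsub n hn
    simp only [List.mem_cons, List.not_mem_nil, or_false] at this
    rcases this with rfl | rfl | rfl | rfl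
    · rw [hin.n]; exact bn
    · rw [hin.m]; exact bm
    · rw [hin.r]; exact br
    · rw [hin.D]; exact bD)
  obtain ⟨hst, h9, h8⟩ := CoverData.tablesProg_spec hin
  set s₃ := CoverData.tablesProg.den s₂ with hs₃
  have hα : s₃.arr 8 = fun _ => 0 := by
    rw [h8]
    show s₁.arr 8 = _
    rw [harr]
    rfl
  obtain ⟨T₄, s₄, e₄, hT₄, hF⟩ := CoverData.searchLoop_exec (G := G) hM1
    (by
      simp only [List.mem_cons, List.not_mem_nil, or_false, forall_eq_or_imp, forall_eq]
      exact ⟨bn, bm, br, bk, bD, bkm, bdepth⟩)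
    hst.n_pos G.guesses.toList hst hα (valid_of_zero _ fun _ _ => rfl)
    (rest_of_zero _ fun _ _ => rfl) h9
  refine ⟨_, s₄, .seq e₁ (.seq e₂ (.seq e₃ e₄)), ?_, fun hyes => hF (Or.inr ?_)⟩
  · rw [length_toList] at hT₄
    set L := G.guesses.size with hL
    have hL1 : 1 ≤ L := one_le_size _
    set Y := M ^ timeExponent with hY
    have hpow : ∀ e ≤ timeExponent, M ^ e ≤ Y := fun e he => Nat.pow_le_pow_right hM1 he
    have hMY : M ≤ Y := by simpa using hpow 1 (by unfold timeExponent; omega)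
    have hYL : Y ≤ Y * L := Nat.le_mul_of_pos_right _ hL1
    have k1 : T₁ ≤ CoverData.targetProg.size * (Y * L) := hT₁.trans
      (Nat.mul_le_mul_left _ ((hpow _ (by unfold timeExponent; omega)).trans hYL))
    have k3 : T₃ ≤ CoverData.tablesProg.size * (Y * L) := hT₃.trans
      (Nat.mul_le_mul_left _ ((hpow _ (by unfold timeExponent; omega)).trans hYL))
    have k4 : L * (CoverData.runProg.size * M ^ CoverData.runProg.nesting +
        CoverData.nextProg.size * M ^ CoverData.nextProg.nesting + 3) ≤
        (CoverData.runProg.size + CoverData.nextProg.size + 3) * (Y * L) := by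
      have p1 := Nat.mul_le_mul_left CoverData.runProg.size
        (hpow CoverData.runProg.nesting (by unfold timeExponent; omega))
      have p2 := Nat.mul_le_mul_left CoverData.nextProg.size
        (hpow CoverData.nextProg.nesting (by unfold timeExponent; omega))
      calc _ ≤ L * (CoverData.runProg.size * Y + CoverData.nextProg.size * Y + 3 * Y) :=
            Nat.mul_le_mul_left _ (by omega)
        _ = _ := by ring
    simp only [timeFactor, add_mul] at k4 ⊢
    omega
  · obtain ⟨o, ho, hsol⟩ := exists_slots (D := D) hyes (by omega)
    exact (CoverData.ex_guesses (G := G) hst.n_pos ho hsol).exists_mem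

/-! ### The running time -/

/-- The exponent of the running time, up to a constant factor. -/
noncomputable def rate (I : PCCDS) (ε : ℚ) (d : ℕ) : ℝ :=
  (I.k : ℝ) ^ 4 * (I.r : ℝ) ^ 2 * (d : ℝ) * Real.log ((I.r : ℝ) + 1) / (ε : ℝ)

theorem rate_nonneg {ε : ℚ} (hε : 0 < ε) (d : ℕ) : 0 ≤ I.rate ε d := by
  have h1 : (0 : ℝ) < ε := by exact_mod_cast hε
  have h2 : 0 ≤ Real.log ((I.r : ℝ) + 1) := Real.log_nonneg (by
    have : (0 : ℝ) ≤ I.r := Nat.cast_nonneg _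
    linarith)
  unfold rate
  positivity

/-- A bound in natural numbers implies the bound with real exponents. -/
theorem time_le_of_nat {ε : ℚ} (hε : 0 < ε) {d A B E C T y : ℕ}
    (hT : T ≤ A * (I.n + I.m + 1) ^ B * 2 ^ (E * y)) (hy : (y : ℝ) ≤ 6 * I.rate ε d)
    (hA : A ≤ C) (hB : B ≤ C) (hE : 6 * E ≤ C) :
    (T : ℝ) ≤ C * (2 : ℝ) ^ ((C : ℝ) *
        ((I.k : ℝ) ^ 4 * (I.r : ℝ) ^ 2 * (d : ℝ) * Real.log ((I.r : ℝ) + 1) / (ε : ℝ))) *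
          ((I.n : ℝ) + (I.m : ℝ) + 1) ^ C := by
  change (T : ℝ) ≤ C * (2 : ℝ) ^ ((C : ℝ) * I.rate ε d) * ((I.n : ℝ) + (I.m : ℝ) + 1) ^ C
  have hX := I.rate_nonneg hε d
  have h1 : (T : ℝ) ≤ A * ((I.n : ℝ) + I.m + 1) ^ B * (2 : ℝ) ^ (E * y) := by exact_mod_cast hT
  have hN : (1 : ℝ) ≤ (I.n : ℝ) + I.m + 1 := by
    have : (0 : ℝ) ≤ (I.n : ℝ) + I.m := by positivity
    linarith
  have h2 : ((I.n : ℝ) + I.m + 1) ^ B ≤ ((I.n : ℝ) + I.m + 1) ^ C := pow_le_pow_right₀ hN hB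
  have h3 : (2 : ℝ) ^ (E * y) ≤ (2 : ℝ) ^ ((C : ℝ) * I.rate ε d) := by
    rw [← Real.rpow_natCast]
    refine Real.rpow_le_rpow_of_exponent_le (by norm_num) ?_
    push_cast
    have hE' : 6 * (E : ℝ) ≤ C := by exact_mod_cast hE
    calc (E : ℝ) * y ≤ E * (6 * I.rate ε d) := by gcongr
      _ = (6 * E) * I.rate ε d := by ring
      _ ≤ C * I.rate ε d := by gcongr
  have hA' : (A : ℝ) ≤ C := by exact_mod_cast hA
  calc (T : ℝ) ≤ A * ((I.n : ℝ) + I.m + 1) ^ B * (2 : ℝ) ^ (E * y) := h1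
    _ ≤ C * ((I.n : ℝ) + I.m + 1) ^ C * (2 : ℝ) ^ ((C : ℝ) * I.rate ε d) := by gcongr
    _ = _ := by ring

/-- The exponent in the bound on the number of runs is at most linear in the rate, since
`D ≤ 3 k / ε`. -/
theorem accuracy_le {ε : ℚ} (hε : 0 < ε) (hε1 : ε < 1) (hk : 0 < I.k) (hr : 0 < I.r)
    (hD' : ∀ i < D, i * ε.num.toNat < I.k * (ε.den + ε.den)) (d : ℕ) :
    ((I.k * I.r * d * D : ℕ) : ℝ) ≤ 6 * I.rate ε d := by
  have hε' : (0 : ℝ) < ε := by exact_mod_cast hε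
  have hε1' : (ε : ℝ) < 1 := by exact_mod_cast hε1
  have hk' : (1 : ℝ) ≤ I.k := by exact_mod_cast hk
  have hr' : (1 : ℝ) ≤ I.r := by exact_mod_cast hr
  have hD : (D : ℝ) * ε ≤ 3 * I.k := by
    rcases Nat.eq_zero_or_pos D with h0 | h0
    · rw [h0]
      simp
    · have h1 := hD' (D - 1) (by omega)
      have h2 : ((D - 1 : ℕ) : ℝ) * (ε.num.toNat : ℝ) < I.k * (ε.den + ε.den) := by exact_mod_cast h1
      have hden : (0 : ℝ) < ε.den := by exact_mod_cast ε.den_pos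
      have hnum : ((ε.num.toNat : ℕ) : ℝ) = ε * ε.den := by
        have h3 : ((ε.num.toNat : ℕ) : ℤ) = ε.num := Int.toNat_of_nonneg (Rat.num_nonneg.2 hε.le)
        have h4 : ((ε.num.toNat : ℕ) : ℚ) = ε * ε.den := by
          rw [Rat.mul_den_eq_num]
          exact_mod_cast h3
        exact_mod_cast h4
      rw [hnum, Nat.cast_sub h0] at h2
      have h5 : ((D : ℝ) - 1) * ε < 2 * I.k := by
        have : (((D : ℝ) - 1) * ε) * ε.den < (2 * I.k) * ε.den := by
          push_cast at h2
          linarith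
        exact lt_of_mul_lt_mul_right this hden.le
      nlinarith
  have hlog : (1 : ℝ) ≤ 2 * Real.log ((I.r : ℝ) + 1) := by
    have h1 := Real.log_two_gt_d9
    have h2 : Real.log 2 ≤ Real.log ((I.r : ℝ) + 1) := Real.log_le_log (by norm_num) (by linarith)
    linarith
  have hDε : (D : ℝ) ≤ 3 * I.k / ε := by
    rw [le_div_iff₀ hε']
    exact hD
  unfold rate
  push_cast
  calc (I.k : ℝ) * I.r * d * D ≤ I.k * I.r * d * (3 * I.k / ε) := by gcongr
    _ = 3 * ((I.k : ℝ) ^ 2 * (I.r : ℝ) ^ 1 * d * 1 / ε) := by ring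
    _ ≤ 3 * ((I.k : ℝ) ^ 4 * (I.r : ℝ) ^ 2 * d * (2 * Real.log ((I.r : ℝ) + 1)) / ε) := by
      gcongr
      · norm_num
      · norm_num
    _ = _ := by ring

/-- The total time of the search, with one exponential and one polynomial factor. -/
theorem searchTime_le {d : ℕ} (hI : I.KFree d) (hkn : I.k < I.n) (hk : 0 < I.k) (hr : 0 < I.r)
    (hD : 0 < D) {T : ℕ} (hT : T ≤ timeFactor * ((3 * (I.n + I.m + 1) ^ 3 * (D + 1)) ^ timeExponent *
        (I.toData D).guesses.size)) :
    T ≤ timeFactor * 3 ^ timeExponent * (I.n + I.m + 1) ^ (3 * timeExponent) *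
      2 ^ ((timeExponent + 8) * (I.k * I.r * d * D)) := by
  have hG := toData_kfree (D := D) hI
  have hd := CoverData.kfree_pos hG
  have hsize := CoverData.size_guesses hG (show 0 < (I.toData D).n from (Nat.zero_le _).trans_lt hkn)
  change (I.toData D).guesses.size ≤ 2 ^ (D * I.r * I.k) *
      (2 * d * 2 ^ (I.r + 2 * d * D) * 2 ^ ((I.r + D) * d)) ^ I.k at hsize
  set y := I.k * I.r * d * D with hy
  have h2d : 2 * d ≤ 2 ^ (2 * d) := Nat.lt_two_pow_self.le
  have hleaf : (I.toData D).guesses.size ≤ 2 ^ (8 * y) := by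
    refine hsize.trans ?_
    calc _ ≤ 2 ^ (D * I.r * I.k) *
          (2 ^ (2 * d) * 2 ^ (I.r + 2 * d * D) * 2 ^ ((I.r + D) * d)) ^ I.k := by gcongr
      _ = 2 ^ (D * I.r * I.k + (2 * d + (I.r + 2 * d * D) + (I.r + D) * d) * I.k) := by
        rw [← pow_add, ← pow_add, ← pow_mul, ← pow_add]
      _ ≤ _ := by
        refine Nat.pow_le_pow_right (by omega) ?_
        -- each of the eight products is at most `k r d D`, as all factors are positive
        obtain ⟨k, hk'⟩ : ∃ k, I.k = k + 1 := ⟨I.k - 1, by omega⟩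
        obtain ⟨r, hr'⟩ : ∃ r, I.r = r + 1 := ⟨I.r - 1, by omega⟩
        obtain ⟨d', hd'⟩ : ∃ d', d = d' + 1 := ⟨d - 1, by omega⟩
        obtain ⟨D', hD''⟩ : ∃ D', D = D' + 1 := ⟨D - 1, by omega⟩
        have b1 : D * I.r * I.k ≤ y := by
          rw [hy, hd']
          nlinarith [Nat.zero_le (D * I.r * I.k * d')]
        have b2 : d * I.k ≤ y := by
          calc d * I.k = I.k * 1 * d * 1 := by ring
            _ ≤ _ := by rw [hy]; gcongr <;> omega
        have b3 : I.r * I.k ≤ y := by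
          calc I.r * I.k = I.k * I.r * 1 * 1 := by ring
            _ ≤ _ := by rw [hy]; gcongr <;> omega
        have b4 : d * D * I.k ≤ y := by
          calc d * D * I.k = I.k * 1 * d * D := by ring
            _ ≤ _ := by rw [hy]; gcongr; omega
        have b5 : I.r * d * I.k ≤ y := by
          calc I.r * d * I.k = I.k * I.r * d * 1 := by ring
            _ ≤ _ := by rw [hy]; gcongr; omega
        have e : D * I.r * I.k + (2 * d + (I.r + 2 * d * D) + (I.r + D) * d) * I.k =
            D * I.r * I.k + 2 * (d * I.k) + I.r * I.k + 3 * (d * D * I.k) + I.r * d * I.k := by ring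
        omega
  have hDy : D + 1 ≤ 2 ^ y := by
    refine (Nat.succ_le_of_lt Nat.lt_two_pow_self).trans (Nat.pow_le_pow_right (by omega) ?_)
    rw [hy]
    exact Nat.le_mul_of_pos_left _ (by positivity)
  refine hT.trans ?_
  calc _ ≤ timeFactor * ((3 * (I.n + I.m + 1) ^ 3 * 2 ^ y) ^ timeExponent * 2 ^ (8 * y)) := by gcongr
    _ = _ := by
      rw [mul_pow, mul_pow, ← pow_mul, ← pow_mul, add_mul, pow_add, mul_comm y]
      ring

/-! ### Correctness -/

theorem nbr_mono {S S' : Finset (Fin I.n)} (h : S ⊆ S') (j : Fin I.r) :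
    I.nbr j S ⊆ I.nbr j S' := by
  intro b hb
  obtain ⟨hf, a, ha, hab⟩ := (Finset.mem_filter.1 hb).2
  exact Finset.mem_filter.2 ⟨Finset.mem_univ _, hf, a, h ha, hab⟩

/-- The accuracy `D` is fine enough for `ε`. -/
theorem approx_of_accuracy {ε : ℚ} (hε : 0 < ε) (hk : 0 < I.k)
    (hD : I.k * (ε.den + ε.den) ≤ D * ε.num.toNat) {t N : ℕ}
    (h : (D - (I.k + I.k)) * t ≤ D * N) : (1 - (ε : ℝ)) * t ≤ N := by
  have hden : (0 : ℝ) < ε.den := by exact_mod_cast ε.den_pos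
  have hnum : ((ε.num.toNat : ℕ) : ℝ) = ε * ε.den := by
    have h3 : ((ε.num.toNat : ℕ) : ℤ) = ε.num := Int.toNat_of_nonneg (Rat.num_nonneg.2 hε.le)
    have h4 : ((ε.num.toNat : ℕ) : ℚ) = ε * ε.den := by
      rw [Rat.mul_den_eq_num]
      exact_mod_cast h3
    exact_mod_cast h4
  have h1 : (I.k : ℝ) * (ε.den + ε.den) ≤ D * (ε.num.toNat : ℝ) := by exact_mod_cast hD
  have h2 : 2 * (I.k : ℝ) ≤ D * ε := by
    rw [hnum] at h1
    have : (2 * (I.k : ℝ)) * ε.den ≤ (D * ε) * ε.den := by linarith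
    exact le_of_mul_le_mul_right this hden
  have hDpos : (0 : ℝ) < D := by
    have hkk : (0 : ℝ) < I.k := by exact_mod_cast hk
    have hε' : (0 : ℝ) < ε := by exact_mod_cast hε
    by_contra! hneg
    nlinarith
  have h3 : ((D - (I.k + I.k) : ℕ) : ℝ) * t ≤ D * N := by exact_mod_cast h
  have h4 : (D : ℝ) - (I.k + I.k) ≤ ((D - (I.k + I.k) : ℕ) : ℝ) := by
    have : D ≤ (D - (I.k + I.k)) + (I.k + I.k) := by omega
    have : (D : ℝ) ≤ ((D - (I.k + I.k) : ℕ) : ℝ) + (I.k + I.k) := by exact_mod_cast this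
    linarith
  have h5 : (D : ℝ) * ((1 - ε) * t) ≤ D * N := by
    have ht : (0 : ℝ) ≤ t := Nat.cast_nonneg _
    calc (D : ℝ) * ((1 - ε) * t) = (D - D * ε) * t := by ring
      _ ≤ ((D : ℝ) - (I.k + I.k)) * t := by gcongr; linarith
      _ ≤ ((D - (I.k + I.k) : ℕ) : ℝ) * t := by gcongr
      _ ≤ _ := h3
  exact le_of_mul_le_mul_left h5 hDpos

/-- The empty set is a good output in the trivial cases. -/
theorem good_of_trivial {ε : ℚ} (h : I.k = 0 ∨ I.r = 0 ∨ 1 ≤ ε) :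
    I.IsYes → (I.output (I.input ε)).card ≤ I.k ∧ ∀ j : Fin I.r,
      (1 - (ε : ℝ)) * (I.t j : ℝ) ≤ ((I.nbr j (I.output (I.input ε))).card : ℝ) := by
  have hout : I.output (I.input ε) = ∅ := by
    rw [output, Finset.filter_eq_empty_iff]
    intro a _
    simp [input]
  rintro ⟨S, hS, hcov⟩
  rw [hout]
  refine ⟨by simp, fun j => ?_⟩
  rcases h with h | h | h
  · have : S = ∅ := Finset.card_eq_zero.1 (by omega)
    subst this
    have h1 := hcov j
    have h2 : I.nbr j ∅ = ∅ := by simp [nbr]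
    rw [h2] at h1 ⊢
    have : I.t j = 0 := by simpa using h1
    simp [this]
  · exact absurd j.2 (by omega)
  · have h1 : (1 : ℝ) ≤ ε := by exact_mod_cast h
    have h2 : (0 : ℝ) ≤ I.t j := Nat.cast_nonneg _
    have h3 : (0 : ℝ) ≤ (I.nbr j (∅ : Finset (Fin I.n))).card := Nat.cast_nonneg _
    nlinarith

end PCCDS

open PCCDS

theorem mainTheorem5 :
    ∃ (P : RamProg) (C : ℕ), ∀ (I : PCCDS) (ε : ℚ) (d : ℕ), 0 < ε → I.KFree d →
      ∃ (T : ℕ) (s : RamState), RamExec P (I.input ε) T s ∧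
        (T : ℝ) ≤ C * (2 : ℝ) ^ ((C : ℝ) *
            ((I.k : ℝ) ^ 4 * (I.r : ℝ) ^ 2 * (d : ℝ) * Real.log ((I.r : ℝ) + 1) / (ε : ℝ))) *
          ((I.n : ℝ) + (I.m : ℝ) + 1) ^ C ∧
        (I.IsYes → (I.output s).card ≤ I.k ∧
          ∀ j : Fin I.r, (1 - (ε : ℝ)) * (I.t j : ℝ) ≤ ((I.nbr j (I.output s)).card : ℝ)) := by
  refine ⟨mainProg, timeFactor * 3 ^ timeExponent + 3 * timeExponent + 6 * (timeExponent + 8) +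
    allProg.size + allProg.nesting + 20, fun I ε d hε hI => ?_⟩
  have hinp : ∀ x, (RamExpr.var x).eval (I.input ε) = (I.input ε).reg x := fun _ => rfl
  have hc : ∀ x y, RamExpr.cost (.var x) + RamExpr.cost (.var y) + 1 = 3 := fun _ _ => rfl
  have hc' : ∀ x, RamExpr.cost (.lit 0) + RamExpr.cost (.var x) + 1 = 3 := fun _ => rfl
  have htriv : ∀ T, T ≤ 13 → T ≤ 13 * (I.n + I.m + 1) ^ 0 * 2 ^ (0 * 0) := by simp
  have hzero : ((0 : ℕ) : ℝ) ≤ 6 * I.rate ε d := by simpa using I.rate_nonneg hε d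
  by_cases hkn : I.k < I.n
  swap
  · -- all vertices may be selected
    obtain ⟨T, hT, e⟩ := exec (p := allProg) (by decide) (s := I.input ε) (M := I.n + I.m + 1)
      (by omega) (by
        have hsub : ∀ n ∈ allProg.bounds, n ∈ [0] := by decide
        intro n hn
        have := hsub n hn
        simp only [List.mem_cons, List.not_mem_nil, or_false] at this
        subst this
        change I.n ≤ _
        omega)
    refine ⟨_, _, .ifFalse hkn e, time_le_of_nat (A := allProg.size + 3) (B := allProg.nesting)
      (E := 0) (y := 0) hε ?_ hzero (by omega) (by omega) (by omega), ?_⟩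
    · have := Nat.one_le_pow allProg.nesting (I.n + I.m + 1) (by omega)
      rw [hc, add_mul, Nat.zero_mul, pow_zero, mul_one]
      omega
    · rintro ⟨S, -, hcov⟩
      have hall : I.output (allProg.den (I.input ε)) = Finset.univ := by
        rw [output, Finset.filter_true_of_mem]
        intro a _
        rw [allProg, den_mapLoop 0 (fun _ => 1) (N := I.n) rfl (by simp) (by simp)]
        simp
      rw [hall]
      refine ⟨by simpa using hkn, fun j => ?_⟩
      have h1 : (I.t j : ℝ) ≤ ((I.nbr j Finset.univ).card : ℝ) := by
        exact_mod_cast (hcov j).trans (Finset.card_le_card (nbr_mono (Finset.subset_univ S) j))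
      have h2 : (0 : ℝ) ≤ I.t j := Nat.cast_nonneg _
      have h3 : (0 : ℝ) < ε := by exact_mod_cast hε
      nlinarith
  by_cases hk : 0 < I.k
  swap
  · exact ⟨_, _, .ifTrue hkn (.ifFalse hk (.skip _)), time_le_of_nat hε
      (htriv _ (by rw [hc, hc']; omega)) hzero (by omega) (by omega) (by omega),
      good_of_trivial (Or.inl (by omega))⟩
  by_cases hr : 0 < I.r
  swap
  · exact ⟨_, _, .ifTrue hkn (.ifTrue hk (.ifFalse hr (.skip _))), time_le_of_nat hε
      (htriv _ (by rw [hc, hc', hc']; omega)) hzero (by omega) (by omega) (by omega),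
      good_of_trivial (Or.inr (Or.inl (by omega)))⟩
  have hnum : 0 < ε.num := Rat.num_pos.2 hε
  have hlt : ε.num.toNat < ε.den ↔ ε < 1 := by
    rw [← Rat.num_lt_denom_iff]
    omega
  by_cases hε1 : ε < 1
  swap
  · exact ⟨_, _, .ifTrue hkn (.ifTrue hk (.ifTrue hr (.ifFalse (mt hlt.1 hε1) (.skip _)))),
      time_le_of_nat hε (htriv _ (by rw [hc, hc', hc', hc])) hzero (by omega) (by omega)
        (by omega), good_of_trivial (Or.inr (Or.inr (not_lt.1 hε1)))⟩
  -- the least `D` with `2 k / ε ≤ D`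
  have hex : ∃ D, I.k * (ε.den + ε.den) ≤ D * ε.num.toNat :=
    ⟨I.k * (ε.den + ε.den), Nat.le_mul_of_pos_right _ (by omega)⟩
  classical
  set D := Nat.find hex with hDdef
  have hD := Nat.find_spec hex
  have hD' : ∀ i < D, i * ε.num.toNat < I.k * (ε.den + ε.den) := fun i hi =>
    not_le.1 (Nat.find_min hex hi)
  rw [← hDdef] at hD
  have hDpos : 0 < D := by
    rcases Nat.eq_zero_or_pos D with h0 | h0
    · rw [h0, Nat.zero_mul] at hD
      have := Nat.mul_pos hk (Nat.add_pos_left ε.den_pos ε.den)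
      omega
    · exact h0
  obtain ⟨T, s, e, hT, hF⟩ := searchProg_exec hkn hD hD'
  have hT' := searchTime_le hI hkn hk hr hDpos hT
  refine ⟨_, s, .ifTrue hkn (.ifTrue hk (.ifTrue hr (.ifTrue (hlt.2 hε1) e))),
    time_le_of_nat (A := timeFactor * 3 ^ timeExponent + 12) (B := 3 * timeExponent)
      (E := timeExponent + 8) hε ?_ (accuracy_le hε hε1 hk hr hD' d) (by omega) (by omega)
      (by omega), fun hyes => ?_⟩
  · rw [hc, hc', hc', hc]
    have h1 : 1 ≤ (I.n + I.m + 1) ^ (3 * timeExponent) *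
        2 ^ ((timeExponent + 8) * (I.k * I.r * d * D)) :=
      Nat.mul_pos (Nat.pow_pos (by omega)) (Nat.two_pow_pos _)
    rw [mul_assoc] at hT' ⊢
    rw [add_mul]
    omega
  · obtain ⟨h1, h2⟩ := good_of_found (hF hyes)
    exact ⟨h1, fun j => approx_of_accuracy hε hk hD (h2 j)⟩
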